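/- Let $\epsilon>0$ and let $u_0(x)=\sum_{p=1}^P\frac{c_p}{x-z_p}+\mathrm{c.c.}$ with $c_p\in\mathbb C\setminus\{0\}$, $\operatorname{Im} z_p>0$, $\operatorname{Re} z_1<\dots<\operatorname{Re} z_P$ and $\sum_{p}(c_p+c_p^*)=0$. Put $$f(x)=\sum_{p=1}^P\Big[c_p\big(\operatorname{Log}(i(x-z_p))+\tfrac{\pi i}{2}\big)+c_p^*\big(\operatorname{Log}(-i(x-z_p^*))-\tfrac{\pi i}{2}\big)\Big],\qquad h(x;\lambda)=\lambda x+f(x),$$ with principal logarithms, so that $f$ is analytic off the vertical half-lines going up from the $z_p$ and down from the $z_p^*$. For $m=1,\dots,P$ let $C_m^<$ be a contour in the domain of $f$ that starts at $i\infty$ to the left of all branch cuts and ends at $i\infty$ between the cuts of $z_m$ and $z_{m+1}$ (to the right of all cuts if $m=P$); if $ic_m/\epsilon$ is a strictly negative integer, $C_m^<$ ends at $z_m$ instead. For $\lambda<0$ define $$A^<_{mp}(\lambda)=\int_{C_m^<}\frac{e^{-ih(z;\lambda)/\epsilon}}{z-z_p}\,dz,\qquad b^<_m(\lambda)=-\lambda\int_{C_m^<}e^{-ih(z;\lambda)/\epsilon}\,dz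 .$$ A number $\lambda_j<0$ is called an eigenvalue if there is a nonzero $w$ in the Hardy space $\mathbb H^+(\mathbb R)$ of the upper half-plane with $i\epsilon w'+\lambda_j w=-\mathcal C^+[u_0w]$ on $\mathbb R$, where $\mathcal C^+[g](x)=\lim_{\delta\downarrow0}\frac1{2\pi i}\int_{\mathbb R}\frac{g(y)}{y-(x+i\delta)}\,dy$. Then $\mathbf A^<$ and $\mathbf b^<$ have analytic continuations to $\mathbb C\setminus[0,\infty)$, again denoted $\mathbf A^<$ and $\mathbf b^<$, and for $\lambda$ in this domain $D(\lambda):=\det\mathbf A^<(\lambda)$ vanishes exactly when $\lambda$ is an eigenvalue. Let $\mathbf v(\lambda)$ be the unique solution of $\mathbf A^<(\lambda)\mathbf v(\lambda)=\mathbf b^<(\lambda)$ for each $\lambda\in\mathbb C\setminus[0,\infty)$ with $D(\lambda)\ne0$. Then each component $v_p$ is analytic on $\mathbb C\setminus[0,\infty)$ except at the eigenvalues, and every eigenvalue $\lambda_j$ is a simple pole of the vector function $\mathbf v$. Moreover, for every eigenvalue $\lambda_j$ there is a unique vector $\boldsymbol\phi(\lambda_j)$ with $\mathbf A^<(\lambda_j)\boldsymbol\phi(\lambda_j)=\mathbf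 0$ and $\sum_{p}\phi_p(\lambda_j)=\lambda_j$; there is a nonzero $\mathbf m$ with $\mathbf m^{\mathsf T}\mathbf A^<(\lambda_j)=\mathbf 0$; and for every such $\mathbf m$ one has $\mathbf m^{\mathsf T}\mathbf b^<(\lambda_j)\neq0$ and, for every $p$, $$v_p(\lambda)=-i\epsilon\,\frac{\phi_p(\lambda_j)}{\lambda-\lambda_j}+(z_p+\Gamma_j)\,\phi_p(\lambda_j)+O(\lambda-\lambda_j)\quad(\lambda\to\lambda_j),$$ $$\Gamma_j=-\frac{i\epsilon}{2\lambda_j}-\frac1{2\lambda_j}\sum_{p=1}^P z_p\,\phi_p(\lambda_j)-\frac{i\epsilon}{2}\,\frac{\mathbf m^{\mathsf T}{\mathbf b^<}'(\lambda_j)}{\mathbf m^{\mathsf T}\mathbf b^<(\lambda_j)} .$$ Each component $v_p$ is meromorphic at $\lambda_j$, and the pole of $v_p$ there is simple if $\phi_p(\lambda_j)\ne0$. -/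

import Mathlib

open scoped ComplexConjugate Matrix Topology

namespace BenjaminOno

noncomputable section

/-! ### The rational potential and its antiderivative -/

/-- The potential `u₀(x) = ∑ c_p / (x - z_p) + c.c.`, evaluated at real `x`. -/
def potential {P : ℕ} (c z : Fin P → ℂ) (x : ℝ) : ℂ :=
  ∑ p, (c p / ((x : ℂ) - z p) + conj (c p / ((x : ℂ) - z p)))

/-- The antiderivative `f` of `u₀`, with vertical logarithmic branch cuts going up from the `z_p`
and down from the `conj z_p`.  The abbreviation "c.c." for complex `x` is the Schwarz reflection
of the first term. -/
def antideriv {P : ℕ} (c z : Fin P → ℂ) (x : ℂ) : ℂ :=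
  ∑ p, (c p * (Complex.log (Complex.I * (x - z p)) + Real.pi * Complex.I / 2)
    + conj (c p) * (Complex.log (-Complex.I * (x - conj (z p))) - Real.pi * Complex.I / 2))

/-- `h(x; lam) = lam x + f(x)`. -/
def phase {P : ℕ} (c z : Fin P → ℂ) (lam : ℝ) (x : ℂ) : ℂ :=
  lam * x + antideriv c z x

/-! ### Contour integrals -/

/-- Integral of `F` along the contour that comes down the vertical line `Re = a` from `a + i∞`
to the real axis, follows the real axis to `d`, and goes up the line `Re = d` to `d + i∞`. -/
def integralU (F : ℂ → ℂ) (a d : ℝ) : ℂ :=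
  -(∫ t in Set.Ioi (0 : ℝ), F ((a : ℂ) + t * Complex.I) * Complex.I)
    + (∫ s in a..d, F (s : ℂ))
    + ∫ t in Set.Ioi (0 : ℝ), F ((d : ℂ) + t * Complex.I) * Complex.I

/-- Integral of `F` along the contour that comes down the vertical line `Re = a` from `a + i∞`
to the real axis, follows the real axis to `Re w`, and goes up vertically to the point `w`. -/
def integralL (F : ℂ → ℂ) (a : ℝ) (w : ℂ) : ℂ :=
  -(∫ t in Set.Ioi (0 : ℝ), F ((a : ℂ) + t * Complex.I) * Complex.I)
    + (∫ s in a..w.re, F (s : ℂ))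
    + ∫ t in (0 : ℝ)..w.im, F ((w.re : ℂ) + t * Complex.I) * Complex.I

/-- An abscissa in `G_0`, to the left of all the `z_p`. -/
def leftAbscissa {P : ℕ} (z : Fin P → ℂ) (m : Fin P) : ℝ :=
  (z ⟨0, m.pos⟩).re - 1

/-- An abscissa of `G_m`: strictly between `Re z_m` and the real part of the next pole, or to the
right of all poles if `z_m` is the last one. -/
def rightAbscissa {P : ℕ} (z : Fin P → ℂ) (m : Fin P) : ℝ :=
  if h : (m : ℕ) + 1 < P then ((z m).re + (z ⟨(m : ℕ) + 1, h⟩).re) / 2 else (z m).re + 1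

open Classical in
/-- Integral over the contour `C_m^<`.  In general this is `U_m^<`, a contour in the domain of `f`
from `i∞` in `G_0` to `i∞` in `G_m` (passing below `z_1, …, z_m`); if `i c_m / ε` is a strictly
negative integer it is `ℓ_0(z_m)`, from `i∞` in `G_0` to `z_m`.  The contours only matter up to
deformation within the domain of `f`, and a polygonal representative is used. -/
def integralC {P : ℕ} (ε : ℝ) (c z : Fin P → ℂ) (m : Fin P) (F : ℂ → ℂ) : ℂ :=
  if ∃ n : ℕ, 0 < n ∧ Complex.I * c m / ε = -(n : ℂ) then
    integralL F (leftAbscissa z m) (z m)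
  else
    integralU F (leftAbscissa z m) (rightAbscissa z m)

/-! ### The linear system -/

/-- The entries of the matrix `A^<(lam)` for `lam < 0`. -/
def matA {P : ℕ} (ε : ℝ) (c z : Fin P → ℂ) (m p : Fin P) (lam : ℝ) : ℂ :=
  integralC ε c z m fun x => Complex.exp (-Complex.I * phase c z lam x / ε) / (x - z p)

/-- The entries of the vector `b^<(lam)` for `lam < 0`. -/
def vecB {P : ℕ} (ε : ℝ) (c z : Fin P → ℂ) (m : Fin P) (lam : ℝ) : ℂ :=
  -lam * integralC ε c z m fun x => Complex.exp (-Complex.I * phase c z lam x / ε)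

/-- The plane cut along the nonnegative real half-line. -/
def cutPlane : Set ℂ := (((↑) : ℝ → ℂ) '' Set.Ici 0)ᶜ

/-- `G` is the analytic continuation to the cut plane of the function `g`
on the negative half-line.  (It is unique on the cut plane, which is connected.) -/
def IsContinuation (g : ℝ → ℂ) (G : ℂ → ℂ) : Prop :=
  AnalyticOnNhd ℂ G cutPlane ∧ ∀ lam : ℝ, lam < 0 → G lam = g lam

/-- `A` is the continuation of the matrix `A^<` to the cut plane. -/
def IsContinuedA {P : ℕ} (ε : ℝ) (c z : Fin P → ℂ)
    (A : ℂ → Matrix (Fin P) (Fin P) ℂ) : Prop :=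
  ∀ m p, IsContinuation (matA ε c z m p) fun lam => A lam m p

/-- `b` is the continuation of the vector `b^<` to the cut plane. -/
def IsContinuedB {P : ℕ} (ε : ℝ) (c z : Fin P → ℂ) (b : ℂ → Fin P → ℂ) : Prop :=
  ∀ m, IsContinuation (vecB ε c z m) fun lam => b lam m

/-! ### Eigenvalues of the spectral problem -/

/-- The Hardy space of the upper half-plane: `w` is the boundary value, almost everywhere on the
real line, of a function analytic in the upper half-plane whose `L²` norms on horizontal lines
are bounded. -/
def MemHardyPlus (w : ℝ → ℂ) : Prop :=
  ∃ F : ℂ → ℂ, DifferentiableOn ℂ F {x | 0 < x.im} ∧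
    (∃ K : NNReal, ∀ y : ℝ, 0 < y →
      MeasureTheory.eLpNorm (fun x : ℝ => F ((x : ℂ) + y * Complex.I)) 2
        MeasureTheory.volume ≤ K) ∧
    ∀ᵐ x : ℝ, Filter.Tendsto (fun y : ℝ => F ((x : ℂ) + y * Complex.I)) (𝓝[>] 0) (𝓝 (w x))

/-- `C⁺[g](x) = l`: the Cauchy integral of `g` at `x + iδ` tends to `l` as `δ ↓ 0`. -/
def HasCauchyPlus (g : ℝ → ℂ) (x : ℝ) (l : ℂ) : Prop :=
  Filter.Tendsto
    (fun δ : ℝ => 1 / (2 * Real.pi * Complex.I) *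
      ∫ y : ℝ, g y / ((y : ℂ) - ((x : ℂ) + δ * Complex.I))) (𝓝[>] 0) (𝓝 l)

/-- `lam < 0` is an eigenvalue for the potential `u`: there is a nonzero `w` in the Hardy space
with `i ε w' + lam w = - C⁺[u w]` on the real line. -/
def IsEigenvalue (ε : ℝ) (u : ℝ → ℂ) (lam : ℝ) : Prop :=
  lam < 0 ∧ ∃ w : ℝ → ℂ, w ≠ 0 ∧ MemHardyPlus w ∧ Differentiable ℝ w ∧
    ∀ x : ℝ, HasCauchyPlus (fun y => u y * w y) x
      (-(Complex.I * ε * deriv w x + lam * w x))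

/-- The set of eigenvalues for the potential `u`, as a subset of the complex plane. -/
def eigenvalues (ε : ℝ) (u : ℝ → ℂ) : Set ℂ :=
  {lam | ∃ r : ℝ, IsEigenvalue ε u r ∧ lam = r}

/-- The constant
`Γ = -iε/(2 lam) - (1/(2 lam)) ∑ z_p φ_p - (iε/2) (mᵀ b'(lam)) / (mᵀ b(lam))`. -/
def gammaConst {P : ℕ} (ε : ℝ) (z : Fin P → ℂ) (b : ℂ → Fin P → ℂ) (lam : ℂ)
    (φ m : Fin P → ℂ) : ℂ :=
  -(Complex.I * ε) / (2 * lam) - 1 / (2 * lam) * ∑ p, z p * φ p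
    - Complex.I * ε / 2 * ((m ⬝ᵥ deriv b lam) / (m ⬝ᵥ b lam))

end

end BenjaminOno

/-! The system is the solvability condition of the equation `iεF' + (λ + u₀)F = R` with rational
`R`. The exponential `E = exp(-ih/ε)` is an integrating factor, `(EF)' = ER/(iε)`, so the integral
of `ER` over the contour of index `m` compares the solution that decays high above the poles with
its continuation from the far left, below `z_1, …, z_m`, up into the gap after `z_m`. If all these
integrals vanish, the continuations fit together to one function. At `z_m` the equation is Fuchsian
with exponent `i c_m/ε`. Unless this is a negative integer, a single-valued solution has a removable
singularity there (`fuchs_removable`); in the exceptional case `E` is single-valued near `z_m` with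
a zero there, and the contour that ends at `z_m` supplies the missing condition. Thus
`exists_solution` yields a solution holomorphic on the closed upper half-plane and decaying at
infinity, and `sysInt_eq_zero_of_solvesAt` is the converse. In these terms `Aφ` is the family of
contour functionals of `∑ φ_p/(x - z_p)`, and `b` is `-λ` times the functionals of the constant 1.

Continuation to the cut plane: high above the poles the vertical tails may be rotated to any upward
direction `ω` with `Im(λω) < 0`, because the bounded solution there is unique
(`SolvesAt.eq_raySol`). The functionals so obtained, `sysInt`, are defined on the whole cut plane
and may be differentiated in `λ` under the integral.

Everything about the singular points follows from Green's identity `integral_pairing` and the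
residue relation `c_p F(z_p) = φ_p` for the solution `F` that belongs to a kernel vector `φ`.
Pairing `F` with itself shows that `λ` is real. If `∑ φ_p = 0`, then `xF` decays too, and pairing it
with `F` gives `‖F‖ = 0`; so the kernel is at most a line, on which the sum of the entries does not
vanish. If `b` were in the range of `A`, pairing the resulting solution with `F` would again give `∑
φ_p = 0`. Kernel vectors correspond to eigenfunctions: the boundary values of `F` solve the spectral
problem by Cauchy's formula, and the Hardy extension of an eigenfunction solves the equation with
`φ_p = c_p F(z_p)`.

The Laurent expansion is then linear algebra. Since `x/(x - z_p) = 1 + z_p/(x - z_p)`,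
differentiation in `λ` closes up: `A' = (i/(ελ)) b 1ᵀ - (i/ε) A diag(z)`. Write `v = (λ - λ_j)^k g`
with `g(λ_j) ≠ 0`. As `b` is not in the range, `k < 0`. One derivative of the equation for `g`
excludes `k < -1` and fixes the residue; a second derivative, paired with the left null vector,
gives `Γ_j` (`exists_pole_expansion`, `pole_expansion_second`). -/

namespace BenjaminOno
open Complex Set Filter MeasureTheory

/-! ### Primitives on comb-shaped domains -/

/-- An open set that contains the horizontal line at height `y`, and with each of its points the
vertical segment from that point to this line. -/
structure IsComb (S : Set ℂ) (y : ℝ) : Prop where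
  isOpen : IsOpen S
  line : ∀ s : ℝ, (s : ℂ) + y * I ∈ S
  vert : ∀ x ∈ S, ∀ t ∈ uIcc y x.im, (x.re : ℂ) + t * I ∈ S

theorem IsComb.intervalIntegrable_line {S : Set ℂ} {y : ℝ} (hS : IsComb S y) {g : ℂ → ℂ}
    (hg : ContinuousOn g S) (a b : ℝ) :
    IntervalIntegrable (fun s : ℝ => g (s + y * I)) volume a b :=
  (hg.comp (by fun_prop) fun s _ => hS.line s).intervalIntegrable

theorem IsComb.intervalIntegrable_vert {S : Set ℂ} {y : ℝ} (hS : IsComb S y) {g : ℂ → ℂ}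
    (hg : ContinuousOn g S) {x : ℂ} (hx : x ∈ S) :
    IntervalIntegrable (fun t : ℝ => g (x.re + t * I)) volume y x.im :=
  (hg.comp (by fun_prop) fun t ht => hS.vert x hx t ht).intervalIntegrable

/-- The path runs along the line at height `y` and then vertically, so it stays in the comb. For `w`
in a small disk around `x`, it differs from the path through `x` by the boundary of the rectangle
between that line and the horizontal segment from `x` towards `w`. The comb property puts this
rectangle inside `S`, so Cauchy's theorem on it reduces the claim to the disk. -/
theorem IsComb.hasDerivAt_wedgeIntegral {S : Set ℂ} {y : ℝ} (hS : IsComb S y) {g : ℂ → ℂ}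
    (hg : DifferentiableOn ℂ g S) (a : ℝ) {x : ℂ} (hx : x ∈ S) :
    HasDerivAt (fun w => wedgeIntegral (a + y * I) w g) (g x) x := by
  obtain ⟨r, hr, hball⟩ := Metric.isOpen_iff.mp hS.isOpen x hx
  have h1 : HasDerivAt (fun w => wedgeIntegral x w g) (g x) x :=
    (hg.mono hball).isConservativeOn.hasDerivAt_wedgeIntegral (hg.mono hball).continuousOn
      (Metric.mem_ball_self hr)
  have key : ∀ w ∈ Metric.ball x r, wedgeIntegral (a + y * I) w g
      = wedgeIntegral (a + y * I) x g + wedgeIntegral x w g := by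
    intro w hw
    have hwS := hball hw
    have hcorner : ∀ s ∈ uIcc x.re w.re, (s : ℂ) + x.im * I ∈ Metric.ball x r := by
      intro s hs
      rw [Metric.mem_ball, Complex.dist_eq] at hw ⊢
      refine lt_of_le_of_lt ?_ hw
      have e1 : (s : ℂ) + x.im * I - x = ((s - x.re : ℝ) : ℂ) := by
        apply Complex.ext <;> simp
      rw [e1, Complex.norm_real]
      refine le_trans ?_ (abs_re_le_norm (w - x))
      simpa [abs_sub_comm] using abs_sub_left_of_mem_uIcc hs
    have hrect : (uIcc x.re w.re ×ℂ uIcc y x.im) ⊆ S := by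
      rintro p ⟨hp1, hp2⟩
      have := hS.vert _ (hball (hcorner p.re hp1)) p.im (by simpa using hp2)
      simpa using this
    have hc := integral_boundary_rect_eq_zero_of_differentiableOn g ((x.re : ℂ) + y * I)
      ((w.re : ℂ) + x.im * I) (hg.mono (by simpa using hrect))
    simp only [add_re, ofReal_re, mul_re, I_re, mul_zero, ofReal_im, I_im, mul_one, sub_self,
      add_zero, add_im, mul_im, zero_add] at hc
    have hx' : ((w.re : ℂ) + x.im * I) ∈ S := by
      exact hball (hcorner w.re right_mem_uIcc)
    have i1 := intervalIntegral.integral_add_adjacent_intervals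
      (hS.intervalIntegrable_line hg.continuousOn a x.re)
      (hS.intervalIntegrable_line hg.continuousOn x.re w.re)
    have iv1 := hS.intervalIntegrable_vert hg.continuousOn hx'
    have iv2 := hS.intervalIntegrable_vert hg.continuousOn hwS
    simp only [add_re, ofReal_re, mul_re, I_re, mul_zero, ofReal_im, I_im, mul_one, sub_self,
      add_zero, add_im, mul_im, zero_add] at iv1
    have i2 := intervalIntegral.integral_add_adjacent_intervals iv1 (iv1.symm.trans iv2)
    simp only [wedgeIntegral, add_re, ofReal_re, mul_re, I_re, mul_zero, ofReal_im, I_im, mul_one,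
      sub_self, add_zero, add_im, mul_im, zero_add, smul_eq_mul] at hc ⊢
    rw [← i1, ← i2]
    linear_combination hc
  refine (h1.const_add (wedgeIntegral (a + y * I) x g)).congr_of_eventuallyEq ?_
  filter_upwards [Metric.ball_mem_nhds x hr] with w hw using key w hw

theorem IsComb.exists_primitive {S : Set ℂ} {y : ℝ} (hS : IsComb S y) {g : ℂ → ℂ}
    (hg : DifferentiableOn ℂ g S) (x₀ v : ℂ) :
    ∃ G : ℂ → ℂ, G x₀ = v ∧ ∀ x ∈ S, HasDerivAt G (g x) x := by
  have : IsExactOn g S := ⟨_, fun x hx => hS.hasDerivAt_wedgeIntegral hg 0 hx⟩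
  exact this.with_val_at x₀ v

theorem IsComb.isPreconnected {S : Set ℂ} {y : ℝ} (hS : IsComb S y) : IsPreconnected S := by
  refine isPreconnected_of_forall ((0 : ℝ) + y * I) fun x hx => ?_
  refine ⟨(fun s : ℝ => (s : ℂ) + y * I) '' univ ∪ (fun t : ℝ => (x.re : ℂ) + t * I) '' uIcc y x.im,
    ?_, ?_, ?_, ?_⟩
  · rintro _ (⟨s, -, rfl⟩ | ⟨t, ht, rfl⟩)
    exacts [hS.line s, hS.vert x hx t ht]
  · exact Or.inl ⟨0, trivial, rfl⟩
  · exact Or.inr ⟨x.im, right_mem_uIcc, by simp⟩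
  · refine IsPreconnected.union ((x.re : ℂ) + y * I) ⟨x.re, trivial, rfl⟩ ⟨y, left_mem_uIcc, rfl⟩
      (isPreconnected_univ.image _ (by fun_prop)) (isPreconnected_uIcc.image _ (by fun_prop))

theorem eqOn_of_hasDerivAt_eq {S : Set ℂ} (hS : IsOpen S) (hS' : IsPreconnected S)
    {F G f : ℂ → ℂ} (hF : ∀ x ∈ S, HasDerivAt F (f x) x) (hG : ∀ x ∈ S, HasDerivAt G (f x) x)
    {x₀ : ℂ} (hx₀ : x₀ ∈ S) (h : F x₀ = G x₀) : EqOn F G S := by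
  intro x hx
  have := hS.is_const_of_deriv_eq_zero (f := fun x => F x - G x) hS'
    (fun x hx => ((hF x hx).sub (hG x hx)).differentiableAt.differentiableWithinAt)
    (fun x hx => by
      have h1 : HasDerivAt (fun x => F x - G x) (f x - f x) x := (hF x hx).sub (hG x hx)
      simpa using h1.deriv) hx hx₀
  simpa [h, sub_eq_zero] using this

/-! ### Cauchy's formula on the upper half-plane for decaying functions -/

/-- The filter of neighbourhoods of infinity in the closed upper half-plane. -/
noncomputable def upperInfty : Filter ℂ := Bornology.cobounded ℂ ⊓ 𝓟 {x | 0 ≤ x.im}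

theorem isBigO_upperInfty_iff {G : ℂ → ℂ} {n : ℕ} :
    G =O[upperInfty] (fun x => (x ^ n)⁻¹) ↔
      ∃ C R : ℝ, 0 < R ∧ ∀ x : ℂ, 0 ≤ x.im → R ≤ ‖x‖ → ‖G x‖ ≤ C / ‖x‖ ^ n := by
  rw [Asymptotics.isBigO_iff]
  refine exists_congr fun C => ?_
  rw [upperInfty, eventually_inf_principal,
    (Metric.hasBasis_cobounded_compl_ball (0 : ℂ)).eventually_iff]
  constructor
  · rintro ⟨R, -, h⟩
    refine ⟨max R 1, by positivity, fun x hx hR => ?_⟩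
    have := @h x (by simpa using (le_max_left _ _).trans hR) hx
    simpa [div_eq_mul_inv] using this
  · rintro ⟨R, -, h⟩
    refine ⟨R, trivial, fun x hx hx' => ?_⟩
    have := h x hx' (by simpa using hx)
    simpa [div_eq_mul_inv] using this

theorem integrable_ofReal_of_isBigO {G : ℂ → ℂ} (hG : Continuous fun x : ℝ => G x)
    (hO : G =O[upperInfty] fun x => (x ^ 2)⁻¹) : Integrable fun x : ℝ => G x := by
  refine hG.locallyIntegrable.integrable_of_isBigO_cocompact (g := fun x : ℝ => (1 + x ^ 2)⁻¹)
    ?_ (integrable_inv_one_add_sq.integrableAtFilter _)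
  obtain ⟨C, R, hR, h⟩ := isBigO_upperInfty_iff.mp hO
  refine Asymptotics.IsBigO.of_bound (2 * C) ?_
  rw [← Metric.cobounded_eq_cocompact, (Metric.hasBasis_cobounded_compl_ball (0 : ℝ)).eventually_iff]
  refine ⟨max R 1, trivial, fun x hx => ?_⟩
  have hx' : max R 1 ≤ |x| := by simpa using hx
  have h1 : 1 ≤ x ^ 2 := by
    rw [← sq_abs]; nlinarith [(le_max_right R 1).trans hx']
  have := h x (by simp) (by simpa using (le_max_left _ _).trans hx')
  rw [norm_real, Real.norm_eq_abs, sq_abs] at this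
  refine this.trans ?_
  rw [Real.norm_of_nonneg (by positivity)]
  have hC : 0 ≤ C := by
    have := (norm_nonneg _).trans this
    by_contra hc
    push Not at hc
    have : C / x ^ 2 < 0 := div_neg_of_neg_of_pos hc (by positivity)
    linarith
  rw [← div_eq_mul_inv, div_le_div_iff₀ (by positivity) (by positivity)]
  nlinarith

theorem continuous_ofReal_of_differentiableAt {G : ℂ → ℂ}
    (hG : ∀ x : ℂ, 0 ≤ x.im → DifferentiableAt ℂ G x) : Continuous fun x : ℝ => G x :=
  continuous_iff_continuousAt.mpr fun x =>
    (hG x (by simp)).continuousAt.comp (f := fun x : ℝ => (x : ℂ)) (by fun_prop)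

/-- Cauchy's theorem on the rectangle over `[-T, T]` of height `T`: the other three sides have total
length `4T` and carry values of size `T⁻²`. -/
theorem integral_eq_zero_of_isBigO {G : ℂ → ℂ}
    (hG : ∀ x : ℂ, 0 ≤ x.im → DifferentiableAt ℂ G x)
    (hO : G =O[upperInfty] fun x => (x ^ 2)⁻¹) : ∫ x : ℝ, G x = 0 := by
  have hint := integrable_ofReal_of_isBigO (continuous_ofReal_of_differentiableAt hG) hO
  have hlim := intervalIntegral_tendsto_integral (μ := volume) hint
    tendsto_neg_atTop_atBot (tendsto_id (α := ℝ))
  refine tendsto_nhds_unique hlim ?_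
  obtain ⟨C, R, hR, h⟩ := isBigO_upperInfty_iff.mp hO
  have hz : Tendsto (fun T : ℝ => 4 * (|C| / T)) atTop (𝓝 0) := by
    simpa using (tendsto_const_nhds (x := |C|)).div_atTop tendsto_id |>.const_mul 4
  refine squeeze_zero_norm' ?_ hz
  filter_upwards [eventually_ge_atTop R, eventually_gt_atTop 0] with T hT hT0
  have hrect := integral_boundary_rect_eq_zero_of_differentiableOn G (-T : ℂ) (T + T * I) (by
    rintro p ⟨-, hp⟩
    refine (hG p ?_).differentiableWithinAt
    have : p.im ∈ uIcc 0 T := by simpa using hp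
    rw [uIcc_of_le hT0.le] at this
    exact this.1)
  simp only [neg_re, ofReal_re, add_re, mul_re, I_re, mul_zero, ofReal_im, I_im, mul_one, sub_self,
      add_zero, add_im, mul_im, zero_add, neg_im, neg_zero, smul_eq_mul, zero_mul, ofReal_zero] at hrect
  have hb : ∀ x : ℂ, 0 ≤ x.im → T ≤ ‖x‖ → ‖G x‖ ≤ |C| / T ^ 2 := fun x hx hTx =>
    (h x hx (hT.trans hTx)).trans (by gcongr; exact le_abs_self C)
  have b1 : ‖∫ x : ℝ in -T..T, G (x + T * I)‖ ≤ |C| / T ^ 2 * |T - -T| := by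
    refine intervalIntegral.norm_integral_le_of_norm_le_const fun x _ => hb _ (by simp [hT0.le]) ?_
    refine le_trans (le_of_eq ?_) (abs_im_le_norm _)
    simp [abs_of_pos hT0]
  have b2 : ‖∫ x : ℝ in (0:ℝ)..T, G (T + x * I)‖ ≤ |C| / T ^ 2 * |T - 0| := by
    refine intervalIntegral.norm_integral_le_of_norm_le_const fun x hx => hb _ ?_ ?_
    · rw [uIoc_of_le hT0.le] at hx; simpa using hx.1.le
    refine le_trans (le_of_eq ?_) (abs_re_le_norm _)
    simp [abs_of_pos hT0]
  have b3 : ‖∫ x : ℝ in (0:ℝ)..T, G (-T + x * I)‖ ≤ |C| / T ^ 2 * |T - 0| := by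
    refine intervalIntegral.norm_integral_le_of_norm_le_const fun x hx => hb _ ?_ ?_
    · rw [uIoc_of_le hT0.le] at hx; simpa using hx.1.le
    refine le_trans (le_of_eq ?_) (abs_re_le_norm _)
    simp [abs_of_pos hT0]
  have e : ∫ x : ℝ in -T..T, G x = (∫ x : ℝ in -T..T, G (x + T * I))
      - I * (∫ x : ℝ in (0:ℝ)..T, G (T + x * I)) + I * ∫ x : ℝ in (0:ℝ)..T, G (-T + x * I) := by
    rw [ofReal_neg] at hrect
    linear_combination hrect
  simp only [id]
  rw [e]
  refine (norm_add_le _ _).trans ((add_le_add_left (norm_sub_le _ _) _).trans ?_)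
  rw [norm_mul, norm_mul, norm_I, one_mul, one_mul]
  have e1 : |T - -T| = 2 * T := by rw [abs_of_pos] <;> linarith
  have e2 : |T - 0| = T := by rw [abs_of_pos] <;> linarith
  rw [e1] at b1
  rw [e2] at b2 b3
  have : |C| / T ^ 2 * (2 * T) + |C| / T ^ 2 * T + |C| / T ^ 2 * T = 4 * (|C| / T) := by
    field_simp; ring
  linarith

theorem isBigO_inv_sub_upperInfty (ζ : ℂ) :
    (fun x : ℂ => (x - ζ)⁻¹) =O[upperInfty] fun x => x⁻¹ := by
  refine Asymptotics.IsBigO.inv_rev ?_ ?_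
  · refine Asymptotics.IsBigO.of_bound 2 ?_
    refine Filter.Eventually.filter_mono inf_le_left ?_
    rw [(Metric.hasBasis_cobounded_compl_ball (0 : ℂ)).eventually_iff]
    refine ⟨2 * ‖ζ‖, trivial, fun x hx => ?_⟩
    have : 2 * ‖ζ‖ ≤ ‖x‖ := by simpa using hx
    have := norm_sub_norm_le x ζ
    linarith
  · refine Filter.Eventually.filter_mono inf_le_left ?_
    rw [(Metric.hasBasis_cobounded_compl_ball (0 : ℂ)).eventually_iff]
    refine ⟨‖ζ‖ + 1, trivial, fun x hx h => ?_⟩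
    have : ‖ζ‖ + 1 ≤ ‖x‖ := by simpa using hx
    rw [h, norm_zero] at this
    linarith [norm_nonneg ζ]

theorem isBigO_pow_two_of_mul {F G : ℂ → ℂ} (hF : F =O[upperInfty] fun x => x⁻¹)
    (hG : G =O[upperInfty] fun x => x⁻¹) :
    (fun x => F x * G x) =O[upperInfty] fun x => (x ^ 2)⁻¹ := by
  simpa [sq, mul_inv] using hF.mul hG

theorem integral_div_sub_of_im_neg {G : ℂ → ℂ}
    (hG : ∀ x : ℂ, 0 ≤ x.im → DifferentiableAt ℂ G x)
    (hO : G =O[upperInfty] fun x => x⁻¹) {ζ : ℂ} (hζ : ζ.im < 0) :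
    ∫ x : ℝ, G x / (x - ζ) = 0 := by
  refine integral_eq_zero_of_isBigO (G := fun x => G x / (x - ζ)) (fun x hx => ?_) ?_
  · refine (hG x hx).div (by fun_prop) fun h => ?_
    rw [sub_eq_zero.mp h] at hx
    linarith
  · simpa [div_eq_mul_inv] using isBigO_pow_two_of_mul hO (isBigO_inv_sub_upperInfty ζ)

/-- The integrand is a multiple of the Poisson kernel; translation and scaling reduce it to the
integral of `1/(1 + x²)`. -/
theorem integral_poisson {ζ : ℂ} (hζ : 0 < ζ.im) :
    ∫ x : ℝ, (ζ - conj ζ) / (((x : ℂ) - conj ζ) * (x - ζ)) = 2 * Real.pi * I := by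
  have e : ∀ x : ℝ, (ζ - conj ζ) / (((x : ℂ) - conj ζ) * (x - ζ))
      = (2 * I / ζ.im) * (((1 + ((x - ζ.re) / ζ.im) ^ 2)⁻¹ : ℝ) : ℂ) := by
    intro x
    have h1 : ((x : ℂ) - conj ζ) * (x - ζ) = (((x - ζ.re) ^ 2 + ζ.im ^ 2 : ℝ) : ℂ) := by
      apply Complex.ext
      · simp [pow_two]
      · simp [pow_two]; ring
    have h2 : ζ - conj ζ = 2 * ζ.im * I := by apply Complex.ext <;> simp; ring
    have h3 : (ζ.im : ℂ) ≠ 0 := by exact_mod_cast hζ.ne'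
    have h4 : (((x - ζ.re) ^ 2 + ζ.im ^ 2 : ℝ) : ℂ) ≠ 0 := by
      exact_mod_cast (by positivity : (x - ζ.re) ^ 2 + ζ.im ^ 2 ≠ 0)
    have h5 : 1 + ((x - ζ.re) / ζ.im) ^ 2 = ((x - ζ.re) ^ 2 + ζ.im ^ 2) / ζ.im ^ 2 := by
      field_simp; ring
    rw [h1, h2, h5]
    push_cast at h4 ⊢
    field_simp
  simp_rw [e]
  rw [integral_const_mul, integral_complex_ofReal,
    integral_sub_right_eq_self (fun x => (1 + (x / ζ.im) ^ 2)⁻¹) ζ.re,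
    Measure.integral_comp_div (fun x => (1 + x ^ 2)⁻¹) ζ.im, integral_univ_inv_one_add_sq,
    abs_of_pos hζ]
  have h3 : (ζ.im : ℂ) ≠ 0 := by exact_mod_cast hζ.ne'
  simp only [smul_eq_mul]
  push_cast
  field_simp

/-- The function `k = (ζ - conj ζ)/(x - conj ζ)` is holomorphic on the closed half-plane, decays,
and equals 1 at `ζ`. Subtracting `G ζ * k` from `G` leaves a function with a zero at `ζ`; its
quotient by `x - ζ` is holomorphic and `O(x⁻²)`, hence integrates to zero. What remains is `G ζ`
times the Poisson integral. -/
theorem integral_div_sub_of_im_pos {G : ℂ → ℂ}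
    (hG : ∀ x : ℂ, 0 ≤ x.im → DifferentiableAt ℂ G x)
    (hO : G =O[upperInfty] fun x => x⁻¹) {ζ : ℂ} (hζ : 0 < ζ.im) :
    ∫ x : ℝ, G x / (x - ζ) = 2 * Real.pi * I * G ζ := by
  set k : ℂ → ℂ := fun x => (ζ - conj ζ) / (x - conj ζ) with hk
  have hcz : ∀ x : ℂ, 0 ≤ x.im → x - conj ζ ≠ 0 := fun x hx h => by
    rw [sub_eq_zero.mp h] at hx
    simp at hx; linarith
  have hkd : ∀ x : ℂ, 0 ≤ x.im → DifferentiableAt ℂ k x := fun x hx =>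
    (by fun_prop : DifferentiableAt ℂ (fun _ => ζ - conj ζ) x).div (by fun_prop) (hcz x hx)
  set N : ℂ → ℂ := fun x => G x - G ζ * k x with hN
  have hNd : ∀ x : ℂ, 0 ≤ x.im → DifferentiableAt ℂ N x := fun x hx =>
    (hG x hx).sub ((hkd x hx).const_mul _)
  have hN0 : N ζ = 0 := by
    have : k ζ = 1 := div_self (hcz ζ hζ.le)
    simp [hN, this]
  have hkO : k =O[upperInfty] fun x => x⁻¹ := by
    simpa [hk, div_eq_mul_inv] using (isBigO_inv_sub_upperInfty (conj ζ)).const_mul_left (ζ - conj ζ)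
  have hNO : N =O[upperInfty] fun x => x⁻¹ := hO.sub (hkO.const_mul_left _)
  have hds : ∀ x, x ≠ ζ → dslope N ζ x = N x * (x - ζ)⁻¹ := fun x hx => by
    rw [dslope_of_ne _ hx, slope_def_field, hN0, sub_zero, div_eq_mul_inv]
  have hdd : ∀ x : ℂ, 0 ≤ x.im → DifferentiableAt ℂ (dslope N ζ) x := by
    intro x hx
    by_cases hxz : x = ζ
    · subst hxz
      have hU : {y : ℂ | 0 < y.im} ∈ 𝓝 x := (isOpen_lt continuous_const continuous_im).mem_nhds hζ
      exact ((differentiableOn_dslope hU).mpr fun y hy =>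
        (hNd y (le_of_lt hy)).differentiableWithinAt).differentiableAt hU
    · exact (differentiableAt_dslope_of_ne hxz).mpr (hNd x hx)
  have hdO : dslope N ζ =O[upperInfty] fun x => (x ^ 2)⁻¹ := by
    refine (isBigO_pow_two_of_mul hNO (isBigO_inv_sub_upperInfty ζ)).congr' ?_ .rfl
    refine Filter.Eventually.filter_mono inf_le_left ?_
    rw [(Metric.hasBasis_cobounded_compl_ball (0 : ℂ)).eventually_iff]
    refine ⟨‖ζ‖ + 1, trivial, fun x hx => (hds x fun h => ?_).symm⟩
    have : ‖ζ‖ + 1 ≤ ‖x‖ := by simpa using hx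
    rw [h] at this; linarith
  have hne : ∀ x : ℝ, (x : ℂ) - ζ ≠ 0 := fun x h => by
    rw [← sub_eq_zero.mp h] at hζ; simp at hζ
  have hne' : ∀ x : ℝ, (x : ℂ) - conj ζ ≠ 0 := fun x => hcz x (by simp)
  have e : ∀ x : ℝ, G x / (x - ζ) =
      dslope N ζ x + G ζ * ((ζ - conj ζ) / (((x : ℂ) - conj ζ) * (x - ζ))) := by
    intro x
    have h1 := hne x
    have h2 := hne' x
    rw [hds x (sub_ne_zero.mp h1), hN, hk]
    field_simp
    ring
  have hi1 := integrable_ofReal_of_isBigO (continuous_ofReal_of_differentiableAt hdd) hdO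
  have hi2 : Integrable fun x : ℝ => (ζ - conj ζ) / (((x : ℂ) - conj ζ) * (x - ζ)) := by
    refine integrable_ofReal_of_isBigO (G := fun x => (ζ - conj ζ) / ((x - conj ζ) * (x - ζ))) ?_ ?_
    · exact Continuous.div (by fun_prop) (by fun_prop) fun x => mul_ne_zero (hne' x) (hne x)
    · simpa [div_eq_mul_inv, mul_comm] using (isBigO_pow_two_of_mul (isBigO_inv_sub_upperInfty
        (conj ζ)) (isBigO_inv_sub_upperInfty ζ)).const_mul_left (ζ - conj ζ)
  simp_rw [e]
  rw [integral_add hi1 (hi2.const_mul _), integral_const_mul, integral_poisson hζ,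
    integral_eq_zero_of_isBigO hdd hdO]
  ring

end BenjaminOno

namespace BenjaminOno
open Complex Set Filter MeasureTheory

/-! ### Laplace integrals -/

theorem integrableOn_exp_neg_mul {a : ℝ} (ha : 0 < a) (C : ℝ) :
    IntegrableOn (fun t => C * Real.exp (-a * t)) (Ioi 0) :=
  (integrableOn_exp_mul_Ioi (by linarith) 0).const_mul C

/-- If `q` grows subexponentially, its Laplace transform may be differentiated under the
integral sign. -/
theorem hasDerivAt_laplace {q : ℝ → ℂ} (hqm : AEStronglyMeasurable q (volume.restrict (Ioi 0)))
    (hq : ∀ κ : ℝ, 0 < κ → ∃ C : ℝ, ∀ t : ℝ, 0 < t → ‖q t‖ ≤ C * Real.exp (κ * t))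
    {s : ℂ} (hs : s.re < 0) :
    IntegrableOn (fun t : ℝ => cexp (s * t) * q t) (Ioi 0) ∧
    HasDerivAt (fun s : ℂ => ∫ t in Ioi (0 : ℝ), cexp (s * t) * q t)
      (∫ t in Ioi (0 : ℝ), cexp (s * t) * (t * q t)) s := by
  -- With `s.re = -4κ`, moving `s` within a disk of radius `κ` costs one `κ`, the growth of `q` a
  -- second, and the factor `t` of the derivative a third; the decay `exp(-κt)` is left as majorant.
  set κ := -s.re / 4 with hκ
  have hκ0 : 0 < κ := by rw [hκ]; linarith
  obtain ⟨C, hC⟩ := hq κ hκ0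
  have hbound : ∀ s' ∈ Metric.ball s κ, ∀ t : ℝ, 0 < t →
      ‖cexp (s' * t)‖ ≤ Real.exp (-(3 * κ) * t) := by
    intro s' hs' t ht
    rw [norm_exp]
    have h1 : |(s' - s).re| < κ := (abs_re_le_norm _).trans_lt (by simpa [dist_eq_norm] using hs')
    have h2 : s'.re < -3 * κ := by
      have := (abs_lt.mp h1).2
      simp only [sub_re] at this
      rw [hκ] at this ⊢
      linarith
    refine Real.exp_le_exp.mpr ?_
    simp
    nlinarith
  have hmeas : ∀ s' : ℂ, AEStronglyMeasurable (fun t : ℝ => cexp (s' * t) * q t)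
      (volume.restrict (Ioi 0)) := fun s' =>
    (Continuous.aestronglyMeasurable (by fun_prop)).mul hqm
  have hint : IntegrableOn (fun t : ℝ => cexp (s * t) * q t) (Ioi 0) := by
    refine Integrable.mono' (integrableOn_exp_neg_mul (a := 2 * κ) (by linarith) C) (hmeas s) ?_
    refine (ae_restrict_iff' measurableSet_Ioi).mpr (ae_of_all _ fun t ht => ?_)
    rw [norm_mul]
    have h1 := hbound s (Metric.mem_ball_self hκ0) t ht
    have h2 := hC t ht
    calc _ ≤ Real.exp (-(3 * κ) * t) * (C * Real.exp (κ * t)) := by gcongr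
      _ = C * (Real.exp (-(3 * κ) * t) * Real.exp (κ * t)) := by ring
      _ = _ := by rw [← Real.exp_add]; ring_nf
  refine ⟨hint, ?_⟩
  have := (hasDerivAt_integral_of_dominated_loc_of_deriv_le (μ := volume.restrict (Ioi (0 : ℝ)))
    (F := fun s' (t : ℝ) => cexp (s' * t) * q t) (F' := fun s' (t : ℝ) => cexp (s' * t) * (t * q t))
    (x₀ := s) (s := Metric.ball s κ) (bound := fun t => C / κ * Real.exp (-κ * t))
    (Metric.ball_mem_nhds _ hκ0) (Eventually.of_forall hmeas) hint ?_ ?_ ?_ ?_).2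
  · exact this
  · exact (Continuous.aestronglyMeasurable (by fun_prop)).mul
      ((Continuous.aestronglyMeasurable (by fun_prop)).mul hqm)
  · refine (ae_restrict_iff' measurableSet_Ioi).mpr (ae_of_all _ fun t ht s' hs' => ?_)
    rw [norm_mul, norm_mul]
    have h1 := hbound s' hs' t ht
    have h2 := hC t ht
    have h3 : ‖(t : ℂ)‖ ≤ κ⁻¹ * Real.exp (κ * t) := by
      rw [norm_real, Real.norm_of_nonneg (le_of_lt ht), ← div_eq_inv_mul, le_div_iff₀ hκ0]
      have := Real.add_one_le_exp (κ * t)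
      linarith
    calc _ ≤ Real.exp (-(3 * κ) * t) * ((κ⁻¹ * Real.exp (κ * t)) * (C * Real.exp (κ * t))) := by
            gcongr
      _ = C / κ * (Real.exp (-(3 * κ) * t) * Real.exp (κ * t) * Real.exp (κ * t)) := by
        field_simp
      _ = _ := by rw [← Real.exp_add, ← Real.exp_add]; ring_nf
  · exact integrableOn_exp_neg_mul hκ0 _
  · refine ae_of_all _ fun t s' _ => ?_
    have h1 : HasDerivAt (fun s' : ℂ => cexp (s' * t)) (cexp (s' * t) * t) s' := by
      simpa using ((hasDerivAt_id s').mul_const (t : ℂ)).cexp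
    exact (h1.mul_const (q t)).congr_deriv (by ring)

/-- Differentiation under the integral sign on a bounded interval. -/
theorem hasDerivAt_interval_exp {γ q : ℝ → ℂ} {a b : ℝ} (hγ : Continuous γ)
    (hq : IntervalIntegrable q volume a b) (s : ℂ) :
    IntervalIntegrable (fun t => cexp (s * γ t) * q t) volume a b ∧
    HasDerivAt (fun s : ℂ => ∫ t in a..b, cexp (s * γ t) * q t)
      (∫ t in a..b, cexp (s * γ t) * (γ t * q t)) s := by
  have hint : ∀ s : ℂ, IntervalIntegrable (fun t => cexp (s * γ t) * q t) volume a b := fun s =>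
    hq.continuousOn_mul (Continuous.continuousOn (by fun_prop))
  refine ⟨hint s, ?_⟩
  obtain ⟨M, hM⟩ := (isCompact_uIcc (a := a) (b := b)).exists_bound_of_continuousOn hγ.continuousOn
  have hM0 : 0 ≤ M := (norm_nonneg _).trans (hM a left_mem_uIcc)
  refine (intervalIntegral.hasDerivAt_integral_of_dominated_loc_of_deriv_le
    (F' := fun s' t => cexp (s' * γ t) * (γ t * q t)) (s := Metric.ball s 1)
    (bound := fun t => Real.exp ((‖s‖ + 1) * M) * (M * ‖q t‖)) (Metric.ball_mem_nhds _ one_pos)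
    (Eventually.of_forall fun s => ((intervalIntegrable_iff.mp (hint s)).aestronglyMeasurable))
    (hint s) ?_ ?_ ?_ ?_).2
  · have : IntervalIntegrable (fun t => γ t * q t) volume a b := hq.continuousOn_mul hγ.continuousOn
    exact (intervalIntegrable_iff.mp (this.continuousOn_mul (g := fun t => cexp (s * γ t))
      (Continuous.continuousOn (by fun_prop)))).aestronglyMeasurable
  · refine ae_of_all _ fun t ht s' hs' => ?_
    have h1 := hM t (uIoc_subset_uIcc ht)
    have h2 : ‖s'‖ ≤ ‖s‖ + 1 := by
      have := norm_sub_norm_le s' s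
      have h3 : ‖s' - s‖ < 1 := by simpa [dist_eq_norm] using hs'
      linarith
    rw [norm_mul, norm_mul]
    have : ‖cexp (s' * γ t)‖ ≤ Real.exp ((‖s‖ + 1) * M) :=
      (norm_exp_le_exp_norm _).trans (Real.exp_le_exp.mpr (by rw [norm_mul]; gcongr))
    gcongr
  · exact (hq.norm.const_mul M).const_mul _
  · refine ae_of_all _ fun t _ s' _ => ?_
    have h1 : HasDerivAt (fun s' : ℂ => cexp (s' * γ t)) (cexp (s' * γ t) * γ t) s' := by
      simpa using ((hasDerivAt_id s').mul_const (γ t)).cexp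
    exact (h1.mul_const (q t)).congr_deriv (by ring)

/-! ### Removable singularities of solutions of Fuchsian equations -/

/-- A solution of a Fuchsian equation on a punctured disk grows at most polynomially. -/
theorem fuchs_growth {z : ℂ} {r : ℝ} (hr : 0 < r) {F a b : ℂ → ℂ}
    (ha : ContinuousOn a (Metric.ball z r)) (hb : ContinuousOn b (Metric.ball z r))
    (hF : DifferentiableOn ℂ F (Metric.ball z r \ {z}))
    (hode : ∀ x ∈ Metric.ball z r, x ≠ z → (x - z) * deriv F x = a x * F x + b x) :
    ∃ (M : ℕ) (C : ℝ), ∀ x ∈ Metric.ball z (r / 2), x ≠ z → ‖x - z‖ ^ M * ‖F x‖ ≤ C := by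
  set ρ := r / 2 with hρ
  have hρ0 : 0 < ρ := by rw [hρ]; linarith
  have hsub : Metric.closedBall z ρ ⊆ Metric.ball z r := Metric.closedBall_subset_ball (by linarith)
  obtain ⟨A, hA⟩ := (isCompact_closedBall z ρ).exists_bound_of_continuousOn (ha.mono hsub)
  obtain ⟨B, hB⟩ := (isCompact_closedBall z ρ).exists_bound_of_continuousOn (hb.mono hsub)
  have hsph : Metric.sphere z ρ ⊆ Metric.ball z r \ {z} := fun x hx =>
    ⟨hsub (Metric.sphere_subset_closedBall hx), fun h => by
      rw [mem_singleton_iff] at h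
      rw [h] at hx
      simp at hx
      linarith⟩
  obtain ⟨D, hD⟩ := (isCompact_sphere z ρ).exists_bound_of_continuousOn (hF.continuousOn.mono hsph)
  obtain ⟨M, hM⟩ := exists_nat_gt (max A (max B D))
  have hMA : A ≤ M := (le_max_left _ _).trans hM.le
  have hMB : B ≤ M := ((le_max_left _ _).trans (le_max_right _ _)).trans hM.le
  have hMD : D ≤ M := ((le_max_right _ _).trans (le_max_right _ _)).trans hM.le
  refine ⟨M, (M + 1) * ρ ^ M, fun x hx hxz => ?_⟩
  have hx0 : 0 < ‖x - z‖ := norm_pos_iff.mpr (sub_ne_zero.mpr hxz)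
  have hxρ : ‖x - z‖ < ρ := by simpa [dist_eq_norm] using hx
  set e : ℂ := (x - z) / ‖x - z‖ with he
  have hen : ‖e‖ = 1 := by rw [he, norm_div, norm_real, norm_norm, div_self hx0.ne']
  set T := Real.log (ρ / ‖x - z‖) with hT
  have hT0 : 0 ≤ T := Real.log_nonneg ((one_le_div hx0).mpr hxρ.le)
  -- Along the radius towards `z`, parametrized by `τ = log(ρ/‖x - z‖)`, the singular equation
  -- becomes `dF/dτ = -(aF + b)` with bounded coefficients. Gronwall's inequality allows growth
  -- `exp(Mτ)`, which is the power `(ρ/‖x - z‖)^M`. One integer `M` bounds `a`, `b` and the initial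
  -- values on the circle.
  set γ : ℝ → ℂ := fun τ => z + (ρ * Real.exp (-τ) : ℝ) * e with hγ
  have hγn : ∀ τ, ‖γ τ - z‖ = ρ * Real.exp (-τ) := fun τ => by
    rw [hγ, add_sub_cancel_left, norm_mul, hen, mul_one, norm_real,
      Real.norm_of_nonneg (by positivity)]
  have hγmem : ∀ τ, 0 ≤ τ → γ τ ∈ Metric.closedBall z ρ := fun τ hτ => by
    rw [Metric.mem_closedBall, dist_eq_norm, hγn]
    exact mul_le_of_le_one_right hρ0.le (Real.exp_le_one_iff.mpr (by linarith))
  have hγne : ∀ τ, γ τ ≠ z := fun τ h => by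
    have := hγn τ
    rw [h, sub_self, norm_zero] at this
    have : 0 < ρ * Real.exp (-τ) := by positivity
    linarith
  have hopen : IsOpen (Metric.ball z r \ {z}) := Metric.isOpen_ball.sdiff isClosed_singleton
  have hd : ∀ τ, 0 ≤ τ → HasDerivAt (fun τ => F (γ τ)) (-(a (γ τ) * F (γ τ) + b (γ τ))) τ := by
    intro τ hτ
    have h1 : HasDerivAt γ (-(γ τ - z)) τ := by
      have h2 : HasDerivAt (fun τ : ℝ => ρ * Real.exp (-τ)) (-(ρ * Real.exp (-τ))) τ := by
        have := ((hasDerivAt_neg τ).exp).const_mul ρ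
        exact this.congr_deriv (by ring)
      have h3 := (h2.ofReal_comp.mul_const e).const_add z
      refine h3.congr_deriv ?_
      simp [hγ]
    have h4 : HasDerivAt F (deriv F (γ τ)) (γ τ) :=
      (hF.differentiableAt (hopen.mem_nhds ⟨hsub (hγmem τ hτ), hγne τ⟩)).hasDerivAt
    have := h4.comp_of_eq τ h1 rfl
    refine this.congr_deriv ?_
    rw [← hode _ (hsub (hγmem τ hτ)) (hγne τ)]
    ring
  have hG := norm_le_gronwallBound_of_norm_deriv_right_le (f := fun τ => F (γ τ))
    (f' := fun τ => -(a (γ τ) * F (γ τ) + b (γ τ))) (δ := M) (K := M) (ε := M) (a := 0) (b := T)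
    (fun τ hτ => (hd τ hτ.1).continuousAt.continuousWithinAt)
    (fun τ hτ => (hd τ hτ.1).hasDerivWithinAt) ?_ ?_ T ⟨hT0, le_rfl⟩
  · have hxγ : γ T = x := by
      have : ρ * Real.exp (-T) = ‖x - z‖ := by
        rw [hT, Real.exp_neg, Real.exp_log (by positivity)]
        field_simp
      rw [hγ]
      simp only [this]
      rw [he, mul_div_cancel₀ _ (by exact_mod_cast hx0.ne')]
      ring
    rw [hxγ] at hG
    have hM0 : (0 : ℝ) < M ∨ (M : ℝ) = 0 := by
      rcases Nat.eq_zero_or_pos M with h | h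
      · exact Or.inr (by simp [h])
      · exact Or.inl (by exact_mod_cast h)
    have hexp : Real.exp (M * T) = ρ ^ M / ‖x - z‖ ^ M := by
      rw [mul_comm, Real.exp_mul, hT, Real.exp_log (by positivity), Real.rpow_natCast, div_pow]
    have hgb : gronwallBound M M M (T - 0) ≤ (M + 1) * Real.exp (M * T) := by
      rcases hM0 with h | h
      · rw [gronwallBound_of_K_ne_0 h.ne', sub_zero]
        have : (M : ℝ) / M = 1 := div_self h.ne'
        rw [this]
        nlinarith [Real.exp_pos (M * T)]
      · rw [h, gronwallBound_K0]
        simp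
    have := hG.trans hgb
    rw [hexp] at this
    calc _ ≤ ‖x - z‖ ^ M * ((M + 1) * (ρ ^ M / ‖x - z‖ ^ M)) := by gcongr
      _ = _ := by field_simp
  · refine (hD _ ?_).trans hMD
    rw [mem_sphere_iff_norm, hγn]
    simp
  · intro τ hτ
    rw [norm_neg]
    refine (norm_add_le _ _).trans ?_
    rw [norm_mul]
    have h1 := (hA _ (hγmem τ hτ.1)).trans hMA
    have h2 := (hB _ (hγmem τ hτ.1)).trans hMB
    gcongr

/-- A solution of the Fuchsian equation `(x - z) F' = a F + b` on a punctured disk extends to the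
center unless `a z` is a negative integer. -/
theorem fuchs_removable {z : ℂ} {r : ℝ} (hr : 0 < r) {F a b : ℂ → ℂ}
    (ha : ContinuousOn a (Metric.ball z r)) (hb : ContinuousOn b (Metric.ball z r))
    (hF : DifferentiableOn ℂ F (Metric.ball z r \ {z}))
    (hode : ∀ x ∈ Metric.ball z r, x ≠ z → (x - z) * deriv F x = a x * F x + b x)
    (haz : ∀ n : ℕ, 0 < n → a z ≠ -n) :
    ∃ l, Tendsto F (𝓝[≠] z) (𝓝 l) := by
  obtain ⟨M, C, hC⟩ := fuchs_growth hr ha hb hF hode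
  have hball : Metric.ball z (r / 2) ∈ 𝓝 z := Metric.ball_mem_nhds _ (by linarith)
  have hsub : Metric.ball z (r / 2) ⊆ Metric.ball z r := Metric.ball_subset_ball (by linarith)
  have hopen : IsOpen (Metric.ball z r \ {z}) := Metric.isOpen_ball.sdiff isClosed_singleton
  have hdF : ∀ x ∈ Metric.ball z r, x ≠ z → DifferentiableAt ℂ F x := fun x hx hxz =>
    hF.differentiableAt (hopen.mem_nhds ⟨hx, hxz⟩)
  have hmer : MeromorphicAt F z := by
    -- One power more than the growth bound, so that the product tends to 0 at `z` and extends
    -- continuously.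
    refine ⟨M + 1, ?_⟩
    refine analyticAt_of_differentiable_on_punctured_nhds_of_continuousAt ?_ ?_
    · filter_upwards [mem_nhdsWithin_of_mem_nhds hball, self_mem_nhdsWithin] with x hx hxz
      exact (DifferentiableAt.pow (f := fun x => x - z) (by fun_prop) _).smul (hdF x (hsub hx) hxz)
    · rw [← continuousWithinAt_compl_self, ContinuousWithinAt]
      simp only [sub_self, ne_eq, Nat.add_eq_zero_iff, one_ne_zero, and_false, not_false_eq_true,
        zero_pow, zero_smul]
      have h0 : Tendsto (fun x => ‖x - z‖ * C) (𝓝[≠] z) (𝓝 0) := by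
        have : Tendsto (fun x => ‖x - z‖ * C) (𝓝 z) (𝓝 (‖z - z‖ * C)) :=
          Continuous.tendsto (by fun_prop) z
        simpa using this.mono_left nhdsWithin_le_nhds
      refine squeeze_zero_norm' ?_ h0
      filter_upwards [mem_nhdsWithin_of_mem_nhds hball, self_mem_nhdsWithin] with x hx hxz
      rw [norm_smul, norm_pow, pow_succ', mul_assoc]
      have := hC x hx hxz
      gcongr
  refine (tendsto_nhds_iff_meromorphicOrderAt_nonneg hmer).mpr ?_
  by_contra hneg
  push Not at hneg
  obtain ⟨k, hk⟩ := WithTop.ne_top_iff_exists.mp hneg.ne_top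
  rw [← hk] at hneg
  have hk0 : k < 0 := by exact_mod_cast hneg
  obtain ⟨g, hg, hg0, hFg⟩ := (meromorphicOrderAt_eq_int_iff hmer).mp hk.symm
  have hgd : ∀ᶠ x in 𝓝 z, DifferentiableAt ℂ g x :=
    hg.eventually_analyticAt.mono fun x hx => hx.differentiableAt
  -- Insert `F = (x - z)^k g` into the equation and divide by `(x - z)^k`. Since `k < 0`, the term
  -- with `b` vanishes in the limit, leaving `(k - a z) g z = 0`: a genuine pole forces `a z` to be
  -- the negative integer `k`.
  have hev : ∀ᶠ x in 𝓝[≠] z, (k - a x) * g x + (x - z) * deriv g x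
      = b x * (x - z) ^ ((-k).toNat) := by
    have hFg' : ∀ᶠ x in 𝓝[≠] z, F =ᶠ[𝓝 x] fun x => (x - z) ^ k • g x := by
      have := eventually_eventually_nhdsWithin.mpr hFg
      filter_upwards [this, self_mem_nhdsWithin] with x hx hxz
      rwa [IsOpen.nhdsWithin_eq isOpen_compl_singleton hxz] at hx
    filter_upwards [hFg', mem_nhdsWithin_of_mem_nhds hball, self_mem_nhdsWithin,
      hgd.filter_mono nhdsWithin_le_nhds] with x hx hxb hxz hgx
    have hxz' : x - z ≠ 0 := sub_ne_zero.mpr hxz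
    have h1 := hode x (hsub hxb) hxz
    have h2 : HasDerivAt (fun x => (x - z) ^ k • g x)
        ((k * (x - z) ^ (k - 1)) * g x + (x - z) ^ k * deriv g x) x := by
      have := ((hasDerivAt_zpow k (x - z) (Or.inl hxz')).comp x
        ((hasDerivAt_id x).sub_const z)).mul hgx.hasDerivAt
      exact this.congr_deriv (by simp)
    rw [hx.deriv_eq, h2.deriv, hx.eq_of_nhds, smul_eq_mul] at h1
    have h3 : (x - z) ^ k * (x - z) ^ ((-k).toNat) = 1 := by
      rw [← zpow_natCast, ← zpow_add₀ hxz', Int.toNat_of_nonneg (by linarith)]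
      simp
    have h4 : (x - z) * (x - z) ^ (k - 1) = (x - z) ^ k := by
      rw [← zpow_one_add₀ hxz']; ring_nf
    linear_combination (x - z) ^ ((-k).toNat) * h1 -
      ((k - a x) * g x + (x - z) * deriv g x) * h3 -
      k * g x * (x - z) ^ ((-k).toNat) * h4
  have hac : ContinuousAt a z := ha.continuousAt (Metric.ball_mem_nhds _ hr)
  have hbc : ContinuousAt b z := hb.continuousAt (Metric.ball_mem_nhds _ hr)
  have hl : Tendsto (fun x => (k - a x) * g x + (x - z) * deriv g x) (𝓝[≠] z)
      (𝓝 ((k - a z) * g z + (z - z) * deriv g z)) := by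
    refine Tendsto.mono_left ?_ nhdsWithin_le_nhds
    have h1 := hg.continuousAt
    have h2 := hg.deriv.continuousAt
    exact ((continuousAt_const.sub hac).mul h1).add
      ((continuousAt_id.sub continuousAt_const).mul h2)
  have hr' : Tendsto (fun x => b x * (x - z) ^ ((-k).toNat)) (𝓝[≠] z)
      (𝓝 (b z * (z - z) ^ ((-k).toNat))) := by
    refine Tendsto.mono_left ?_ nhdsWithin_le_nhds
    exact hbc.mul ((continuousAt_id.sub continuousAt_const).pow _)
  have := tendsto_nhds_unique (hl.congr' hev) hr'
  have hn : (-k).toNat ≠ 0 := by omega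
  rw [sub_self, zero_mul, add_zero, zero_pow hn, mul_zero] at this
  have h5 : (k : ℂ) - a z = 0 := (mul_eq_zero.mp this).resolve_right hg0
  refine haz (-k).toNat (by omega) ?_
  have h6 : ((-k).toNat : ℂ) = -(k : ℂ) := by
    have : (((-k).toNat : ℤ) : ℂ) = ((-k : ℤ) : ℂ) := by rw [Int.toNat_of_nonneg (by omega)]
    rw [← Int.cast_natCast, this, Int.cast_neg]
  rw [h6, neg_neg]
  exact (sub_eq_zero.mp h5).symm

end BenjaminOno

namespace BenjaminOno
open Complex Set Filter MeasureTheory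

noncomputable section

/-! ### Rational functions with poles at the `z p` and their conjugates -/

/-- The set of all `z p` and their conjugates. -/
def poles {P : ℕ} (z : Fin P → ℂ) : Set ℂ := {ζ | ∃ p, ζ = z p ∨ ζ = conj (z p)}

/-- The rational function with value `r` at infinity and residues `α`, `β`. -/
def rat {P : ℕ} (z : Fin P → ℂ) (r : ℂ) (α β : Fin P → ℂ) (x : ℂ) : ℂ :=
  r + ∑ p, (α p / (x - z p) + β p / (x - conj (z p)))

/-- The meromorphic continuation of the potential. -/
def upot {P : ℕ} (c z : Fin P → ℂ) : ℂ → ℂ := rat z 0 c fun p => conj (c p)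

variable {P : ℕ} {ε : ℝ} {c z : Fin P → ℂ}

theorem potential_eq_upot (x : ℝ) : potential c z x = upot c z x := by
  simp [potential, upot, rat]

theorem mem_poles_left (p : Fin P) : z p ∈ poles z := ⟨p, Or.inl rfl⟩

theorem mem_poles_right (p : Fin P) : conj (z p) ∈ poles z := ⟨p, Or.inr rfl⟩

theorem finite_poles : (poles z).Finite := by
  have : poles z = range z ∪ range fun p => conj (z p) := by
    ext ζ; simp [poles, eq_comm, exists_or]
  rw [this]
  exact (finite_range _).union (finite_range _)

theorem sub_ne_zero_of_notMem_poles {x : ℂ} (hx : x ∉ poles z) (p : Fin P) :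
    x - z p ≠ 0 ∧ x - conj (z p) ≠ 0 :=
  ⟨fun h => hx (sub_eq_zero.mp h ▸ mem_poles_left p),
    fun h => hx (sub_eq_zero.mp h ▸ mem_poles_right p)⟩

theorem differentiableAt_rat (r : ℂ) (α β : Fin P → ℂ) {x : ℂ} (hx : x ∉ poles z) :
    DifferentiableAt ℂ (rat z r α β) x := by
  unfold rat
  refine (differentiableAt_const r).add (DifferentiableAt.fun_sum fun p _ => ?_)
  obtain ⟨h1, h2⟩ := sub_ne_zero_of_notMem_poles hx p
  have h3 : DifferentiableAt ℂ (fun x => α p / (x - z p)) x := by fun_prop (disch := exact h1)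
  have h4 : DifferentiableAt ℂ (fun x => β p / (x - conj (z p))) x := by
    fun_prop (disch := exact h2)
  exact h3.add h4

theorem norm_rat_le (r : ℂ) (α β : Fin P → ℂ) {x : ℂ} {d : ℝ} (hd : 0 < d)
    (h : ∀ ζ ∈ poles z, d ≤ ‖x - ζ‖) :
    ‖rat z r α β x‖ ≤ ‖r‖ + (∑ p, (‖α p‖ + ‖β p‖)) / d := by
  unfold rat
  refine (norm_add_le _ _).trans (add_le_add_right ((norm_sum_le _ _).trans ?_) _)
  rw [Finset.sum_div]
  refine Finset.sum_le_sum fun p _ => (norm_add_le _ _).trans ?_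
  rw [norm_div, norm_div, add_div]
  have h1 := h _ (mem_poles_left p)
  have h2 := h _ (mem_poles_right p)
  gcongr

/-- From `x/(x - ζ) = 1 + ζ/(x - ζ)`. Differentiating `expo` in the spectral parameter multiplies by
`-i x/ε`, so this keeps the derivatives of the contour integrals within rational functions of the
same kind. -/
theorem mul_rat (α β : Fin P → ℂ) (k : ℂ) {x : ℂ} (hx : x ∉ poles z) :
    k * x * rat z 0 α β x = rat z (k * ∑ p, (α p + β p)) (fun p => k * z p * α p)
      (fun p => k * conj (z p) * β p) x := by
  simp only [rat, zero_add, Finset.mul_sum]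
  rw [← Finset.sum_add_distrib]
  refine Finset.sum_congr rfl fun p _ => ?_
  obtain ⟨h1, h2⟩ := sub_ne_zero_of_notMem_poles hx p
  field_simp
  ring

/-! ### Solutions of the first-order equation -/

/-- The exponential `exp (-i (lam x + f x) / ε)`. -/
def expo (ε : ℝ) (lam : ℂ) (f : ℂ → ℂ) (x : ℂ) : ℂ := cexp (-I * (lam * x + f x) / ε)

theorem expo_ne_zero (lam : ℂ) (f : ℂ → ℂ) (x : ℂ) : expo ε lam f x ≠ 0 := exp_ne_zero _

/-- `F` satisfies `i ε F' + (lam + u) F = R` at the point `x`. -/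
def SolvesAt (ε : ℝ) (c z : Fin P → ℂ) (lam : ℂ) (R F : ℂ → ℂ) (x : ℂ) : Prop :=
  HasDerivAt F ((R x - (lam + upot c z x) * F x) / (I * ε)) x

theorem hasDerivAt_expo (hε : 0 < ε) {lam : ℂ} {f : ℂ → ℂ} {x : ℂ}
    (hf : HasDerivAt f (upot c z x) x) :
    HasDerivAt (expo ε lam f) ((lam + upot c z x) / (I * ε) * expo ε lam f x) x := by
  have h1 := ((((hasDerivAt_id x).const_mul lam).add hf).const_mul (-I)).div_const (ε : ℂ)
  have h2 : HasDerivAt (fun x => -I * (lam * x + f x) / ε) (-I * (lam * 1 + upot c z x) / ε) x := h1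
  refine h2.cexp.congr_deriv ?_
  have : (ε : ℂ) ≠ 0 := by exact_mod_cast hε.ne'
  unfold expo
  field_simp
  rw [I_sq]
  ring

/-- The exponential is an integrating factor: the terms with `lam + upot` cancel in the product
rule. -/
theorem SolvesAt.expo_mul (hε : 0 < ε) {lam : ℂ} {f R F : ℂ → ℂ} {x : ℂ}
    (hf : HasDerivAt f (upot c z x) x) (hF : SolvesAt ε c z lam R F x) :
    HasDerivAt (fun x => expo ε lam f x * F x) (expo ε lam f x * R x / (I * ε)) x :=
  ((hasDerivAt_expo hε hf).mul hF).congr_deriv (by ring)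

theorem solvesAt_div (hε : 0 < ε) {lam : ℂ} {E R G : ℂ → ℂ} {x : ℂ}
    (hE : HasDerivAt E ((lam + upot c z x) / (I * ε) * E x) x) (hE0 : E x ≠ 0)
    (hG : HasDerivAt G (E x * R x / (I * ε)) x) :
    SolvesAt ε c z lam R (fun x => G x / E x) x := by
  refine (hG.div hE hE0).congr_deriv ?_
  have : (ε : ℂ) ≠ 0 := by exact_mod_cast hε.ne'
  field_simp

theorem solvesAt_div_expo (hε : 0 < ε) {lam : ℂ} {f R G : ℂ → ℂ} {x : ℂ}
    (hf : HasDerivAt f (upot c z x) x) (hG : HasDerivAt G (expo ε lam f x * R x / (I * ε)) x) :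
    SolvesAt ε c z lam R (fun x => G x / expo ε lam f x) x :=
  solvesAt_div hε (hasDerivAt_expo hε hf) (expo_ne_zero _ _ _) hG

theorem SolvesAt.congr {lam : ℂ} {R F G : ℂ → ℂ} {x : ℂ} (hF : SolvesAt ε c z lam R F x)
    (h : G =ᶠ[𝓝 x] F) : SolvesAt ε c z lam R G x := by
  have := HasDerivAt.congr_of_eventuallyEq hF h
  rwa [← h.eq_of_nhds] at this

/-- Two solutions on a connected domain of a branch agree if they agree at a point. -/
theorem SolvesAt.eqOn (hε : 0 < ε) {lam : ℂ} {f R F G : ℂ → ℂ} {S : Set ℂ} (hS : IsOpen S)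
    (hS' : IsPreconnected S) (hf : ∀ x ∈ S, HasDerivAt f (upot c z x) x)
    (hF : ∀ x ∈ S, SolvesAt ε c z lam R F x) (hG : ∀ x ∈ S, SolvesAt ε c z lam R G x)
    {x₀ : ℂ} (hx₀ : x₀ ∈ S) (h : F x₀ = G x₀) : EqOn F G S := fun x hx => by
  have := eqOn_of_hasDerivAt_eq hS hS' (fun x hx => (hF x hx).expo_mul hε (hf x hx))
    (fun x hx => (hG x hx).expo_mul hε (hf x hx)) hx₀ (by simp only [h]) hx
  exact mul_left_cancel₀ (expo_ne_zero _ _ _) this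

/-! ### The solution that decays along a direction -/

/-- A branch of the antiderivative of the potential, cut along the rays from the poles in the
direction `-ω`. -/
def rayBranch (c z : Fin P → ℂ) (ω x : ℂ) : ℂ :=
  ∑ p, (c p * log ((x - z p) / ω) + conj (c p) * log ((x - conj (z p)) / ω))

/-- The points whose translates in the direction `ω` stay away from the poles, quantitatively. -/
def rayDom (z : Fin P → ℂ) (ω : ℂ) (δ : ℝ) : Set ℂ :=
  {x | ∀ ζ ∈ poles z, ∀ t : ℝ, 0 ≤ t → δ * (1 + t) ≤ ‖x + t * ω - ζ‖}

variable {ω : ℂ} {δ : ℝ}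

theorem rayDom_translate (hδ : 0 < δ) {x : ℂ} (hx : x ∈ rayDom z ω δ) {t : ℝ} (ht : 0 ≤ t) :
    x + t * ω ∈ rayDom z ω δ := by
  intro ζ hζ s hs
  have := hx ζ hζ (t + s) (by linarith)
  push_cast at this
  have e : x + t * ω + s * ω - ζ = x + (t + s) * ω - ζ := by ring
  rw [e]
  nlinarith

theorem rayDom_of_dist_le (hδ : 0 < δ) {x y : ℂ} (hx : x ∈ rayDom z ω δ) (h : ‖y - x‖ ≤ δ / 2) :
    y ∈ rayDom z ω (δ / 2) := by
  intro ζ hζ t ht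
  have h1 := hx ζ hζ t ht
  have e : x + t * ω - ζ = (y + t * ω - ζ) - (y - x) := by ring
  rw [e] at h1
  have := norm_sub_le (y + t * ω - ζ) (y - x)
  nlinarith

theorem notMem_poles_of_rayDom (hδ : 0 < δ) {x : ℂ} (hx : x ∈ rayDom z ω δ) : x ∉ poles z := by
  intro h
  have := hx x h 0 le_rfl
  simp at this
  linarith

theorem rayDom_mem_nhds (hδ : 0 < δ) {x : ℂ} (hx : x ∈ rayDom z ω δ) :
    rayDom z ω (δ / 2) ∈ 𝓝 x := by
  filter_upwards [Metric.closedBall_mem_nhds x (half_pos hδ)] with y hy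
  exact rayDom_of_dist_le hδ hx (by simpa [dist_eq_norm] using hy)

theorem div_mem_slitPlane_of_rayDom (hδ : 0 < δ) (hω : ω ≠ 0) {x : ℂ} (hx : x ∈ rayDom z ω δ)
    {ζ : ℂ} (hζ : ζ ∈ poles z) : (x - ζ) / ω ∈ slitPlane := by
  rw [mem_slitPlane_iff]
  by_contra h
  push Not at h
  obtain ⟨h1, h2⟩ := h
  have e : (x - ζ) / ω = (((x - ζ) / ω).re : ℂ) := by
    apply Complex.ext <;> simp [h2]
  have h3 := hx ζ hζ (-((x - ζ) / ω).re) (by linarith)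
  have e2 : x + ((-((x - ζ) / ω).re : ℝ) : ℂ) * ω - ζ = 0 := by
    rw [ofReal_neg, ← e]
    field_simp
    ring
  rw [e2, norm_zero] at h3
  nlinarith

theorem hasDerivAt_log_div {ω ζ x : ℂ} (hω : ω ≠ 0) (hx : (x - ζ) / ω ∈ slitPlane) :
    HasDerivAt (fun x => log ((x - ζ) / ω)) (1 / (x - ζ)) x := by
  have h1 : HasDerivAt (fun x => (x - ζ) / ω) (1 / ω) x :=
    ((hasDerivAt_id x).sub_const ζ).div_const ω
  refine (h1.clog hx).congr_deriv ?_
  have : x - ζ ≠ 0 := fun h => by simp [h] at hx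
  field_simp

theorem hasDerivAt_rayBranch_of_slit (hω : ω ≠ 0) {x : ℂ}
    (hx : ∀ ζ ∈ poles z, (x - ζ) / ω ∈ slitPlane) :
    HasDerivAt (rayBranch c z ω) (upot c z x) x := by
  unfold rayBranch upot rat
  rw [zero_add]
  refine HasDerivAt.fun_sum fun p _ => ?_
  have h1 := (hasDerivAt_log_div hω (hx _ (mem_poles_left p))).const_mul (c p)
  have h2 := (hasDerivAt_log_div hω (hx _ (mem_poles_right p))).const_mul (conj (c p))
  exact (h1.add h2).congr_deriv (by ring)

theorem hasDerivAt_rayBranch (hδ : 0 < δ) (hω : ω ≠ 0) {x : ℂ} (hx : x ∈ rayDom z ω δ) :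
    HasDerivAt (rayBranch c z ω) (upot c z x) x :=
  hasDerivAt_rayBranch_of_slit hω fun _ hζ => div_mem_slitPlane_of_rayDom hδ hω hx hζ

/-- Along the ray the logarithm has derivative `ω/(x + tω - ζ)`, which the definition of `rayDom`
bounds by `‖ω‖/(δ(1 + t))`; integrate. -/
theorem norm_log_sub_log_le (hδ : 0 < δ) (hω : ω ≠ 0) {x : ℂ} (hx : x ∈ rayDom z ω δ)
    {ζ : ℂ} (hζ : ζ ∈ poles z) {T : ℝ} (hT : 0 ≤ T) :
    ‖log ((x + T * ω - ζ) / ω) - log ((x - ζ) / ω)‖ ≤ ‖ω‖ / δ * Real.log (1 + T) := by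
  have hd : ∀ t : ℝ, 0 ≤ t → HasDerivAt (fun t : ℝ => log ((x + t * ω - ζ) / ω) - log ((x - ζ) / ω))
      (ω / (x + t * ω - ζ)) t := by
    intro t ht
    have h1 : HasDerivAt (fun t : ℝ => x + t * ω) ω t := by
      simpa using ((hasDerivAt_id t).ofReal_comp.mul_const ω).const_add x
    have h2 := (hasDerivAt_log_div hω (div_mem_slitPlane_of_rayDom hδ hω
      (rayDom_translate hδ hx ht) hζ)).comp_of_eq t h1 rfl
    exact (h2.sub_const _).congr_deriv (by ring)
  have hB : ∀ t : ℝ, 0 ≤ t → HasDerivAt (fun t : ℝ => ‖ω‖ / δ * Real.log (1 + t))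
      (‖ω‖ / δ * (1 / (1 + t))) t := by
    intro t ht
    have := (((hasDerivAt_id t).const_add 1).log (by simp; linarith)).const_mul (‖ω‖ / δ)
    simpa using this
  refine image_norm_le_of_norm_deriv_right_le_deriv_boundary'
    (fun t ht => (hd t ht.1).continuousAt.continuousWithinAt)
    (fun t ht => (hd t ht.1).hasDerivWithinAt) (by simp)
    (fun t ht => (hB t ht.1).continuousAt.continuousWithinAt)
    (fun t ht => (hB t ht.1).hasDerivWithinAt) (fun t ht => ?_) ⟨hT, le_rfl⟩
  have h1 := hx ζ hζ t ht.1
  have h2 : 0 < 1 + t := by linarith [ht.1]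
  rw [norm_div, div_mul_div_comm, mul_one]
  gcongr

/-- The antiderivative grows only logarithmically along the ray, so its exponential grows at most
polynomially, hence slower than `exp(κt)` for every `κ > 0`. The constant is uniform in the starting
point. -/
theorem norm_exp_rayBranch_sub_le (hε : 0 < ε) (hδ : 0 < δ) (hω : ω ≠ 0) {κ : ℝ} (hκ : 0 < κ) :
    ∃ C : ℝ, 0 < C ∧ ∀ x ∈ rayDom z ω δ, ∀ t : ℝ, 0 ≤ t →
      ‖cexp (-I * (rayBranch c z ω (x + t * ω) - rayBranch c z ω x) / ε)‖
        ≤ C * Real.exp (κ * t) := by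
  set N : ℝ := (∑ p, (‖c p‖ + ‖c p‖)) * (‖ω‖ / δ) / ε with hN
  have hN0 : 0 ≤ N := by positivity
  -- Chosen so that `N/M ≤ κ` in `N log(1 + t) ≤ N(1 + t)/M + N log M`.
  set M : ℝ := (N + 1) / κ with hM
  have hM0 : 0 < M := by positivity
  refine ⟨Real.exp (N / M + N * Real.log M), Real.exp_pos _, fun x hx t ht => ?_⟩
  have h1 : ‖rayBranch c z ω (x + t * ω) - rayBranch c z ω x‖
      ≤ (∑ p, (‖c p‖ + ‖c p‖)) * (‖ω‖ / δ) * Real.log (1 + t) := by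
    unfold rayBranch
    rw [← Finset.sum_sub_distrib, mul_assoc, Finset.sum_mul]
    refine (norm_sum_le _ _).trans (Finset.sum_le_sum fun p _ => ?_)
    have h1 := norm_log_sub_log_le hδ hω hx (mem_poles_left p) ht
    have h2 := norm_log_sub_log_le hδ hω hx (mem_poles_right p) ht
    have e : c p * log ((x + t * ω - z p) / ω) + conj (c p) * log ((x + t * ω - conj (z p)) / ω)
        - (c p * log ((x - z p) / ω) + conj (c p) * log ((x - conj (z p)) / ω))
        = c p * (log ((x + t * ω - z p) / ω) - log ((x - z p) / ω))
        + conj (c p) * (log ((x + t * ω - conj (z p)) / ω) - log ((x - conj (z p)) / ω)) := by ring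
    rw [e]
    refine (norm_add_le _ _).trans ?_
    rw [norm_mul, norm_mul, RCLike.norm_conj, add_mul]
    gcongr
  have h2 : ‖-I * (rayBranch c z ω (x + t * ω) - rayBranch c z ω x) / ε‖
      ≤ N * Real.log (1 + t) := by
    rw [norm_div, norm_mul, norm_neg, norm_I, one_mul, norm_real, Real.norm_of_nonneg hε.le, hN,
      div_mul_eq_mul_div]
    gcongr
  refine (norm_exp_le_exp_norm _).trans ?_
  rw [← Real.exp_add]
  refine Real.exp_le_exp.mpr (h2.trans ?_)
  have h3 : Real.log (1 + t) ≤ (1 + t) / M + Real.log M := by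
    have := Real.log_le_sub_one_of_pos (x := (1 + t) / M) (by positivity)
    rw [Real.log_div (by positivity) (by positivity)] at this
    linarith
  have h4 : N * ((1 + t) / M) ≤ N / M + κ * t := by
    have : N / M ≤ κ := by
      rw [hM, div_div_eq_mul_div, div_le_iff₀ (by positivity)]
      nlinarith
    calc N * ((1 + t) / M) = N / M + N / M * t := by ring
      _ ≤ _ := by gcongr
  nlinarith [mul_le_mul_of_nonneg_left h3 hN0]

/-- The integral of `expo * R` along the ray from `x` in the direction `ω`. -/
def rayInt (ε : ℝ) (c z : Fin P → ℂ) (ω : ℂ) (R : ℂ → ℂ) (lam x : ℂ) : ℂ :=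
  ∫ t in Ioi (0 : ℝ), expo ε lam (rayBranch c z ω) (x + t * ω) * R (x + t * ω) * ω

/-- The solution that decays along the direction `ω`. -/
def raySol (ε : ℝ) (c z : Fin P → ℂ) (ω : ℂ) (R : ℂ → ℂ) (lam x : ℂ) : ℂ :=
  I / ε * rayInt ε c z ω R lam x / expo ε lam (rayBranch c z ω) x

theorem re_neg_I_mul_div (lam : ℂ) : (-I * (lam * ω) / ε).re = (lam * ω).im / ε := by
  rw [div_ofReal_re]; simp

/-- The linear part of the phase decays at the rate `-(lam * ω).im/ε`; half of this is spent on
absorbing the polynomial growth due to the antiderivative. -/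
theorem norm_expo_le (hε : 0 < ε) (hδ : 0 < δ) (hω : ω ≠ 0) {lam : ℂ} (hlam : (lam * ω).im < 0) :
    ∃ C : ℝ, 0 < C ∧ ∀ x ∈ rayDom z ω δ, ∀ t : ℝ, 0 ≤ t →
      ‖expo ε lam (rayBranch c z ω) (x + t * ω)‖
        ≤ C * Real.exp (-(-(lam * ω).im / (2 * ε)) * t) * ‖expo ε lam (rayBranch c z ω) x‖ := by
  have hκ : 0 < -(lam * ω).im / (2 * ε) := by
    apply div_pos <;> linarith
  obtain ⟨C, hC0, hC⟩ := norm_exp_rayBranch_sub_le (c := c) (z := z) hε hδ hω hκ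
  refine ⟨C, hC0, fun x hx t ht => ?_⟩
  have e : expo ε lam (rayBranch c z ω) (x + t * ω)
      = cexp (-I * (lam * ω) / ε * t)
        * cexp (-I * (rayBranch c z ω (x + t * ω) - rayBranch c z ω x) / ε)
        * expo ε lam (rayBranch c z ω) x := by
    unfold expo
    rw [← Complex.exp_add, ← Complex.exp_add]
    congr 1
    ring
  have h1 : ‖cexp (-I * (lam * ω) / ε * t)‖ = Real.exp ((lam * ω).im / ε * t) := by
    rw [norm_exp, re_mul_ofReal, re_neg_I_mul_div]
  rw [e, norm_mul, norm_mul, h1]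
  have h2 := hC x hx t ht
  refine mul_le_mul_of_nonneg_right ?_ (norm_nonneg _)
  calc _ ≤ Real.exp ((lam * ω).im / ε * t) * (C * Real.exp (-(lam * ω).im / (2 * ε) * t)) := by gcongr
    _ = C * (Real.exp ((lam * ω).im / ε * t) * Real.exp (-(lam * ω).im / (2 * ε) * t)) := by ring
    _ = _ := by
      rw [← Real.exp_add]
      congr 2
      field_simp
      ring

theorem norm_rat_ray_le (hδ : 0 < δ) (r : ℂ) (α β : Fin P → ℂ) {x : ℂ} (hx : x ∈ rayDom z ω δ)
    {t : ℝ} (ht : 0 ≤ t) :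
    ‖rat z r α β (x + t * ω)‖ ≤ ‖r‖ + (∑ p, (‖α p‖ + ‖β p‖)) / δ := by
  refine norm_rat_le r α β hδ fun ζ hζ => le_trans ?_ (hx ζ hζ t ht)
  nlinarith

theorem continuousOn_ray (hδ : 0 < δ) {x : ℂ} (hx : x ∈ rayDom z ω δ) {g : ℂ → ℂ}
    (hg : ∀ y ∈ rayDom z ω δ, ContinuousAt g y) :
    ContinuousOn (fun t : ℝ => g (x + t * ω)) (Ici 0) := fun t ht =>
  ((hg _ (rayDom_translate hδ hx ht)).comp (f := fun t : ℝ => x + t * ω)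
    (by fun_prop)).continuousWithinAt

theorem differentiableAt_expo_mul_rat (hε : 0 < ε) (hδ : 0 < δ) (hω : ω ≠ 0) (lam r : ℂ)
    (α β : Fin P → ℂ) {x : ℂ} (hx : x ∈ rayDom z ω δ) :
    DifferentiableAt ℂ (fun x => expo ε lam (rayBranch c z ω) x * rat z r α β x) x :=
  (hasDerivAt_expo hε (hasDerivAt_rayBranch hδ hω hx)).differentiableAt.mul
    (differentiableAt_rat r α β (notMem_poles_of_rayDom hδ hx))

theorem aestronglyMeasurable_ray (hε : 0 < ε) (hδ : 0 < δ) (hω : ω ≠ 0) (lam r : ℂ)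
    (α β : Fin P → ℂ) {x : ℂ} (hx : x ∈ rayDom z ω δ) :
    AEStronglyMeasurable (fun t : ℝ => expo ε lam (rayBranch c z ω) (x + t * ω)
      * rat z r α β (x + t * ω) * ω) (volume.restrict (Ioi 0)) := by
  refine ContinuousOn.aestronglyMeasurable ?_ measurableSet_Ioi
  refine ((continuousOn_ray (g := fun y => expo ε lam (rayBranch c z ω) y * rat z r α β y) hδ hx
    fun y hy => ?_).mono Ioi_subset_Ici_self).mul continuousOn_const
  exact (differentiableAt_expo_mul_rat hε hδ hω lam r α β hy).continuousAt

theorem integrableOn_ray (hε : 0 < ε) (hδ : 0 < δ) (hω : ω ≠ 0) {lam : ℂ}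
    (hlam : (lam * ω).im < 0) (r : ℂ) (α β : Fin P → ℂ) {x : ℂ} (hx : x ∈ rayDom z ω δ) :
    IntegrableOn (fun t : ℝ => expo ε lam (rayBranch c z ω) (x + t * ω)
      * rat z r α β (x + t * ω) * ω) (Ioi 0) := by
  obtain ⟨C, hC0, hC⟩ := norm_expo_le (c := c) (z := z) hε hδ hω hlam
  have hκ : 0 < -(lam * ω).im / (2 * ε) := by apply div_pos <;> linarith
  refine Integrable.mono' (integrableOn_exp_neg_mul hκ (C * ‖expo ε lam (rayBranch c z ω) x‖
    * (‖r‖ + (∑ p, (‖α p‖ + ‖β p‖)) / δ) * ‖ω‖)) (aestronglyMeasurable_ray hε hδ hω lam r α β hx) ?_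
  refine (ae_restrict_iff' measurableSet_Ioi).mpr (ae_of_all _ fun t ht => ?_)
  rw [norm_mul, norm_mul]
  have h1 := hC x hx t (le_of_lt ht)
  have h2 := norm_rat_ray_le hδ r α β hx (le_of_lt ht)
  calc _ ≤ C * Real.exp (-(-(lam * ω).im / (2 * ε)) * t) * ‖expo ε lam (rayBranch c z ω) x‖
        * (‖r‖ + (∑ p, (‖α p‖ + ‖β p‖)) / δ) * ‖ω‖ := by gcongr
    _ = _ := by ring

/-- Only the ratio of `expo` at `x + tω` and at `x` enters, and its integral over the ray is bounded
uniformly in `x`. Hence one constant serves all right-hand sides and all starting points, which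
later gives both boundedness and decay rates. -/
theorem norm_raySol_le (hε : 0 < ε) (hδ : 0 < δ) (hω : ω ≠ 0) {lam : ℂ}
    (hlam : (lam * ω).im < 0) :
    ∃ C : ℝ, 0 < C ∧ ∀ (R : ℂ → ℂ), ∀ x ∈ rayDom z ω δ, ∀ B : ℝ,
      (∀ t : ℝ, 0 ≤ t → ‖R (x + t * ω)‖ ≤ B) → ‖raySol ε c z ω R lam x‖ ≤ C * B := by
  obtain ⟨C, hC0, hC⟩ := norm_expo_le (c := c) (z := z) hε hδ hω hlam
  set κ := -(lam * ω).im / (2 * ε) with hκd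
  have hκ : 0 < κ := by apply div_pos <;> linarith
  refine ⟨1 / ε * (C * ‖ω‖ * (1 / κ)), by positivity, fun R x hx B hB => ?_⟩
  set E := ‖expo ε lam (rayBranch c z ω) x‖ with hE
  have hE0 : 0 < E := norm_pos_iff.mpr (expo_ne_zero _ _ _)
  have hB0 : 0 ≤ B := (norm_nonneg _).trans (hB 0 le_rfl)
  have h1 : ‖rayInt ε c z ω R lam x‖ ≤ C * E * B * ‖ω‖ * (1 / κ) := by
    unfold rayInt
    have hi := integral_exp_mul_Ioi (a := -κ) (by linarith) 0
    have e : C * E * B * ‖ω‖ * (1 / κ)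
        = ∫ t in Ioi (0 : ℝ), C * E * B * ‖ω‖ * Real.exp (-κ * t) := by
      rw [integral_const_mul, hi]; simp
    rw [e]
    refine norm_integral_le_of_norm_le (integrableOn_exp_neg_mul hκ _) ?_
    refine (ae_restrict_iff' measurableSet_Ioi).mpr (ae_of_all _ fun t ht => ?_)
    rw [norm_mul, norm_mul]
    have h1 := hC x hx t (le_of_lt ht)
    have h2 := hB t (le_of_lt ht)
    calc _ ≤ C * Real.exp (-κ * t) * E * B * ‖ω‖ := by gcongr
      _ = _ := by ring
  rw [raySol, norm_div, norm_mul, norm_div, norm_I, norm_real, Real.norm_of_nonneg hε.le,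
    div_le_iff₀ hE0]
  calc _ ≤ 1 / ε * (C * E * B * ‖ω‖ * (1 / κ)) := by gcongr
    _ = _ := by ring

/-- Differentiation in `x` under the integral produces `g'(x + tω) ω`, which is the derivative of
`g(x + tω)` in `t`; since `g` vanishes at the end of the ray, the integral is `-g x`. -/
theorem hasDerivAt_rayInt (hε : 0 < ε) (hδ : 0 < δ) (hω : ω ≠ 0) {lam : ℂ}
    (hlam : (lam * ω).im < 0) (r : ℂ) (α β : Fin P → ℂ) {x : ℂ} (hx : x ∈ rayDom z ω δ) :
    HasDerivAt (rayInt ε c z ω (rat z r α β) lam)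
      (-(expo ε lam (rayBranch c z ω) x * rat z r α β x)) x := by
  set g : ℂ → ℂ := fun x => expo ε lam (rayBranch c z ω) x * rat z r α β x with hg
  have hδ2 : 0 < δ / 2 := half_pos hδ
  have hδ4 : 0 < δ / 4 := by linarith
  obtain ⟨C, hC0, hC⟩ := norm_expo_le (c := c) (z := z) hε hδ2 hω hlam
  set κ := -(lam * ω).im / (2 * ε) with hκd
  have hκ : 0 < κ := by apply div_pos <;> linarith
  have hball : ∀ y ∈ Metric.closedBall x (δ / 2), y ∈ rayDom z ω (δ / 2) := fun y hy =>
    rayDom_of_dist_le hδ hx (by simpa [dist_eq_norm] using hy)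
  obtain ⟨K, hK⟩ := (isCompact_closedBall x (δ / 2)).exists_bound_of_continuousOn
    (f := expo ε lam (rayBranch c z ω)) fun y hy => (hasDerivAt_expo hε (hasDerivAt_rayBranch hδ2 hω
      (hball y hy))).continuousAt.continuousWithinAt
  set B : ℝ := C * K * (‖r‖ + (∑ p, (‖α p‖ + ‖β p‖)) / (δ / 2)) with hB
  have hgb : ∀ y ∈ Metric.closedBall x (δ / 2), ∀ t : ℝ, 0 ≤ t →
      ‖g (y + t * ω)‖ ≤ B * Real.exp (-κ * t) := by
    intro y hy t ht
    have h1 := hC y (hball y hy) t ht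
    have h2 := norm_rat_ray_le hδ2 r α β (hball y hy) ht
    have h3 := hK y hy
    have hK0 : 0 ≤ K := (norm_nonneg _).trans h3
    have h4 := h1.trans (mul_le_mul_of_nonneg_left h3 (by positivity))
    rw [hg, norm_mul]
    calc _ ≤ C * Real.exp (-κ * t) * K * (‖r‖ + (∑ p, (‖α p‖ + ‖β p‖)) / (δ / 2)) := by gcongr
        _ ≤ _ := by rw [hB]; apply le_of_eq; ring
  have hgd : ∀ y ∈ rayDom z ω (δ / 2), DifferentiableAt ℂ g y := fun y hy =>
    differentiableAt_expo_mul_rat hε hδ2 hω lam r α β hy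
  have hgd' : ∀ y ∈ Metric.closedBall x (δ / 2), ∀ t : ℝ, 0 ≤ t →
      DifferentiableAt ℂ g (y + t * ω) := fun y hy t ht =>
    hgd _ (rayDom_translate hδ2 (hball y hy) ht)
  have hsub4 : Metric.ball x (δ / 4) ⊆ Metric.closedBall x (δ / 2) :=
    (Metric.ball_subset_ball (by linarith)).trans Metric.ball_subset_closedBall
  -- The integrable majorant for the derivative comes from Cauchy's estimate on circles of radius
  -- `δ/4`, translated along the ray: they remain in the region where `g` itself has an exponential
  -- bound.
  have hderiv : ∀ y ∈ Metric.ball x (δ / 4), ∀ t : ℝ, 0 ≤ t →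
      ‖deriv g (y + t * ω)‖ ≤ B * Real.exp (-κ * t) / (δ / 4) := by
    intro y hy t ht
    have hyd : dist y x < δ / 4 := hy
    have hmem : ∀ w ∈ Metric.closedBall (y + t * ω) (δ / 4),
        w - t * ω ∈ Metric.closedBall x (δ / 2) := by
      intro w hw
      rw [mem_closedBall_iff_norm] at hw ⊢
      rw [dist_eq_norm] at hyd
      calc ‖w - t * ω - x‖ = ‖(w - (y + t * ω)) + (y - x)‖ := by ring_nf
        _ ≤ _ := norm_add_le _ _
        _ ≤ _ := by linarith
    refine Complex.norm_deriv_le_of_forall_mem_sphere_norm_le hδ4 ?_ fun w hw => ?_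
    · refine DifferentiableOn.diffContOnCl (s := Metric.ball (y + t * ω) (δ / 4)) fun w hw => ?_
      rw [closure_ball _ hδ4.ne'] at hw
      have := hgd' _ (hmem w hw) t ht
      rw [sub_add_cancel] at this
      exact this.differentiableWithinAt
    · have := hgb _ (hmem w (Metric.sphere_subset_closedBall hw)) t ht
      rwa [sub_add_cancel] at this
  have hmain := hasDerivAt_integral_of_dominated_loc_of_deriv_le
    (μ := volume.restrict (Ioi (0 : ℝ))) (F := fun y (t : ℝ) => g (y + t * ω) * ω)
    (F' := fun y (t : ℝ) => deriv g (y + t * ω) * ω) (x₀ := x) (s := Metric.ball x (δ / 4))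
    (bound := fun t => B / (δ / 4) * ‖ω‖ * Real.exp (-κ * t)) (Metric.ball_mem_nhds _ hδ4) ?_
    (integrableOn_ray hε hδ hω hlam r α β hx) ?_ ?_ (integrableOn_exp_neg_mul hκ _) ?_
  · refine hmain.2.congr_deriv ?_
    have hFTC := integral_Ioi_of_hasDerivAt_of_tendsto' (a := (0 : ℝ)) (m := (0 : ℂ))
      (f := fun t : ℝ => g (x + t * ω)) (f' := fun t : ℝ => deriv g (x + t * ω) * ω)
      (fun t ht => ?_) hmain.1 ?_
    · rw [hFTC]; simp [hg]
    · have h1 : HasDerivAt (fun t : ℝ => x + t * ω) ω t := by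
        simpa using ((hasDerivAt_id t).ofReal_comp.mul_const ω).const_add x
      exact (hgd' x (Metric.mem_closedBall_self hδ2.le) t ht).hasDerivAt.comp_of_eq t h1 rfl
    · have h0 : Tendsto (fun t : ℝ => B * Real.exp (-κ * t)) atTop (𝓝 0) := by
        have := Real.tendsto_exp_neg_atTop_nhds_zero.comp (tendsto_id.const_mul_atTop hκ)
        simpa using this.const_mul B
      refine squeeze_zero_norm' ?_ h0
      filter_upwards [eventually_ge_atTop 0] with t ht
      exact hgb x (Metric.mem_closedBall_self hδ2.le) t ht
  · filter_upwards [rayDom_mem_nhds hδ hx] with y hy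
    exact aestronglyMeasurable_ray hε hδ2 hω lam r α β hy
  · refine ContinuousOn.aestronglyMeasurable ?_ measurableSet_Ioi
    refine ContinuousOn.mul (fun t ht => ContinuousAt.continuousWithinAt ?_) continuousOn_const
    have hy := rayDom_translate hδ hx (le_of_lt ht)
    have : AnalyticAt ℂ g (x + t * ω) := by
      rw [analyticAt_iff_eventually_differentiableAt]
      filter_upwards [rayDom_mem_nhds hδ hy] with y hy using hgd y hy
    exact this.deriv.continuousAt.comp (f := fun t : ℝ => x + t * ω) (by fun_prop)
  · refine (ae_restrict_iff' measurableSet_Ioi).mpr (ae_of_all _ fun t ht y hy => ?_)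
    rw [norm_mul]
    have := hderiv y hy t (le_of_lt ht)
    calc _ ≤ B * Real.exp (-κ * t) / (δ / 4) * ‖ω‖ := by gcongr
      _ = _ := by ring
  · refine (ae_restrict_iff' measurableSet_Ioi).mpr (ae_of_all _ fun t ht y hy => ?_)
    have h1 := (hgd' y (hsub4 hy) t (le_of_lt ht)).hasDerivAt
    exact (h1.comp_add_const y (t * ω)).mul_const ω

theorem solvesAt_raySol (hε : 0 < ε) (hδ : 0 < δ) (hω : ω ≠ 0) {lam : ℂ}
    (hlam : (lam * ω).im < 0) (r : ℂ) (α β : Fin P → ℂ) {x : ℂ} (hx : x ∈ rayDom z ω δ) :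
    SolvesAt ε c z lam (rat z r α β) (raySol ε c z ω (rat z r α β) lam) x := by
  refine solvesAt_div_expo hε (hasDerivAt_rayBranch hδ hω hx)
    (((hasDerivAt_rayInt hε hδ hω hlam r α β hx).const_mul (I / ε)).congr_deriv ?_)
  have : (ε : ℂ) ≠ 0 := by exact_mod_cast hε.ne'
  field_simp
  rw [I_sq]
  ring

/-- The ray integrals depend analytically on the spectral parameter. -/
theorem hasDerivAt_rayInt_param (hε : 0 < ε) (hδ : 0 < δ) (hω : ω ≠ 0) {lam : ℂ}
    (hlam : (lam * ω).im < 0) (r : ℂ) (α β : Fin P → ℂ) {x : ℂ} (hx : x ∈ rayDom z ω δ) :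
    HasDerivAt (fun lam => rayInt ε c z ω (rat z r α β) lam x)
      (rayInt ε c z ω (fun y => -I / ε * y * rat z r α β y) lam x) lam := by
  have hε' : (ε : ℂ) ≠ 0 := by exact_mod_cast hε.ne'
  -- All dependence on `lam` is in `exp(-i lam x/ε) exp(-i lam ω t/ε)`, so the ray integral is an
  -- exponential times the Laplace transform of `q`, the integrand at `lam = 0`, at `s = -i lam
  -- ω/ε`.
  set q : ℝ → ℂ := fun t =>
    expo ε 0 (rayBranch c z ω) (x + t * ω) * rat z r α β (x + t * ω) * ω with hq
  have hqm : AEStronglyMeasurable q (volume.restrict (Ioi 0)) :=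
    aestronglyMeasurable_ray hε hδ hω 0 r α β hx
  have hqb : ∀ κ : ℝ, 0 < κ → ∃ C : ℝ, ∀ t : ℝ, 0 < t → ‖q t‖ ≤ C * Real.exp (κ * t) := by
    intro κ hκ
    obtain ⟨C, hC0, hC⟩ := norm_exp_rayBranch_sub_le (c := c) (z := z) hε hδ hω hκ
    refine ⟨C * ‖expo ε 0 (rayBranch c z ω) x‖ * (‖r‖ + (∑ p, (‖α p‖ + ‖β p‖)) / δ) * ‖ω‖,
      fun t ht => ?_⟩
    have h1 := hC x hx t ht.le
    have h2 := norm_rat_ray_le hδ r α β hx ht.le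
    have e : expo ε 0 (rayBranch c z ω) (x + t * ω)
        = cexp (-I * (rayBranch c z ω (x + t * ω) - rayBranch c z ω x) / ε)
          * expo ε 0 (rayBranch c z ω) x := by
      unfold expo
      rw [← Complex.exp_add]
      congr 1
      ring
    rw [hq, norm_mul, norm_mul, e, norm_mul]
    calc _ ≤ C * Real.exp (κ * t) * ‖expo ε 0 (rayBranch c z ω) x‖
          * (‖r‖ + (∑ p, (‖α p‖ + ‖β p‖)) / δ) * ‖ω‖ := by gcongr
      _ = _ := by ring
  have hs : (-I * (lam * ω) / ε).re < 0 := by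
    rw [re_neg_I_mul_div]; exact div_neg_of_neg_of_pos hlam hε
  obtain ⟨hint, hL⟩ := hasDerivAt_laplace hqm hqb hs
  have e1 : ∀ (lam : ℂ) (t : ℝ) (k : ℂ), expo ε lam (rayBranch c z ω) (x + t * ω)
      * (k * rat z r α β (x + t * ω)) * ω
      = cexp (-I * lam * x / ε) * (k * (cexp (-I * (lam * ω) / ε * t) * q t)) := by
    intro lam t k
    have : expo ε lam (rayBranch c z ω) (x + t * ω) = cexp (-I * lam * x / ε)
        * cexp (-I * (lam * ω) / ε * t) * expo ε 0 (rayBranch c z ω) (x + t * ω) := by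
      unfold expo
      rw [← Complex.exp_add, ← Complex.exp_add]
      congr 1
      ring
    rw [this, hq]
    ring
  have h1 : HasDerivAt (fun lam : ℂ => -I * (lam * ω) / ε) (-I * ω / ε) lam := by
    have := (((hasDerivAt_id lam).mul_const ω).const_mul (-I)).div_const (ε : ℂ)
    simpa using this
  have h2 : HasDerivAt (fun lam : ℂ => cexp (-I * lam * x / ε))
      (cexp (-I * lam * x / ε) * (-I * x / ε)) lam := by
    have := (((hasDerivAt_id lam).const_mul (-I)).mul_const x).div_const (ε : ℂ)
    simpa using this.cexp
  have h3 := h2.mul (hL.comp lam h1)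
  have e0 : (fun lam => rayInt ε c z ω (rat z r α β) lam x) = fun lam =>
      cexp (-I * lam * x / ε) * ∫ t in Ioi (0 : ℝ), cexp (-I * (lam * ω) / ε * t) * q t := by
    ext lam
    rw [rayInt, ← integral_const_mul]
    refine integral_congr_ae (ae_of_all _ fun t => ?_)
    simpa using e1 lam t 1
  rw [e0]
  refine h3.congr_deriv ?_
  have hint2 : IntegrableOn (fun t : ℝ => cexp (-I * (lam * ω) / ε * t) * (t * q t)) (Ioi 0) := by
    refine (hasDerivAt_laplace (q := fun t => t * q t)
      ((Continuous.aestronglyMeasurable (by fun_prop)).mul hqm) (fun κ hκ => ?_) hs).1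
    obtain ⟨C, hC⟩ := hqb (κ / 2) (by linarith)
    refine ⟨(κ / 2)⁻¹ * C, fun t ht => ?_⟩
    have h3 : ‖(t : ℂ)‖ ≤ (κ / 2)⁻¹ * Real.exp (κ / 2 * t) := by
      rw [norm_real, Real.norm_of_nonneg (le_of_lt ht), ← div_eq_inv_mul,
        le_div_iff₀ (by linarith)]
      have := Real.add_one_le_exp (κ / 2 * t)
      linarith
    rw [norm_mul]
    have h4 := hC t ht
    calc _ ≤ ((κ / 2)⁻¹ * Real.exp (κ / 2 * t)) * (C * Real.exp (κ / 2 * t)) := by gcongr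
      _ = (κ / 2)⁻¹ * C * (Real.exp (κ / 2 * t) * Real.exp (κ / 2 * t)) := by ring
      _ = _ := by rw [← Real.exp_add]; ring_nf
  simp only [Function.comp_def, rayInt]
  simp_rw [e1]
  rw [integral_const_mul]
  have e3 : ∀ t : ℝ, -I / ε * (x + t * ω) * (cexp (-I * (lam * ω) / ε * t) * q t)
      = -I * x / ε * (cexp (-I * (lam * ω) / ε * t) * q t)
        + -I * ω / ε * (cexp (-I * (lam * ω) / ε * t) * (t * q t)) := fun t => by ring
  simp_rw [e3]
  rw [integral_add (hint.const_mul _) (hint2.const_mul _), integral_const_mul, integral_const_mul]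
  ring

end

end BenjaminOno

namespace BenjaminOno
open Complex Set Filter MeasureTheory

noncomputable section

variable {P : ℕ} {ε : ℝ} {c z : Fin P → ℂ} {ω : ℂ} {δ : ℝ}

/-! ### Regions of the plane -/

/-- A height above all the poles. -/
def height (z : Fin P → ℂ) : ℝ := 1 + ∑ p, (z p).im

theorem im_add_one_le_height (hz : ∀ p, 0 < (z p).im) (p : Fin P) : (z p).im + 1 ≤ height z := by
  unfold height
  have := Finset.single_le_sum (f := fun p => (z p).im) (fun p _ => (hz p).le) (Finset.mem_univ p)
  linarith

theorem height_pos (hz : ∀ p, 0 < (z p).im) : 0 < height z := by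
  unfold height
  have := Finset.sum_nonneg (s := Finset.univ) fun p _ => (hz p).le
  linarith

theorem im_add_one_le_height_of_mem_poles (hz : ∀ p, 0 < (z p).im) {ζ : ℂ} (hζ : ζ ∈ poles z) :
    ζ.im + 1 ≤ height z := by
  obtain ⟨p, rfl | rfl⟩ := hζ
  · exact im_add_one_le_height hz p
  · have := im_add_one_le_height hz p
    have := hz p
    rw [conj_im]; linarith

/-- The half-plane above all the poles. -/
def highDom (z : Fin P → ℂ) : Set ℂ := {x | height z - 1 / 2 < x.im}

theorem isOpen_highDom : IsOpen (highDom z) := isOpen_lt continuous_const continuous_im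

theorem isPreconnected_highDom : IsPreconnected (highDom z) :=
  (convex_halfSpace_im_gt _).isPreconnected

/-- The imaginary part of `x + tω - ζ` exceeds `1/2 + t`, because `ω.im = 1`. The margin `1/2` in
`highDom` leaves the line at `height z` inside an open set while keeping this distance. -/
theorem highDom_subset_rayDom (hz : ∀ p, 0 < (z p).im) (hω : ω.im = 1) :
    highDom z ⊆ rayDom z ω (1 / 2) := by
  intro x hx ζ hζ t ht
  have h1 := im_add_one_le_height_of_mem_poles hz hζ
  have hx' : height z - 1 / 2 < x.im := hx
  refine le_trans ?_ (le_trans (le_abs_self _) (abs_im_le_norm _))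
  simp [hω]
  linarith

theorem add_mul_mem_highDom (hω : ω.im = 1) {x : ℂ} (hx : x ∈ highDom z) {t : ℝ} (ht : 0 ≤ t) :
    x + t * ω ∈ highDom z := by
  have hx' : height z - 1 / 2 < x.im := hx
  change height z - 1 / 2 < _
  simp [hω]
  linarith

/-- From `‖x + tω‖ ≥ t`, by imaginary parts, and `‖x + tω‖ ≥ ‖x‖ - t‖ω‖` one gets `‖x + tω‖ ≥ d(‖x‖
+ t)`: a ray in an upward direction that starts far out in the closed upper half-plane never comes
back near the origin, even if `ω` is slanted and `x` is on the real line. -/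
theorem exists_far_rayDom (hω : ω.im = 1) :
    ∃ R δ : ℝ, 0 < R ∧ 0 < δ ∧ ∀ x : ℂ, 0 ≤ x.im → R ≤ ‖x‖ →
      x ∈ rayDom z ω δ ∧ ∀ t : ℝ, 0 ≤ t → δ * ‖x‖ ≤ ‖x + t * ω‖ := by
  obtain ⟨B, hB⟩ := (finite_poles (z := z)).isCompact.exists_bound_of_continuousOn
    (f := id) continuousOn_id
  set d : ℝ := 1 / (2 * (1 + ‖ω‖)) with hd
  have hd0 : 0 < d := by positivity
  have hd1 : d ≤ 1 / 2 := by
    rw [hd]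
    exact one_div_le_one_div_of_le two_pos (by linarith [norm_nonneg ω])
  have key : ∀ x : ℂ, 0 ≤ x.im → ∀ t : ℝ, 0 ≤ t → d * (‖x‖ + t) ≤ ‖x + t * ω‖ := by
    intro x hx t ht
    have h1 : t ≤ ‖x + t * ω‖ := by
      refine le_trans ?_ (le_trans (le_abs_self _) (abs_im_le_norm _))
      simp [hω, hx]
    have h2 : ‖x‖ ≤ ‖x + t * ω‖ + t * ‖ω‖ := by
      have : ‖x‖ = ‖(x + t * ω) - t * ω‖ := by ring_nf
      rw [this]
      refine (norm_sub_le _ _).trans ?_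
      rw [norm_mul, norm_real, Real.norm_of_nonneg ht]
    have h3 : ‖x‖ ≤ (1 + ‖ω‖) * ‖x + t * ω‖ := by
      nlinarith [mul_le_mul_of_nonneg_right h1 (norm_nonneg ω)]
    have h4 : d * ‖x‖ ≤ ‖x + t * ω‖ / 2 := by
      rw [hd, div_mul_eq_mul_div, one_mul, div_le_div_iff₀ (by positivity) two_pos]
      nlinarith
    nlinarith
  refine ⟨2 * (|B| + 1) / d, d / 2, by positivity, by positivity, fun x hx hR => ⟨?_, ?_⟩⟩
  · intro ζ hζ t ht
    have h1 := key x hx t ht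
    have h2 : ‖ζ‖ ≤ |B| := (hB ζ hζ).trans (le_abs_self B)
    have h3 := norm_sub_norm_le (x + t * ω) ζ
    rw [div_le_iff₀ hd0] at hR
    nlinarith [abs_nonneg B]
  · intro t ht
    have := key x hx t ht
    nlinarith [norm_nonneg x]

/-- The whole ray from `x` stays at distance at least `δ‖x‖` from the origin, so `R` is `O(‖x‖⁻ⁿ)`
on it, and `norm_raySol_le` passes this on to the solution. -/
theorem isBigO_raySol (hε : 0 < ε) (hω : ω.im = 1) {lam : ℂ} (hlam : (lam * ω).im < 0)
    {R : ℂ → ℂ} {n : ℕ} (hR : R =O[upperInfty] fun x => (x ^ n)⁻¹) :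
    raySol ε c z ω R lam =O[upperInfty] fun x => (x ^ n)⁻¹ := by
  have hω0 : ω ≠ 0 := fun h => by simp [h] at hω
  obtain ⟨R₀, δ, hR₀, hδ, hfar⟩ := exists_far_rayDom (z := z) hω
  obtain ⟨C, hC0, hC⟩ := norm_raySol_le (c := c) (z := z) hε hδ hω0 hlam
  obtain ⟨A, R₁, hR₁, hA⟩ := isBigO_upperInfty_iff.mp hR
  refine isBigO_upperInfty_iff.mpr ⟨C * (|A| / δ ^ n), max R₀ (R₁ / δ), by positivity,
    fun x hx hxR => ?_⟩
  obtain ⟨h1, h2⟩ := hfar x hx ((le_max_left _ _).trans hxR)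
  have hx0 : 0 < ‖x‖ := hR₀.trans_le ((le_max_left _ _).trans hxR)
  refine (hC R x h1 (|A| / (δ * ‖x‖) ^ n) fun t ht => ?_).trans (le_of_eq ?_)
  · have h3 := h2 t ht
    have h4 : R₁ ≤ δ * ‖x‖ := by
      have := (le_max_right R₀ (R₁ / δ)).trans hxR
      rw [div_le_iff₀ hδ] at this
      linarith
    refine (hA _ ?_ (h4.trans h3)).trans ?_
    · simp [hω]; linarith
    · gcongr
      exact le_abs_self A
  · rw [mul_pow]; field_simp

theorem isBigO_rat (α β : Fin P → ℂ) : rat z 0 α β =O[upperInfty] fun x => x⁻¹ := by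
  have : rat z 0 α β = fun x => ∑ p, (α p * (x - z p)⁻¹ + β p * (x - conj (z p))⁻¹) := by
    ext x; simp [rat, div_eq_mul_inv]
  rw [this]
  exact Asymptotics.IsBigO.fun_sum fun p _ => ((isBigO_inv_sub_upperInfty _).const_mul_left _).add
    ((isBigO_inv_sub_upperInfty _).const_mul_left _)

theorem eventually_notMem_poles : ∀ᶠ x in upperInfty, x ∉ poles z := by
  refine Filter.Eventually.filter_mono inf_le_left ?_
  exact (finite_poles (z := z)).isBounded

theorem eventually_ne_zero_upperInfty : ∀ᶠ x in upperInfty, x ≠ 0 := by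
  refine Filter.Eventually.filter_mono inf_le_left ?_
  exact (Set.finite_singleton (0 : ℂ)).isBounded

/-- By `mul_rat`, `x` times the function has value `∑ (α p + β p)` at infinity; if this vanishes,
the product is again `O(1/x)`. -/
theorem isBigO_rat_of_sum_eq_zero {α β : Fin P → ℂ} (h : ∑ p, (α p + β p) = 0) :
    rat z 0 α β =O[upperInfty] fun x => (x ^ 2)⁻¹ := by
  have h1 := isBigO_pow_two_of_mul (Asymptotics.isBigO_refl (fun x : ℂ => x⁻¹) upperInfty)
    (isBigO_rat (z := z) (fun p => 1 * z p * α p) (fun p => 1 * conj (z p) * β p))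
  refine h1.congr' ?_ .rfl
  filter_upwards [eventually_notMem_poles (z := z), eventually_ne_zero_upperInfty] with x hx hx0
  have := mul_rat α β 1 hx
  rw [h, mul_zero] at this
  rw [← this]
  field_simp

/-! ### Domains with vertical cuts, and the strips between the poles -/

/-- The domain of `antideriv`. -/
def dDom (z : Fin P → ℂ) : Set ℂ :=
  {x | ∀ p, x.re = (z p).re → -(z p).im < x.im ∧ x.im < (z p).im}

/-- The domain cut downwards from the `z p`. -/
def vDom (z : Fin P → ℂ) : Set ℂ := {x | ∀ p, x.re = (z p).re → (z p).im < x.im}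

/-- The vertical strip around the abscissa `a` bounded by the neighbouring poles. -/
def gapDom (z : Fin P → ℂ) (a : ℝ) : Set ℂ :=
  {x | ∀ p, ((z p).re < a → (z p).re < x.re) ∧ (¬(z p).re < a → x.re < (z p).re)}

theorem isOpen_imp_re {a : ℝ} {s : Set ℂ} (hs : IsOpen s) : IsOpen {x : ℂ | x.re = a → x ∈ s} := by
  have : {x : ℂ | x.re = a → x ∈ s} = {x : ℂ | x.re = a}ᶜ ∪ s := by
    ext x; simp [imp_iff_not_or]
  rw [this]
  exact (isClosed_eq continuous_re continuous_const).isOpen_compl.union hs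

theorem isOpen_dDom : IsOpen (dDom z) := by
  have : dDom z = ⋂ p, {x | x.re = (z p).re → x ∈ {x : ℂ | -(z p).im < x.im ∧ x.im < (z p).im}} := by
    ext; simp [dDom]
  rw [this]
  exact isOpen_iInter_of_finite fun p => isOpen_imp_re
    ((isOpen_lt continuous_const continuous_im).inter (isOpen_lt continuous_im continuous_const))

theorem isOpen_vDom : IsOpen (vDom z) := by
  have : vDom z = ⋂ p, {x | x.re = (z p).re → x ∈ {x : ℂ | (z p).im < x.im}} := by
    ext; simp [vDom]
  rw [this]
  exact isOpen_iInter_of_finite fun p => isOpen_imp_re (isOpen_lt continuous_const continuous_im)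

theorem isOpen_gapDom {a : ℝ} : IsOpen (gapDom z a) := by
  have : gapDom z a = ⋂ p, {x | ((z p).re < a → (z p).re < x.re) ∧
      (¬(z p).re < a → x.re < (z p).re)} := by
    ext; simp [gapDom]
  rw [this]
  refine isOpen_iInter_of_finite fun p => ?_
  by_cases h : (z p).re < a
  · simpa [h] using isOpen_lt continuous_const continuous_re
  · simpa [h] using isOpen_lt continuous_re continuous_const

theorem isPreconnected_gapDom {a : ℝ} : IsPreconnected (gapDom z a) := by
  refine Convex.isPreconnected ?_
  have : gapDom z a = ⋂ p, {x | ((z p).re < a → (z p).re < x.re) ∧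
      (¬(z p).re < a → x.re < (z p).re)} := by
    ext; simp [gapDom]
  rw [this]
  refine convex_iInter fun p => ?_
  by_cases h : (z p).re < a
  · simpa [h] using convex_halfSpace_re_gt _
  · simpa [h] using convex_halfSpace_re_lt _

theorem gapDom_re_ne {a : ℝ} {x : ℂ} (hx : x ∈ gapDom z a) (p : Fin P) : x.re ≠ (z p).re := by
  by_cases h : (z p).re < a
  · exact ((hx p).1 h).ne'
  · exact ((hx p).2 h).ne

theorem mem_dDom_of_re_ne {x : ℂ} (h : ∀ p, x.re ≠ (z p).re) : x ∈ dDom z :=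
  fun p hp => absurd hp (h p)

theorem mem_vDom_of_re_ne {x : ℂ} (h : ∀ p, x.re ≠ (z p).re) : x ∈ vDom z :=
  fun p hp => absurd hp (h p)

theorem mem_gapDom {a : ℝ} (ha : ∀ p, a ≠ (z p).re) (t : ℝ) : (a : ℂ) + t * I ∈ gapDom z a := by
  intro p
  simp only [add_re, ofReal_re, mul_re, I_re, mul_zero, ofReal_im, I_im, mul_one, sub_self,
    add_zero]
  exact ⟨id, fun h => lt_of_le_of_ne (not_lt.mp h) (ha p)⟩

theorem isComb_dDom (hz : ∀ p, 0 < (z p).im) : IsComb (dDom z) 0 where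
  isOpen := isOpen_dDom
  line s p _ := by simp [hz p]
  vert x hx t ht p hp := by
    have h := hx p (by simpa using hp)
    have := hz p
    simp only [add_im, ofReal_im, mul_im, ofReal_re, I_im, mul_one, I_re, mul_zero, add_zero,
      zero_add]
    rcases mem_uIcc.mp ht with ⟨h1, h2⟩ | ⟨h1, h2⟩ <;> constructor <;> linarith

theorem isComb_vDom (hz : ∀ p, 0 < (z p).im) : IsComb (vDom z) (height z) where
  isOpen := isOpen_vDom
  line s p _ := by
    have := im_add_one_le_height hz p
    simp; linarith
  vert x hx t ht p hp := by
    have h := hx p (by simpa using hp)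
    have := im_add_one_le_height hz p
    simp only [add_im, ofReal_im, mul_im, ofReal_re, I_im, mul_one, I_re, mul_zero, add_zero,
      zero_add]
    rcases mem_uIcc.mp ht with ⟨h1, h2⟩ | ⟨h1, h2⟩ <;> linarith

theorem highDom_subset_vDom (hz : ∀ p, 0 < (z p).im) : highDom z ⊆ vDom z := by
  intro x hx p _
  have := im_add_one_le_height hz p
  have hx' : height z - 1 / 2 < x.im := hx
  linarith

theorem notMem_poles_of_dDom {x : ℂ} (hx : x ∈ dDom z) :
    x ∉ poles z := by
  rintro ⟨p, rfl | rfl⟩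
  · exact lt_irrefl _ (hx p rfl).2
  · have := (hx p (by simp)).1
    simp at this

theorem notMem_poles_of_vDom (hz : ∀ p, 0 < (z p).im) {x : ℂ} (hx : x ∈ vDom z) :
    x ∉ poles z := by
  rintro ⟨p, rfl | rfl⟩
  · exact lt_irrefl _ (hx p rfl)
  · have := hx p (by simp)
    have := hz p
    simp at *
    linarith

/-! ### Branches of the antiderivative on the cut domains -/

theorem hasDerivAt_log_I_mul {ζ x : ℂ} (h : x.re = ζ.re → x.im < ζ.im) :
    HasDerivAt (fun x => log (I * (x - ζ))) (1 / (x - ζ)) x := by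
  have hs : I * (x - ζ) ∈ slitPlane := by
    rw [mem_slitPlane_iff]
    by_cases hre : x.re = ζ.re
    · left; simp [h hre]
    · right; simpa [sub_eq_zero] using hre
  have h1 : HasDerivAt (fun x => I * (x - ζ)) I x := by
    simpa using ((hasDerivAt_id x).sub_const ζ).const_mul I
  refine (h1.clog hs).congr_deriv ?_
  have : x - ζ ≠ 0 := fun h => by simp [h] at hs
  have := I_ne_zero
  field_simp

theorem hasDerivAt_log_neg_I_mul {ζ x : ℂ} (h : x.re = ζ.re → ζ.im < x.im) :
    HasDerivAt (fun x => log (-I * (x - ζ))) (1 / (x - ζ)) x := by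
  have hs : -I * (x - ζ) ∈ slitPlane := by
    rw [mem_slitPlane_iff]
    by_cases hre : x.re = ζ.re
    · left; simp [h hre]
    · right
      intro h0
      apply hre
      simp at h0
      linarith
  have h1 : HasDerivAt (fun x => -I * (x - ζ)) (-I) x := by
    simpa using ((hasDerivAt_id x).sub_const ζ).const_mul (-I)
  refine (h1.clog hs).congr_deriv ?_
  have : x - ζ ≠ 0 := fun h => by simp [h] at hs
  have := I_ne_zero
  field_simp

theorem hasDerivAt_antideriv {x : ℂ} (hx : x ∈ dDom z) :
    HasDerivAt (antideriv c z) (upot c z x) x := by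
  unfold antideriv upot rat
  rw [zero_add]
  refine HasDerivAt.fun_sum fun p _ => ?_
  have h1 := ((hasDerivAt_log_I_mul (ζ := z p) fun h => (hx p h).2).add_const
    (Real.pi * I / 2)).const_mul (c p)
  have h2 := ((hasDerivAt_log_neg_I_mul (ζ := conj (z p)) (x := x) fun h => by
    simpa using (hx p (by simpa using h)).1).sub_const (Real.pi * I / 2)).const_mul (conj (c p))
  exact (h1.add h2).congr_deriv (by ring)

theorem hasDerivAt_rayBranch_I (hz : ∀ p, 0 < (z p).im) {x : ℂ} (hx : x ∈ vDom z) :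
    HasDerivAt (rayBranch c z I) (upot c z x) x := by
  refine hasDerivAt_rayBranch_of_slit I_ne_zero fun ζ hζ => ?_
  have h : x.re = ζ.re → ζ.im < x.im := by
    obtain ⟨p, rfl | rfl⟩ := hζ
    · exact hx p
    · intro h
      have := hx p (by simpa using h)
      have := hz p
      rw [conj_im]; linarith
  have e : (x - ζ) / I = -I * (x - ζ) := by
    rw [div_I]; ring
  rw [e, mem_slitPlane_iff]
  by_cases hre : x.re = ζ.re
  · left; simp [h hre]
  · right
    intro h0
    apply hre
    simp at h0
    linarith

/-- On a strip between neighbouring poles both branches are primitives of the potential. The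
constant depends on the strip; this is the monodromy which the contour integrals have to account
for. -/
theorem exists_antideriv_eq_rayBranch_add (hz : ∀ p, 0 < (z p).im) (a : ℝ) :
    ∃ K : ℂ, ∀ x ∈ gapDom z a, antideriv c z x = rayBranch c z I x + K := by
  by_cases h : (gapDom z a).Nonempty
  · obtain ⟨x₀, hx₀⟩ := h
    refine ⟨antideriv c z x₀ - rayBranch c z I x₀, ?_⟩
    refine eqOn_of_hasDerivAt_eq (f := upot c z) isOpen_gapDom isPreconnected_gapDom
      (fun x hx => hasDerivAt_antideriv (mem_dDom_of_re_ne (gapDom_re_ne hx)))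
      (fun x hx => (hasDerivAt_rayBranch_I hz (mem_vDom_of_re_ne (gapDom_re_ne hx))).add_const _)
      hx₀ (by ring)
  · exact ⟨0, fun x hx => absurd ⟨x, hx⟩ h⟩

/-! ### The solution above the poles -/

/-- A bounded solution above all poles is the ray solution. -/
theorem SolvesAt.eq_raySol (hε : 0 < ε) (hz : ∀ p, 0 < (z p).im) (hω : ω.im = 1) {lam : ℂ}
    (hlam : (lam * ω).im < 0) {r : ℂ} {α β : Fin P → ℂ} {F : ℂ → ℂ}
    (hF : ∀ x ∈ highDom z, SolvesAt ε c z lam (rat z r α β) F x) {x : ℂ} (hx : x ∈ highDom z)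
    {B : ℝ} (hB : ∀ t : ℝ, 0 ≤ t → ‖F (x + t * ω)‖ ≤ B) :
    F x = raySol ε c z ω (rat z r α β) lam x := by
  have hω0 : ω ≠ 0 := fun h => by simp [h] at hω
  have hδ : (0 : ℝ) < 1 / 2 := by norm_num
  have hray := highDom_subset_rayDom hz hω
  set S := raySol ε c z ω (rat z r α β) lam with hS
  set f := rayBranch c z ω with hf
  have hSd : ∀ x ∈ highDom z, SolvesAt ε c z lam (rat z r α β) S x := fun x hx =>
    solvesAt_raySol hε hδ hω0 hlam r α β (hray hx)
  -- The difference of two solutions, multiplied by `expo`, is constant along the ray. Since `expo`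
  -- decays there and both solutions are bounded, the constant is 0.
  have hconst : ∀ t : ℝ, 0 ≤ t → expo ε lam f (x + t * ω) * (F (x + t * ω) - S (x + t * ω))
      = expo ε lam f x * (F x - S x) := by
    intro t ht
    have hfd : ∀ x ∈ highDom z, HasDerivAt f (upot c z x) x := fun x hx =>
      hasDerivAt_rayBranch hδ hω0 (hray hx)
    have := eqOn_of_hasDerivAt_eq (f := fun _ => 0)
      (F := fun y => expo ε lam f y * F y - expo ε lam f y * S y)
      (G := fun _ => expo ε lam f x * F x - expo ε lam f x * S x)
      isOpen_highDom isPreconnected_highDom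
      (fun y hy => (((hF y hy).expo_mul hε (hfd y hy)).sub
        ((hSd y hy).expo_mul hε (hfd y hy))).congr_deriv (sub_self _))
      (fun y _ => hasDerivAt_const _ _) hx rfl (add_mul_mem_highDom hω hx ht)
    simp only at this
    linear_combination this
  obtain ⟨C, hC0, hC⟩ := norm_raySol_le (c := c) (z := z) hε hδ hω0 hlam
  obtain ⟨C', hC'0, hC'⟩ := norm_expo_le (c := c) (z := z) hε hδ hω0 hlam
  set κ := -(lam * ω).im / (2 * ε) with hκd
  have hκ : 0 < κ := by apply div_pos <;> linarith
  set B' := C * (‖r‖ + (∑ p, (‖α p‖ + ‖β p‖)) / (1 / 2)) with hB'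
  have hSb : ∀ t : ℝ, 0 ≤ t → ‖S (x + t * ω)‖ ≤ B' := fun t ht =>
    hC _ _ (rayDom_translate hδ (hray hx) ht) _ fun s hs =>
      norm_rat_ray_le hδ r α β (rayDom_translate hδ (hray hx) ht) hs
  have hlim : Tendsto (fun t : ℝ => C' * Real.exp (-κ * t) * ‖expo ε lam f x‖ * (B + B')) atTop
      (𝓝 0) := by
    have := Real.tendsto_exp_neg_atTop_nhds_zero.comp (tendsto_id.const_mul_atTop hκ)
    have := ((this.const_mul C').mul_const ‖expo ε lam f x‖).mul_const (B + B')
    simpa using this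
  have h0 : expo ε lam f x * (F x - S x) = 0 := by
    refine norm_le_zero_iff.mp (ge_of_tendsto hlim ?_)
    filter_upwards [eventually_ge_atTop 0] with t ht
    rw [← hconst t ht, norm_mul]
    have h1 := hC' x (hray hx) t ht
    have h2 := (norm_sub_le (F (x + t * ω)) (S (x + t * ω))).trans (add_le_add (hB t ht) (hSb t ht))
    gcongr
  have := (mul_eq_zero.mp h0).resolve_left (expo_ne_zero _ _ _)
  exact sub_eq_zero.mp this

/-! ### The cut plane and the bounded solution for each spectral parameter in it -/

theorem mem_cutPlane_iff {lam : ℂ} : lam ∈ cutPlane ↔ lam.re < 0 ∨ lam.im ≠ 0 := by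
  simp only [cutPlane, mem_compl_iff, mem_image, mem_Ici, not_exists, not_and]
  constructor
  · intro h
    by_contra h'
    push Not at h'
    exact h lam.re h'.1 (by apply Complex.ext <;> simp [h'.2])
  · rintro h r hr rfl
    simp at h
    linarith

theorem isOpen_cutPlane : IsOpen cutPlane := by
  have : cutPlane = {x : ℂ | x.re < 0} ∪ {x : ℂ | x.im = 0}ᶜ := by
    ext; exact mem_cutPlane_iff
  rw [this]
  exact (isOpen_lt continuous_re continuous_const).union
    (isClosed_eq continuous_im continuous_const).isOpen_compl

theorem isPreconnected_cutPlane : IsPreconnected cutPlane := by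
  have : cutPlane = (fun x => -x) '' slitPlane := by
    ext x
    rw [image_neg_eq_neg, Set.mem_neg, mem_cutPlane_iff, mem_slitPlane_iff]
    simp
  rw [this]
  exact (starConvex_one_slitPlane.isPathConnected one_mem_slitPlane).isConnected.isPreconnected.image _
    (by fun_prop)

/-- A direction of imaginary part `1` in which `exp (-i lam x / ε)` decays. -/
def decayDir (lam : ℂ) : ℂ := if lam.im = 0 then I else ((-(lam.re + 1) / lam.im : ℝ) : ℂ) + I

theorem decayDir_im (lam : ℂ) : (decayDir lam).im = 1 := by
  unfold decayDir; split_ifs <;> simp [-ofReal_div, -ofReal_neg]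

/-- Off the real axis the slope of `decayDir` is chosen to make this imaginary part equal to `-1`;
on the negative axis it is `lam.re`. -/
theorem mul_decayDir_im {lam : ℂ} (h : lam ∈ cutPlane) : (lam * decayDir lam).im < 0 := by
  rw [mem_cutPlane_iff] at h
  unfold decayDir
  split_ifs with h0
  · simpa [h0] using h
  · simp [-ofReal_div, -ofReal_neg]
    rw [mul_div_cancel₀ _ h0]
    linarith

/-- The bounded solution above the poles. -/
def upSol (ε : ℝ) (c z : Fin P → ℂ) (R : ℂ → ℂ) (lam x : ℂ) : ℂ :=
  raySol ε c z (decayDir lam) R lam x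

theorem im_ne_zero_dir (hω : ω.im = 1) : ω ≠ 0 := fun h => by simp [h] at hω

theorem solvesAt_upSol (hε : 0 < ε) (hz : ∀ p, 0 < (z p).im) {lam : ℂ} (hlam : lam ∈ cutPlane)
    (r : ℂ) (α β : Fin P → ℂ) {x : ℂ} (hx : x ∈ highDom z) :
    SolvesAt ε c z lam (rat z r α β) (upSol ε c z (rat z r α β) lam) x :=
  solvesAt_raySol hε (by norm_num : (0 : ℝ) < 1 / 2) (im_ne_zero_dir (decayDir_im lam))
    (mul_decayDir_im hlam) r α β (highDom_subset_rayDom hz (decayDir_im lam) hx)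

/-- A bounded solution above the poles is `upSol`. -/
theorem SolvesAt.eq_upSol (hε : 0 < ε) (hz : ∀ p, 0 < (z p).im) {lam : ℂ} (hlam : lam ∈ cutPlane)
    {r : ℂ} {α β : Fin P → ℂ} {F : ℂ → ℂ}
    (hF : ∀ x ∈ highDom z, SolvesAt ε c z lam (rat z r α β) F x)
    {B : ℝ} (hB : ∀ x ∈ highDom z, ‖F x‖ ≤ B) {x : ℂ} (hx : x ∈ highDom z) :
    F x = upSol ε c z (rat z r α β) lam x :=
  SolvesAt.eq_raySol hε hz (decayDir_im lam) (mul_decayDir_im hlam) hF hx fun _ ht =>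
    hB _ (add_mul_mem_highDom (decayDir_im lam) hx ht)

theorem exists_norm_raySol_le_highDom (hε : 0 < ε) (hz : ∀ p, 0 < (z p).im) (hω : ω.im = 1)
    {lam : ℂ} (hlam : (lam * ω).im < 0) (r : ℂ) (α β : Fin P → ℂ) :
    ∃ B : ℝ, ∀ x ∈ highDom z, ‖raySol ε c z ω (rat z r α β) lam x‖ ≤ B := by
  have hδ : (0 : ℝ) < 1 / 2 := by norm_num
  obtain ⟨C, hC0, hC⟩ := norm_raySol_le (c := c) (z := z) hε hδ (im_ne_zero_dir hω) hlam
  exact ⟨_, fun x hx => hC _ x (highDom_subset_rayDom hz hω hx) _ fun t ht =>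
    norm_rat_ray_le hδ r α β (highDom_subset_rayDom hz hω hx) ht⟩

/-- `decayDir` is not continuous in `lam`. Uniqueness of the bounded solution makes the choice of
direction irrelevant, so near a given parameter the direction may be frozen when differentiating. -/
theorem raySol_eq_upSol (hε : 0 < ε) (hz : ∀ p, 0 < (z p).im) (hω : ω.im = 1) {lam : ℂ}
    (hlam : lam ∈ cutPlane) (hlamω : (lam * ω).im < 0) (r : ℂ) (α β : Fin P → ℂ) {x : ℂ}
    (hx : x ∈ highDom z) :
    raySol ε c z ω (rat z r α β) lam x = upSol ε c z (rat z r α β) lam x := by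
  obtain ⟨B, hB⟩ := exists_norm_raySol_le_highDom (c := c) hε hz hω hlamω r α β
  exact SolvesAt.eq_upSol hε hz hlam (fun y hy => solvesAt_raySol hε (by norm_num)
    (im_ne_zero_dir hω) hlamω r α β (highDom_subset_rayDom hz hω hy)) hB hx

end

end BenjaminOno

namespace BenjaminOno
open Complex Set Filter MeasureTheory

noncomputable section

variable {P : ℕ} {ε : ℝ} {c z : Fin P → ℂ} {ω : ℂ} {δ : ℝ}

/-! ### Functionals given by contour integrals -/

theorem rat_add (r r' : ℂ) (α α' β β' : Fin P → ℂ) (x : ℂ) :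
    rat z (r + r') (α + α') (β + β') x = rat z r α β x + rat z r' α' β' x := by
  simp only [rat, Pi.add_apply, add_div, Finset.sum_add_distrib]
  ring

theorem rat_smul (k r : ℂ) (α β : Fin P → ℂ) (x : ℂ) :
    rat z (k * r) (fun p => k * α p) (fun p => k * β p) x = k * rat z r α β x := by
  simp only [rat, mul_add, Finset.mul_sum, mul_div_assoc]

theorem rat_single (p : Fin P) (x : ℂ) : rat z 0 (Pi.single p 1) 0 x = 1 / (x - z p) := by
  simp [rat, Pi.single_apply, Finset.sum_ite_eq', ite_div]

theorem rat_one (x : ℂ) : rat z 1 0 0 x = 1 := by simp [rat]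

/-- Functionals on rational functions that depend on the spectral parameter like integrals
of `expo * R` over a fixed contour. -/
structure IsSpectralFunctional (ε : ℝ) (z : Fin P → ℂ) (L : (ℂ → ℂ) → ℂ → ℂ) : Prop where
  add : ∀ lam ∈ cutPlane, ∀ (r r' : ℂ) (α α' β β' : Fin P → ℂ),
    L (rat z (r + r') (α + α') (β + β')) lam = L (rat z r α β) lam + L (rat z r' α' β') lam
  smul : ∀ lam ∈ cutPlane, ∀ (k r : ℂ) (α β : Fin P → ℂ),
    L (rat z (k * r) (fun p => k * α p) (fun p => k * β p)) lam = k * L (rat z r α β) lam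
  deriv : ∀ lam ∈ cutPlane, ∀ α β : Fin P → ℂ,
    HasDerivAt (fun lam => L (rat z 0 α β) lam)
      (L (rat z (-I / ε * ∑ p, (α p + β p)) (fun p => -I / ε * z p * α p)
        (fun p => -I / ε * conj (z p) * β p)) lam) lam

namespace IsSpectralFunctional

variable {L L' : (ℂ → ℂ) → ℂ → ℂ}

theorem add_functional (h : IsSpectralFunctional ε z L) (h' : IsSpectralFunctional ε z L') :
    IsSpectralFunctional ε z fun R lam => L R lam + L' R lam where
  add lam hl r r' α α' β β' := by rw [h.add lam hl, h'.add lam hl]; ring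
  smul lam hl k r α β := by rw [h.smul lam hl, h'.smul lam hl]; ring
  deriv lam hl α β := (h.deriv lam hl α β).add (h'.deriv lam hl α β)

theorem const_mul_functional (h : IsSpectralFunctional ε z L) (k : ℂ) :
    IsSpectralFunctional ε z fun R lam => k * L R lam where
  add lam hl r r' α α' β β' := by rw [h.add lam hl]; ring
  smul lam hl k r α β := by rw [h.smul lam hl]; ring
  deriv lam hl α β := (h.deriv lam hl α β).const_mul k

theorem apply_add (h : IsSpectralFunctional ε z L) {lam : ℂ} (hl : lam ∈ cutPlane) (r : ℂ)
    (α β : Fin P → ℂ) :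
    L (rat z r α β) lam = r * L (rat z 1 0 0) lam + L (rat z 0 α β) lam := by
  have h1 := h.add lam hl r 0 0 α 0 β
  have h2 := h.smul lam hl r 1 0 0
  simp only [mul_one, Pi.zero_apply, mul_zero] at h2
  rw [add_zero, zero_add, zero_add] at h1
  rw [h1, ← h2]
  rfl

theorem apply_sum (h : IsSpectralFunctional ε z L) {lam : ℂ} (hl : lam ∈ cutPlane)
    (φ : Fin P → ℂ) :
    L (rat z 0 φ 0) lam = ∑ p, L (rat z 0 (Pi.single p 1) 0) lam * φ p := by
  have h0 : L (rat z 0 0 0) lam = 0 := by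
    have := h.smul lam hl 0 0 0 0
    simp only [mul_zero, zero_mul] at this
    exact this
  have key : ∀ s : Finset (Fin P), L (rat z 0 (fun q => if q ∈ s then φ q else 0) 0) lam
      = ∑ p ∈ s, L (rat z 0 (Pi.single p 1) 0) lam * φ p := by
    intro s
    induction s using Finset.induction_on with
    | empty => simpa [Pi.zero_def] using h0
    | insert p s hp ih =>
      rw [Finset.sum_insert hp, ← ih]
      have h1 := h.smul lam hl (φ p) 0 (Pi.single p 1) 0
      have h2 := h.add lam hl 0 0 (fun q => φ p * (Pi.single p 1 : Fin P → ℂ) q)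
        (fun q => if q ∈ s then φ q else 0) 0 0
      simp only [mul_zero, Pi.zero_apply] at h1
      rw [add_zero, add_zero] at h2
      rw [mul_comm, ← h1]
      refine Eq.trans ?_ h2
      congr 2
      ext q
      by_cases hq : q = p
      · subst hq; simp [hp]
      · simp [hq, Finset.mem_insert]
  simpa using key Finset.univ

/-- The source of the differential equation for the matrix: `x/(x - z p) = 1 + z p/(x - z p)`. -/
theorem hasDerivAt_single (h : IsSpectralFunctional ε z L) {lam : ℂ} (hl : lam ∈ cutPlane)
    (p : Fin P) :
    HasDerivAt (fun lam => L (rat z 0 (Pi.single p 1) 0) lam)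
      (-I / ε * (L (rat z 1 0 0) lam + z p * L (rat z 0 (Pi.single p 1) 0) lam)) lam := by
  refine (h.deriv lam hl _ _).congr_deriv ?_
  rw [h.apply_add hl]
  have h1 := h.smul lam hl (-I / ε * z p) 0 (Pi.single p 1) 0
  rw [mul_zero] at h1
  have e : (fun q => -I / ε * z q * (Pi.single p 1 : Fin P → ℂ) q)
      = fun q => -I / ε * z p * (Pi.single p 1 : Fin P → ℂ) q := by
    ext q
    by_cases hq : q = p
    · rw [hq]
    · simp [hq]
  rw [e]
  simp only [Pi.zero_apply, mul_zero, add_zero] at h1 ⊢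
  rw [h1]
  simp
  ring

end IsSpectralFunctional

/-- The integral of `expo * R` along the curve `γ` with constant velocity `v`. -/
def segInt (ε : ℝ) (c z : Fin P → ℂ) (γ : ℝ → ℂ) (v : ℂ) (a b : ℝ) (R : ℂ → ℂ) (lam : ℂ) : ℂ :=
  ∫ t in a..b, expo ε lam (antideriv c z) (γ t) * R (γ t) * v

theorem expo_eq_mul (lam : ℂ) (f : ℂ → ℂ) (x : ℂ) :
    expo ε lam f x = cexp (-I / ε * lam * x) * expo ε 0 f x := by
  unfold expo
  rw [← Complex.exp_add]
  congr 1
  ring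

/-- Poles need to be avoided only almost everywhere, since a contour may end at one. Integrability
at `lam = 0` suffices, because the remaining factor `exp(-i lam γ/ε)` is continuous on the compact
interval. -/
theorem isSpectralFunctional_segInt {γ : ℝ → ℂ} (hγ : Continuous γ) (v : ℂ) {a b : ℝ}
    (hp : ∀ᵐ t : ℝ, t ∈ uIoc a b → γ t ∉ poles z)
    (hi : ∀ (r : ℂ) (α β : Fin P → ℂ), IntervalIntegrable
      (fun t => expo ε 0 (antideriv c z) (γ t) * rat z r α β (γ t)) volume a b) :
    IsSpectralFunctional ε z (segInt ε c z γ v a b) := by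
  have hint : ∀ (lam r : ℂ) (α β : Fin P → ℂ), IntervalIntegrable
      (fun t => expo ε lam (antideriv c z) (γ t) * rat z r α β (γ t) * v) volume a b := by
    intro lam r α β
    have := ((hi r α β).continuousOn_mul (g := fun t => cexp (-I / ε * lam * γ t))
      (Continuous.continuousOn (by fun_prop))).mul_const v
    refine this.congr fun t _ => ?_
    rw [expo_eq_mul lam]
    ring
  refine ⟨fun lam _ r r' α α' β β' => ?_, fun lam _ k r α β => ?_, fun lam _ α β => ?_⟩
  · simp only [segInt]
    rw [← intervalIntegral.integral_add (hint _ _ _ _) (hint _ _ _ _)]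
    simp only [rat_add]
    congr 1; ext t; ring
  · simp only [segInt]
    rw [← intervalIntegral.integral_const_mul]
    simp only [rat_smul]
    congr 1; ext t; ring
  · have hd := (hasDerivAt_interval_exp (γ := fun t => -I / ε * γ t) (by fun_prop)
      ((hi 0 α β).mul_const v) lam).2
    have e : ∀ lam : ℂ, segInt ε c z γ v a b (rat z 0 α β) lam = ∫ t in a..b,
        cexp (lam * (-I / ε * γ t)) * (expo ε 0 (antideriv c z) (γ t) * rat z 0 α β (γ t) * v) := by
      intro lam
      simp only [segInt]
      congr 1; ext t
      rw [expo_eq_mul lam, show -I / ε * lam * γ t = lam * (-I / ε * γ t) by ring]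
      ring
    simp_rw [e]
    refine hd.congr_deriv ?_
    refine intervalIntegral.integral_congr_ae (hp.mono fun t ht hmem => ?_)
    rw [expo_eq_mul lam, ← mul_rat α β (-I / ε) (ht hmem),
      show -I / ε * lam * γ t = lam * (-I / ε * γ t) by ring]
    ring

/-- For a fixed direction `ω` the product is a constant multiple of the ray integral, the constant
being free of `lam`; near each parameter `upSol` agrees with the solution of such a frozen
direction. -/
theorem isSpectralFunctional_upSol (hε : 0 < ε) (hz : ∀ p, 0 < (z p).im) {x : ℂ}
    (hx : x ∈ highDom z) :
    IsSpectralFunctional ε z fun R lam => expo ε lam (antideriv c z) x * upSol ε c z R lam x := by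
  have hδ : (0 : ℝ) < 1 / 2 := by norm_num
  have hε' : (ε : ℂ) ≠ 0 := by exact_mod_cast hε.ne'
  have hint : ∀ lam ∈ cutPlane, ∀ (r : ℂ) (α β : Fin P → ℂ), _ := fun lam hl r α β =>
    integrableOn_ray (c := c) hε hδ (im_ne_zero_dir (decayDir_im lam)) (mul_decayDir_im hl) r α β
      (highDom_subset_rayDom hz (decayDir_im lam) hx)
  refine ⟨fun lam hl r r' α α' β β' => ?_, fun lam hl k r α β => ?_, fun lam hl α β => ?_⟩
  · have : rayInt ε c z (decayDir lam) (rat z (r + r') (α + α') (β + β')) lam x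
        = rayInt ε c z (decayDir lam) (rat z r α β) lam x
          + rayInt ε c z (decayDir lam) (rat z r' α' β') lam x := by
      simp only [rayInt]
      rw [← integral_add (hint lam hl _ _ _) (hint lam hl _ _ _)]
      simp only [rat_add]
      congr 1; ext t; ring
    simp only [upSol, raySol, this]
    ring
  · have : rayInt ε c z (decayDir lam) (rat z (k * r) (fun p => k * α p) (fun p => k * β p)) lam x
        = k * rayInt ε c z (decayDir lam) (rat z r α β) lam x := by
      simp only [rayInt]
      rw [← integral_const_mul]
      simp only [rat_smul]
      congr 1; ext t; ring
    simp only [upSol, raySol, this]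
    ring
  · set ω := decayDir lam with hω
    have hω1 : ω.im = 1 := decayDir_im lam
    have hω0 : ω ≠ 0 := im_ne_zero_dir hω1
    have hlω : (lam * ω).im < 0 := mul_decayDir_im hl
    have hxr := highDom_subset_rayDom hz hω1 hx
    set K := cexp (-I * (antideriv c z x - rayBranch c z ω x) / ε) with hK
    have e : ∀ (lam : ℂ) (R : ℂ → ℂ), expo ε lam (antideriv c z) x * raySol ε c z ω R lam x
        = K * (I / ε) * rayInt ε c z ω R lam x := by
      intro lam R
      have : expo ε lam (antideriv c z) x = K * expo ε lam (rayBranch c z ω) x := by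
        rw [hK]
        unfold expo
        rw [← Complex.exp_add]
        congr 1
        ring
      rw [raySol, this]
      have := expo_ne_zero (ε := ε) lam (rayBranch c z ω) x
      field_simp
    have hev : (fun lam => expo ε lam (antideriv c z) x * upSol ε c z (rat z 0 α β) lam x)
        =ᶠ[𝓝 lam] fun lam => K * (I / ε) * rayInt ε c z ω (rat z 0 α β) lam x := by
      have h1 : {l : ℂ | (l * ω).im < 0} ∈ 𝓝 lam :=
        (isOpen_lt (by fun_prop) continuous_const).mem_nhds hlω
      filter_upwards [h1, isOpen_cutPlane.mem_nhds hl] with l hl1 hl2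
      rw [← e, raySol_eq_upSol hε hz hω1 hl2 hl1 0 α β hx]
    refine (((hasDerivAt_rayInt_param hε hδ hω0 hlω 0 α β hxr).const_mul
      (K * (I / ε))).congr_of_eventuallyEq hev).congr_deriv ?_
    have e2 : rayInt ε c z ω (fun y => -I / ε * y * rat z 0 α β y) lam x
        = rayInt ε c z ω (rat z (-I / ε * ∑ p, (α p + β p)) (fun p => -I / ε * z p * α p)
          (fun p => -I / ε * conj (z p) * β p)) lam x := by
      simp only [rayInt]
      refine setIntegral_congr_fun measurableSet_Ioi fun t ht => ?_
      rw [mul_rat α β (-I / ε) (notMem_poles_of_rayDom hδ (rayDom_translate hδ hxr (le_of_lt ht)))]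
    rw [e2, ← e]
    rfl

/-! ### Poles at which the exponential is single-valued -/

/-- The condition that `expo` has a zero at `z m`. -/
def HasZeroAt (ε : ℝ) (c : Fin P → ℂ) (m : Fin P) : Prop :=
  ∃ n : ℕ, 0 < n ∧ I * c m / ε = -(n : ℂ)

/-- The domain of `antideriv` with the cut from `z m` upwards added. -/
def exDom (z : Fin P → ℂ) (m : Fin P) : Set ℂ :=
  {x | ∀ p, x.re = (z p).re → -(z p).im < x.im ∧ (p ≠ m → x.im < (z p).im)}

/-- The rational function without the pole at `z m`. -/
def ratEx (z : Fin P → ℂ) (m : Fin P) (r : ℂ) (α β : Fin P → ℂ) (x : ℂ) : ℂ :=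
  r + ∑ p, ((if p = m then 0 else α p / (x - z p)) + β p / (x - conj (z p)))

/-- The antiderivative without the logarithm at `z m`. -/
def antiderivEx (c z : Fin P → ℂ) (m : Fin P) (x : ℂ) : ℂ :=
  c m * (Real.pi * I / 2) + ∑ p, ((if p = m then 0 else
    c p * (log (I * (x - z p)) + Real.pi * I / 2))
    + conj (c p) * (log (-I * (x - conj (z p))) - Real.pi * I / 2))

variable {m : Fin P}

theorem sum_ite_add (m : Fin P) (f g : Fin P → ℂ) :
    ∑ p, (f p + g p) = f m + ∑ p, ((if p = m then 0 else f p) + g p) := by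
  rw [Finset.sum_add_distrib, Finset.sum_add_distrib, ← Finset.add_sum_erase _ f (Finset.mem_univ m),
    add_assoc]
  congr 2
  rw [← Finset.sum_erase (f := fun p => if p = m then 0 else f p) Finset.univ (a := m) (by simp)]
  exact Finset.sum_congr rfl fun p hp => by simp [Finset.ne_of_mem_erase hp]

theorem rat_eq_ratEx (r : ℂ) (α β : Fin P → ℂ) (x : ℂ) :
    rat z r α β x = α m / (x - z m) + ratEx z m r α β x := by
  rw [rat, ratEx, sum_ite_add m]
  ring

theorem antideriv_eq_antiderivEx (x : ℂ) :
    antideriv c z x = c m * log (I * (x - z m)) + antiderivEx c z m x := by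
  rw [antideriv, antiderivEx, sum_ite_add m]
  ring

theorem dDom_subset_exDom : dDom z ⊆ exDom z m := fun _ hx p hp => ⟨(hx p hp).1, fun _ => (hx p hp).2⟩

theorem mem_dDom_of_exDom {x : ℂ} (hx : x ∈ exDom z m) (h : x.re = (z m).re → x.im < (z m).im) :
    x ∈ dDom z := fun p hp => ⟨(hx p hp).1, by
  by_cases hpm : p = m
  · subst hpm; exact h hp
  · exact (hx p hp).2 hpm⟩

theorem isOpen_exDom : IsOpen (exDom z m) := by
  have : exDom z m = ⋂ p, {x | x.re = (z p).re →
      x ∈ {x : ℂ | -(z p).im < x.im ∧ (p ≠ m → x.im < (z p).im)}} := by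
    ext; simp [exDom]
  rw [this]
  refine isOpen_iInter_of_finite fun p => isOpen_imp_re ?_
  by_cases h : p = m
  · simpa [h] using isOpen_lt continuous_const continuous_im
  · simpa [h, ofPred_and] using (isOpen_lt continuous_const continuous_im).inter
      (isOpen_lt continuous_im continuous_const)

theorem isComb_exDom (hz : ∀ p, 0 < (z p).im) : IsComb (exDom z m) 0 where
  isOpen := isOpen_exDom
  line s p _ := by simp [hz p]
  vert x hx t ht p hp := by
    have h := hx p (by simpa using hp)
    have := hz p
    simp only [add_im, ofReal_im, mul_im, ofReal_re, I_im, mul_one, I_re, mul_zero, add_zero,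
      zero_add]
    rcases mem_uIcc.mp ht with ⟨h1, h2⟩ | ⟨h1, h2⟩ <;>
      refine ⟨by linarith, fun hpm => ?_⟩ <;> have := h.2 hpm <;> linarith

theorem mem_exDom_self (hz : ∀ p, 0 < (z p).im) (hre : StrictMono fun p => (z p).re) :
    z m ∈ exDom z m := by
  intro p hp
  have : m = p := hre.injective hp
  subst this
  exact ⟨by linarith [hz m], fun h => absurd rfl h⟩

theorem exDom_sub_ne_zero {x : ℂ} (hx : x ∈ exDom z m) (p : Fin P) :
    (p ≠ m → x - z p ≠ 0) ∧ x - conj (z p) ≠ 0 := by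
  constructor
  · intro hpm h
    rw [sub_eq_zero] at h
    have := (hx p (by rw [h])).2 hpm
    rw [h] at this
    exact lt_irrefl _ this
  · intro h
    rw [sub_eq_zero] at h
    have := (hx p (by simp [h])).1
    rw [h] at this
    simp at this

theorem differentiableAt_ratEx (r : ℂ) (α β : Fin P → ℂ) {x : ℂ} (hx : x ∈ exDom z m) :
    DifferentiableAt ℂ (ratEx z m r α β) x := by
  unfold ratEx
  refine (differentiableAt_const r).add (DifferentiableAt.fun_sum fun p _ => ?_)
  obtain ⟨h1, h2⟩ := exDom_sub_ne_zero hx p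
  have h4 : DifferentiableAt ℂ (fun x => β p / (x - conj (z p))) x := by
    fun_prop (disch := exact h2)
  refine DifferentiableAt.add ?_ h4
  by_cases hp : p = m
  · simp [hp]
  · simp only [hp, if_false]
    have := h1 hp
    fun_prop (disch := exact this)

theorem hasDerivAt_antiderivEx {x : ℂ} (hx : x ∈ exDom z m) :
    HasDerivAt (antiderivEx c z m) (ratEx z m 0 c (fun p => conj (c p)) x) x := by
  unfold antiderivEx ratEx
  rw [zero_add]
  refine HasDerivAt.const_add _ (HasDerivAt.fun_sum fun p _ => ?_)
  have h2 := ((hasDerivAt_log_neg_I_mul (ζ := conj (z p)) (x := x) fun h => by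
    simpa using (hx p (by simpa using h)).1).sub_const (Real.pi * I / 2)).const_mul (conj (c p))
  refine HasDerivAt.add ?_ (h2.congr_deriv (by ring))
  by_cases hp : p = m
  · simpa [hp] using hasDerivAt_const x (0 : ℂ)
  · simp only [hp, if_false]
    exact (((hasDerivAt_log_I_mul (ζ := z p) fun h => (hx p h).2 hp).add_const
      (Real.pi * I / 2)).const_mul (c p)).congr_deriv (by ring)

theorem differentiableAt_expo_antiderivEx (lam : ℂ) {x : ℂ} (hx : x ∈ exDom z m) :
    DifferentiableAt ℂ (expo ε lam (antiderivEx c z m)) x := by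
  have := (hasDerivAt_antiderivEx (c := c) hx).differentiableAt
  unfold expo
  fun_prop

/-- The function `expo * R`, divided by a power of `x - z m`, without its singularity at `z m`. -/
def regular (ε : ℝ) (c z : Fin P → ℂ) (m : Fin P) (n : ℕ) (lam r : ℂ) (α β : Fin P → ℂ)
    (x : ℂ) : ℂ :=
  I ^ n * expo ε lam (antiderivEx c z m) x * (α m + (x - z m) * ratEx z m r α β x)

theorem differentiableAt_regular (n : ℕ) (lam r : ℂ) (α β : Fin P → ℂ) {x : ℂ}
    (hx : x ∈ exDom z m) : DifferentiableAt ℂ (regular ε c z m n lam r α β) x := by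
  have h1 := differentiableAt_expo_antiderivEx (ε := ε) (c := c) lam hx
  have h2 := differentiableAt_ratEx r α β hx
  unfold regular
  fun_prop

/-- The logarithm at `z m` enters the exponent with the factor `-i c_m/ε = n`, so its exponential is
an `n`-th power, whatever the branch. In particular the identity persists on the cut above `z m`. -/
theorem expo_antideriv_eq {n : ℕ} (hn : I * c m / ε = -(n : ℂ)) (lam : ℂ) {x : ℂ} (hx : x ≠ z m) :
    expo ε lam (antideriv c z) x = (I * (x - z m)) ^ n * expo ε lam (antiderivEx c z m) x := by
  have hw : I * (x - z m) ≠ 0 := mul_ne_zero I_ne_zero (sub_ne_zero.mpr hx)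
  unfold expo
  rw [antideriv_eq_antiderivEx (m := m), ← exp_log hw, ← Complex.exp_nat_mul, ← Complex.exp_add,
    exp_log hw]
  congr 1
  have : -I * (lam * x + (c m * log (I * (x - z m)) + antiderivEx c z m x)) / ε
      = -(I * c m / ε) * log (I * (x - z m)) + -I * (lam * x + antiderivEx c z m x) / ε := by ring
  rw [this, hn, neg_neg]

theorem expo_mul_rat_eq_regular {n : ℕ} (hn0 : 0 < n) (hn : I * c m / ε = -(n : ℂ)) (lam r : ℂ)
    (α β : Fin P → ℂ) {x : ℂ} (hx : x ≠ z m) :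
    expo ε lam (antideriv c z) x * rat z r α β x
      = (x - z m) ^ (n - 1) * regular ε c z m n lam r α β x := by
  obtain ⟨k, rfl⟩ : ∃ k, n = k + 1 := ⟨n - 1, by omega⟩
  rw [expo_antideriv_eq hn lam hx, rat_eq_ratEx (m := m), regular, add_tsub_cancel_right]
  have : x - z m ≠ 0 := sub_ne_zero.mpr hx
  rw [mul_pow]
  field_simp
  ring

/-! ### The contour functionals of the linear system -/

/-- The integral up the vertical line over the abscissa `a`, continued to the cut plane. -/
def tailInt (ε : ℝ) (c z : Fin P → ℂ) (a : ℝ) (R : ℂ → ℂ) (lam : ℂ) : ℂ :=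
  segInt ε c z (fun t => a + t * I) I 0 (height z) R lam
    -- The factor `-iε` undoes the normalization `i/ε` in `raySol`, so this term is the integral of
    -- `expo * R` over the slanted ray from the top of the segment.
    + -I * ε * (expo ε lam (antideriv c z) (a + height z * I) * upSol ε c z R lam (a + height z * I))

open Classical in
/-- The integral of `expo * R` over the contour `C_m`, continued to the cut plane. -/
def sysInt (ε : ℝ) (c z : Fin P → ℂ) (m : Fin P) (R : ℂ → ℂ) (lam : ℂ) : ℂ :=
  -1 * tailInt ε c z (leftAbscissa z m) R lam +
  if HasZeroAt ε c m then
    segInt ε c z (fun s => s) 1 (leftAbscissa z m) (z m).re R lam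
      + segInt ε c z (fun t => (z m).re + t * I) I 0 (z m).im R lam
  else
    segInt ε c z (fun s => s) 1 (leftAbscissa z m) (rightAbscissa z m) R lam
      + tailInt ε c z (rightAbscissa z m) R lam

theorem leftAbscissa_lt (hre : StrictMono fun p => (z p).re) (m p : Fin P) :
    leftAbscissa z m < (z p).re := by
  have h : (⟨0, m.pos⟩ : Fin P) ≤ p := Fin.mk_le_of_le_val (Nat.zero_le _)
  have := hre.monotone h
  simp only [leftAbscissa] at this ⊢
  linarith

theorem lt_rightAbscissa (hre : StrictMono fun p => (z p).re) {m p : Fin P} (h : p ≤ m) :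
    (z p).re < rightAbscissa z m := by
  have h1 : (z p).re ≤ (z m).re := hre.monotone h
  unfold rightAbscissa
  split_ifs with hm
  · have : (z m).re < (z ⟨(m : ℕ) + 1, hm⟩).re := hre (by simp [Fin.lt_def])
    linarith
  · linarith

theorem rightAbscissa_lt (hre : StrictMono fun p => (z p).re) {m p : Fin P} (h : m < p) :
    rightAbscissa z m < (z p).re := by
  have hm : (m : ℕ) + 1 < P := lt_of_le_of_lt (Nat.succ_le_of_lt h) p.2
  have h1 : (z ⟨(m : ℕ) + 1, hm⟩).re ≤ (z p).re := hre.monotone (by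
    rw [Fin.le_def]; exact Nat.succ_le_of_lt h)
  have h2 : (z m).re < (z ⟨(m : ℕ) + 1, hm⟩).re := hre (by simp [Fin.lt_def])
  unfold rightAbscissa
  rw [dif_pos hm]
  linarith

theorem leftAbscissa_ne (hre : StrictMono fun p => (z p).re) (m p : Fin P) :
    leftAbscissa z m ≠ (z p).re := (leftAbscissa_lt hre m p).ne

theorem rightAbscissa_ne (hre : StrictMono fun p => (z p).re) (m p : Fin P) :
    rightAbscissa z m ≠ (z p).re := by
  rcases le_or_gt p m with h | h
  · exact (lt_rightAbscissa hre h).ne'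
  · exact (rightAbscissa_lt hre h).ne

theorem differentiableAt_expo_antideriv_mul_rat (hε : 0 < ε) (lam r : ℂ) (α β : Fin P → ℂ) {x : ℂ}
    (hx : x ∈ dDom z) :
    DifferentiableAt ℂ (fun x => expo ε lam (antideriv c z) x * rat z r α β x) x :=
  (hasDerivAt_expo hε (hasDerivAt_antideriv hx)).differentiableAt.mul
    (differentiableAt_rat r α β (notMem_poles_of_dDom hx))

theorem intervalIntegrable_of_dDom (hε : 0 < ε) {γ : ℝ → ℂ} (hγ : Continuous γ) {a b : ℝ}
    (h : ∀ t ∈ uIcc a b, γ t ∈ dDom z) (lam r : ℂ) (α β : Fin P → ℂ) :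
    IntervalIntegrable (fun t => expo ε lam (antideriv c z) (γ t) * rat z r α β (γ t)) volume a b :=
  ContinuousOn.intervalIntegrable fun t ht =>
    ((differentiableAt_expo_antideriv_mul_rat (c := c) hε lam r α β (h t ht)).continuousAt.comp (f := γ)
      hγ.continuousAt).continuousWithinAt

theorem mem_dDom_vert {a : ℝ} (ha : ∀ p, a ≠ (z p).re) (t : ℝ) : (a : ℂ) + t * I ∈ dDom z :=
  mem_dDom_of_re_ne fun p => by simpa using ha p

theorem mem_dDom_real (hz : ∀ p, 0 < (z p).im) (s : ℝ) : (s : ℂ) ∈ dDom z := by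
  simpa using (isComb_dDom hz).line s

theorem mem_exDom_vert (hre : StrictMono fun p => (z p).re) {t : ℝ}
    (ht : -(z m).im < t) : ((z m).re : ℂ) + t * I ∈ exDom z m := by
  intro p hp
  have : m = p := hre.injective (by simpa using hp)
  subst this
  exact ⟨by simpa using ht, fun h => absurd rfl h⟩

theorem mem_dDom_vert_pole (hre : StrictMono fun p => (z p).re) {t : ℝ}
    (ht : -(z m).im < t) (ht' : t < (z m).im) : ((z m).re : ℂ) + t * I ∈ dDom z :=
  mem_dDom_of_exDom (mem_exDom_vert hre ht) fun _ => by simpa using ht'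

theorem ae_ne_pole (b : ℝ) : ∀ᵐ t : ℝ, t ≠ b := by
  simp [ae_iff]

/-- The zero of order `n ≥ 1` of the exponential outweighs the simple pole of the rational function:
off the endpoint the integrand is `(x - z m)^(n - 1)` times a continuous function. -/
theorem intervalIntegrable_pole (hz : ∀ p, 0 < (z p).im) (hre : StrictMono fun p => (z p).re)
    (hm : HasZeroAt ε c m) (lam r : ℂ) (α β : Fin P → ℂ) :
    IntervalIntegrable (fun t : ℝ => expo ε lam (antideriv c z) ((z m).re + t * I)
      * rat z r α β ((z m).re + t * I)) volume 0 (z m).im := by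
  obtain ⟨n, hn0, hn⟩ := hm
  have h : IntervalIntegrable (fun t : ℝ => ((z m).re + t * I - z m) ^ (n - 1)
      * regular ε c z m n lam r α β ((z m).re + t * I)) volume 0 (z m).im := by
    refine ContinuousOn.intervalIntegrable (ContinuousOn.mul (by fun_prop) fun t ht => ?_)
    rw [uIcc_of_le (hz m).le] at ht
    exact ((differentiableAt_regular n lam r α β (mem_exDom_vert hre
      (by linarith [ht.1, hz m]))).continuousAt.comp (f := fun t : ℝ => ((z m).re : ℂ) + t * I)
        (by fun_prop)).continuousWithinAt
  refine h.congr_ae ((ae_restrict_iff' measurableSet_uIoc).mpr ((ae_ne_pole (z m).im).mono fun t ht _ => ?_))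
  simp only
  rw [expo_mul_rat_eq_regular hn0 hn]
  intro h
  apply ht
  have := congrArg Complex.im h
  simpa using this

theorem isSpectralFunctional_tailInt (hε : 0 < ε) (hz : ∀ p, 0 < (z p).im) {a : ℝ}
    (ha : ∀ p, a ≠ (z p).re) : IsSpectralFunctional ε z (tailInt ε c z a) := by
  refine (isSpectralFunctional_segInt (by fun_prop) I
    (ae_of_all _ fun t _ => notMem_poles_of_dDom (mem_dDom_vert ha t)) fun r α β =>
      intervalIntegrable_of_dDom hε (by fun_prop) (fun t _ => mem_dDom_vert ha t)
        0 r α β).add_functional ((isSpectralFunctional_upSol hε hz ?_).const_mul_functional _)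
  simp [highDom]

theorem isSpectralFunctional_real (hε : 0 < ε) (hz : ∀ p, 0 < (z p).im) (a b : ℝ) :
    IsSpectralFunctional ε z (segInt ε c z (fun s => s) 1 a b) :=
  isSpectralFunctional_segInt (by fun_prop) 1
    (ae_of_all _ fun t _ => notMem_poles_of_dDom (mem_dDom_real hz t)) fun r α β =>
      intervalIntegrable_of_dDom hε (by fun_prop) (fun t _ => mem_dDom_real hz t) 0 r α β

theorem isSpectralFunctional_sysInt (hε : 0 < ε) (hz : ∀ p, 0 < (z p).im)
    (hre : StrictMono fun p => (z p).re) (m : Fin P) :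
    IsSpectralFunctional ε z (sysInt ε c z m) := by
  have h1 := (isSpectralFunctional_tailInt (c := c) hε hz
    (leftAbscissa_ne hre m)).const_mul_functional (-1)
  by_cases h : HasZeroAt ε c m
  · have h2 : IsSpectralFunctional ε z
        (segInt ε c z (fun t => (z m).re + t * I) I 0 (z m).im) := by
      refine isSpectralFunctional_segInt (by fun_prop) I ((ae_ne_pole (z m).im).mono fun t ht hmem =>
        notMem_poles_of_dDom ?_) fun r α β => intervalIntegrable_pole hz hre h 0 r α β
      rw [uIoc_of_le (hz m).le] at hmem
      exact mem_dDom_vert_pole hre (by linarith [hmem.1, hz m]) (lt_of_le_of_ne hmem.2 ht)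
    have := h1.add_functional ((isSpectralFunctional_real (c := c) hε hz (leftAbscissa z m)
      (z m).re).add_functional h2)
    unfold sysInt
    simpa only [h, if_true] using this
  · have := h1.add_functional ((isSpectralFunctional_real (c := c) hε hz (leftAbscissa z m)
      (rightAbscissa z m)).add_functional
        (isSpectralFunctional_tailInt (c := c) hε hz (rightAbscissa_ne hre m)))
    unfold sysInt
    simpa only [h, if_false] using this

theorem segInt_eq_of_primitive (hε : 0 < ε) {γ : ℝ → ℂ} {v lam : ℂ} (hγ : ∀ t, HasDerivAt γ v t)
    {a b : ℝ} {r : ℂ} {α β : Fin P → ℂ} {Q : ℂ → ℂ} (h : ∀ t ∈ uIcc a b, γ t ∈ dDom z)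
    (hQ : ∀ x ∈ dDom z, HasDerivAt Q (expo ε lam (antideriv c z) x * rat z r α β x / (I * ε)) x) :
    segInt ε c z γ v a b (rat z r α β) lam = I * ε * (Q (γ b) - Q (γ a)) := by
  have hε' : (ε : ℂ) ≠ 0 := by exact_mod_cast hε.ne'
  have hi := intervalIntegrable_of_dDom (c := c) hε
    (continuous_iff_continuousAt.mpr fun t => (hγ t).continuousAt) h lam r α β
  rw [mul_sub]
  refine intervalIntegral.integral_eq_sub_of_hasDerivAt (f := fun t => I * ε * Q (γ t))
    (fun t ht => ?_) (hi.mul_const v)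
  have := ((hQ _ (h t ht)).comp_of_eq t (hγ t) rfl).const_mul (I * ε)
  refine this.congr_deriv ?_
  field_simp

theorem hasDerivAt_vert (a : ℂ) (t : ℝ) : HasDerivAt (fun t : ℝ => a + t * I) I t := by
  simpa using ((hasDerivAt_id t).ofReal_comp.mul_const I).const_add a

theorem hasDerivAt_real (t : ℝ) : HasDerivAt (fun t : ℝ => (t : ℂ)) 1 t := by
  simpa using (hasDerivAt_id t).ofReal_comp

theorem tailInt_eq_of_primitive (hε : 0 < ε) {a : ℝ} (ha : ∀ p, a ≠ (z p).re) {lam r : ℂ}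
    {α β : Fin P → ℂ} {Q : ℂ → ℂ}
    (hQ : ∀ x ∈ dDom z, HasDerivAt Q (expo ε lam (antideriv c z) x * rat z r α β x / (I * ε)) x) :
    tailInt ε c z a (rat z r α β) lam = I * ε * (Q (a + height z * I) - Q a
      - expo ε lam (antideriv c z) (a + height z * I)
        * upSol ε c z (rat z r α β) lam (a + height z * I)) := by
  rw [tailInt, segInt_eq_of_primitive hε (hasDerivAt_vert a) (fun t _ => mem_dDom_vert ha t) hQ]
  simp
  ring

/-- The contour functional in terms of a primitive, for a contour that ends at infinity. -/
theorem sysInt_eq_of_primitive (hε : 0 < ε) (hz : ∀ p, 0 < (z p).im)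
    (hre : StrictMono fun p => (z p).re) (hm : ¬HasZeroAt ε c m) {lam r : ℂ}
    {α β : Fin P → ℂ} {Q : ℂ → ℂ}
    (hQ : ∀ x ∈ dDom z, HasDerivAt Q (expo ε lam (antideriv c z) x * rat z r α β x / (I * ε)) x)
    (hleft : Q (leftAbscissa z m + height z * I)
      = expo ε lam (antideriv c z) (leftAbscissa z m + height z * I)
        * upSol ε c z (rat z r α β) lam (leftAbscissa z m + height z * I)) :
    sysInt ε c z m (rat z r α β) lam = I * ε * (Q (rightAbscissa z m + height z * I)
      - expo ε lam (antideriv c z) (rightAbscissa z m + height z * I)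
        * upSol ε c z (rat z r α β) lam (rightAbscissa z m + height z * I)) := by
  rw [sysInt, if_neg hm, tailInt_eq_of_primitive hε (leftAbscissa_ne hre m) hQ,
    tailInt_eq_of_primitive hε (rightAbscissa_ne hre m) hQ,
    segInt_eq_of_primitive hε hasDerivAt_real (fun t _ => mem_dDom_real hz t) hQ, ← hleft]
  ring

/-- The contour functional in terms of a primitive, for a contour that ends at a pole. -/
theorem sysInt_eq_of_primitive_pole (hε : 0 < ε) (hz : ∀ p, 0 < (z p).im)
    (hre : StrictMono fun p => (z p).re) (hm : HasZeroAt ε c m) {lam r l : ℂ}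
    {α β : Fin P → ℂ} {Q : ℂ → ℂ}
    (hQ : ∀ x ∈ dDom z, HasDerivAt Q (expo ε lam (antideriv c z) x * rat z r α β x / (I * ε)) x)
    (hleft : Q (leftAbscissa z m + height z * I)
      = expo ε lam (antideriv c z) (leftAbscissa z m + height z * I)
        * upSol ε c z (rat z r α β) lam (leftAbscissa z m + height z * I))
    (hl : Tendsto (fun t : ℝ => Q ((z m).re + t * I)) (𝓝[<] (z m).im) (𝓝 l)) :
    sysInt ε c z m (rat z r α β) lam = I * ε * l := by
  have hε' : (ε : ℂ) ≠ 0 := by exact_mod_cast hε.ne'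
  have hv : segInt ε c z (fun t => (z m).re + t * I) I 0 (z m).im (rat z r α β) lam
      = I * ε * (l - Q (z m).re) := by
    have hd : ∀ t ∈ Ico 0 (z m).im, HasDerivAt (fun t : ℝ => I * ε * Q ((z m).re + t * I))
        (expo ε lam (antideriv c z) ((z m).re + t * I) * rat z r α β ((z m).re + t * I) * I) t := by
      intro t ht
      have := ((hQ _ (mem_dDom_vert_pole hre (by linarith [ht.1, hz m]) ht.2)).comp_of_eq t
        (hasDerivAt_vert (z m).re t) rfl).const_mul (I * ε)
      refine this.congr_deriv ?_
      field_simp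
    have h0 : Tendsto (fun t : ℝ => I * ε * Q ((z m).re + t * I)) (𝓝[>] 0)
        (𝓝 (I * ε * Q (z m).re)) := by
      have := (hd 0 ⟨le_rfl, hz m⟩).continuousAt
      simp only [ContinuousAt, ofReal_zero, zero_mul, add_zero] at this
      exact this.mono_left nhdsWithin_le_nhds
    rw [mul_sub]
    exact intervalIntegral.integral_eq_sub_of_hasDerivAt_of_tendsto (hz m)
      (fun t ht => hd t ⟨ht.1.le, ht.2⟩) ((intervalIntegrable_pole hz hre hm lam r α β).mul_const I)
      h0 (hl.const_mul _)
  rw [sysInt, if_pos hm, tailInt_eq_of_primitive hε (leftAbscissa_ne hre m) hQ, hv,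
    segInt_eq_of_primitive hε hasDerivAt_real (fun t _ => mem_dDom_real hz t) hQ, ← hleft]
  ring

end

end BenjaminOno

namespace BenjaminOno
open Complex Set Filter MeasureTheory

noncomputable section

variable {P : ℕ} {ε : ℝ} {c z : Fin P → ℂ} {ω : ℂ} {δ : ℝ} {m : Fin P}

/-! ### Identification with the integrals for negative spectral parameter -/

theorem integral_Ioi_shift (f : ℝ → ℂ) (Y : ℝ) :
    ∫ t in Ioi (0 : ℝ), f (t + Y) = ∫ t in Ioi Y, f t := by
  have := (measurePreserving_add_right volume Y).setIntegral_preimage_emb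
    (measurableEmbedding_addRight Y) f (Ioi Y)
  simpa using this

theorem integrableOn_Ioi_shift {f : ℝ → ℂ} {Y : ℝ}
    (h : IntegrableOn (fun t => f (t + Y)) (Ioi 0)) : IntegrableOn f (Ioi Y) := by
  have := (measurePreserving_add_right volume Y).integrableOn_comp_preimage
    (measurableEmbedding_addRight Y) (f := f) (s := Ioi Y)
  refine this.mp ?_
  simpa [Function.comp_def] using h

theorem neg_mem_cutPlane {lam : ℝ} (hlam : lam < 0) : (lam : ℂ) ∈ cutPlane :=
  mem_cutPlane_iff.mpr (Or.inl (by simpa using hlam))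

/-- Cut the vertical line at `height z`. Above, within one strip, `antideriv` is `rayBranch` plus a
constant, and for negative `lam` the direction `I` is admissible, so the rest of the integral is the
ray solution in that direction, which is `upSol`. -/
theorem integral_vert_eq_tailInt (hε : 0 < ε) (hz : ∀ p, 0 < (z p).im) {a : ℝ}
    (ha : ∀ p, a ≠ (z p).re) {lam : ℝ} (hlam : lam < 0) (r : ℂ) (α β : Fin P → ℂ) :
    ∫ t in Ioi (0 : ℝ), expo ε lam (antideriv c z) (a + t * I) * rat z r α β (a + t * I) * I
      = tailInt ε c z a (rat z r α β) lam := by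
  set f : ℝ → ℂ := fun t => expo ε lam (antideriv c z) (a + t * I) * rat z r α β (a + t * I) * I
    with hf
  have hδ : (0 : ℝ) < 1 / 2 := by norm_num
  have hlamI : ((lam : ℂ) * I).im < 0 := by simpa using hlam
  have hε' : (ε : ℂ) ≠ 0 := by exact_mod_cast hε.ne'
  set x₀ : ℂ := a + height z * I with hx₀
  have hx₀m : x₀ ∈ highDom z := by simp [highDom, hx₀]
  obtain ⟨K, hK⟩ := exists_antideriv_eq_rayBranch_add (c := c) hz a
  have hE : ∀ t : ℝ, expo ε lam (antideriv c z) (a + t * I)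
      = cexp (-I * K / ε) * expo ε lam (rayBranch c z I) (a + t * I) := by
    intro t
    unfold expo
    rw [hK _ (mem_gapDom ha t), ← Complex.exp_add]
    congr 1
    ring
  have hshift : ∀ t : ℝ, f (t + height z) = cexp (-I * K / ε)
      * (expo ε lam (rayBranch c z I) (x₀ + t * I) * rat z r α β (x₀ + t * I) * I) := by
    intro t
    have e : (a : ℂ) + ((t + height z : ℝ) : ℂ) * I = x₀ + t * I := by
      rw [hx₀]; push_cast; ring
    simp only [hf]
    rw [hE, e]
    ring
  have hint := integrableOn_ray (c := c) hε hδ I_ne_zero hlamI r α β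
    (highDom_subset_rayDom hz I_im hx₀m)
  have h1 : IntegrableOn f (Ioi (height z)) := by
    refine integrableOn_Ioi_shift ?_
    simp_rw [hshift]
    exact hint.const_mul _
  have h2 : IntervalIntegrable f volume 0 (height z) :=
    (intervalIntegrable_of_dDom (c := c) hε (γ := fun t : ℝ => a + t * I) (by fun_prop)
      (fun t _ => mem_dDom_vert ha t) lam r α β).mul_const I
  rw [← intervalIntegral.integral_interval_add_Ioi' h2 h1, ← integral_Ioi_shift]
  simp_rw [hshift]
  rw [integral_const_mul, tailInt]
  congr 1
  rw [← raySol_eq_upSol hε hz I_im (neg_mem_cutPlane hlam) hlamI r α β hx₀m, raySol, hx₀, hE, ← hx₀]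
  have := expo_ne_zero (ε := ε) lam (rayBranch c z I) x₀
  simp only [rayInt]
  field_simp
  rw [I_sq]
  ring

theorem integralC_eq_sysInt (hε : 0 < ε) (hz : ∀ p, 0 < (z p).im)
    (hre : StrictMono fun p => (z p).re) {lam : ℝ} (hlam : lam < 0) (m : Fin P) (r : ℂ)
    (α β : Fin P → ℂ) :
    integralC ε c z m (fun x => expo ε lam (antideriv c z) x * rat z r α β x)
      = sysInt ε c z m (rat z r α β) lam := by
  classical
  unfold integralC sysInt
  change (if HasZeroAt ε c m then _ else _) = _
  have h1 := integral_vert_eq_tailInt (c := c) hε hz (leftAbscissa_ne hre m) hlam r α β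
  by_cases h : HasZeroAt ε c m
  · rw [if_pos h, if_pos h, ← h1]
    simp [integralL, segInt, add_assoc]
  · rw [if_neg h, if_neg h, ← h1,
      ← integral_vert_eq_tailInt hε hz (rightAbscissa_ne hre m) hlam r α β]
    simp [integralU, segInt, add_assoc]

theorem matA_eq_sysInt (hε : 0 < ε) (hz : ∀ p, 0 < (z p).im)
    (hre : StrictMono fun p => (z p).re) (m p : Fin P) {lam : ℝ} (hlam : lam < 0) :
    matA ε c z m p lam = sysInt ε c z m (rat z 0 (Pi.single p 1) 0) lam := by
  rw [← integralC_eq_sysInt hε hz hre hlam]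
  simp only [rat_single, matA, expo, phase, mul_one_div]

theorem vecB_eq_sysInt (hε : 0 < ε) (hz : ∀ p, 0 < (z p).im)
    (hre : StrictMono fun p => (z p).re) (m : Fin P) {lam : ℝ} (hlam : lam < 0) :
    vecB ε c z m lam = -lam * sysInt ε c z m (rat z 1 0 0) lam := by
  rw [← integralC_eq_sysInt hε hz hre hlam]
  simp only [rat_one, vecB, expo, phase, mul_one]

theorem analyticOnNhd_sysInt_single (hε : 0 < ε) (hz : ∀ p, 0 < (z p).im)
    (hre : StrictMono fun p => (z p).re) (m p : Fin P) :
    AnalyticOnNhd ℂ (fun lam => sysInt ε c z m (rat z 0 (Pi.single p 1) 0) lam) cutPlane :=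
  DifferentiableOn.analyticOnNhd (fun _ hl =>
    ((isSpectralFunctional_sysInt hε hz hre m).hasDerivAt_single hl
      p).differentiableAt.differentiableWithinAt) isOpen_cutPlane

/-- The differentiation rule of spectral functionals covers only rational functions that vanish at
infinity. Analyticity for the constant 1 is read off from `hasDerivAt_single`, solved for it: `L(1)
= iεA' - z_m A` for the diagonal entry `A`. -/
theorem analyticOnNhd_sysInt_one (hε : 0 < ε) (hz : ∀ p, 0 < (z p).im)
    (hre : StrictMono fun p => (z p).re) (m : Fin P) :
    AnalyticOnNhd ℂ (fun lam => sysInt ε c z m (rat z 1 0 0) lam) cutPlane := by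
  have hε' : (ε : ℂ) ≠ 0 := by exact_mod_cast hε.ne'
  have hA := analyticOnNhd_sysInt_single (c := c) hε hz hre m m
  have h := ((analyticOnNhd_const (v := I * ε)).mul hA.deriv).sub
    ((analyticOnNhd_const (v := z m)).mul hA)
  refine h.congr isOpen_cutPlane fun lam hl => ?_
  simp only [Pi.sub_apply]
  rw [((isSpectralFunctional_sysInt hε hz hre m).hasDerivAt_single hl m).deriv]
  field_simp
  rw [I_sq]
  ring

theorem isContinuedA_sysInt (hε : 0 < ε) (hz : ∀ p, 0 < (z p).im)
    (hre : StrictMono fun p => (z p).re) :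
    IsContinuedA ε c z fun lam => Matrix.of fun m p =>
      sysInt ε c z m (rat z 0 (Pi.single p 1) 0) lam :=
  fun m p => ⟨analyticOnNhd_sysInt_single hε hz hre m p, fun _ hlam =>
    (matA_eq_sysInt hε hz hre m p hlam).symm⟩

theorem isContinuedB_sysInt (hε : 0 < ε) (hz : ∀ p, 0 < (z p).im)
    (hre : StrictMono fun p => (z p).re) :
    IsContinuedB ε c z fun lam m => -lam * sysInt ε c z m (rat z 1 0 0) lam :=
  fun m => ⟨analyticOnNhd_id.neg.mul (analyticOnNhd_sysInt_one hε hz hre m), fun _ hlam =>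
    (vecB_eq_sysInt hε hz hre m hlam).symm⟩

/-- Identity theorem on the connected cut plane; the negative numbers near `-1` provide the
accumulation point. -/
theorem IsContinuation.eqOn {g : ℝ → ℂ} {G H : ℂ → ℂ} (hG : IsContinuation g G)
    (hH : IsContinuation g H) : EqOn G H cutPlane := by
  have h1 : ((-1 : ℝ) : ℂ) ∈ cutPlane := neg_mem_cutPlane (by norm_num)
  refine hG.1.eqOn_of_preconnected_of_frequently_eq hH.1 isPreconnected_cutPlane h1 ?_
  have h2 : Tendsto (fun x : ℝ => (x : ℂ)) (𝓝[≠] (-1)) (𝓝[≠] ((-1 : ℝ) : ℂ)) := by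
    refine tendsto_nhdsWithin_iff.mpr ⟨?_, ?_⟩
    · exact (continuous_ofReal.tendsto (-1 : ℝ)).mono_left nhdsWithin_le_nhds
    · filter_upwards [self_mem_nhdsWithin] with x hx h
      exact hx (ofReal_injective h)
  refine h2.frequently (Eventually.frequently ?_)
  filter_upwards [mem_nhdsWithin_of_mem_nhds (Iio_mem_nhds (by norm_num : (-1 : ℝ) < 0))] with x hx
  rw [hG.2 x hx, hH.2 x hx]

theorem IsContinuedA.eq_sysInt {A : ℂ → Matrix (Fin P) (Fin P) ℂ} (hA : IsContinuedA ε c z A)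
    (hε : 0 < ε) (hz : ∀ p, 0 < (z p).im) (hre : StrictMono fun p => (z p).re) (m p : Fin P)
    {lam : ℂ} (hl : lam ∈ cutPlane) :
    A lam m p = sysInt ε c z m (rat z 0 (Pi.single p 1) 0) lam :=
  (hA m p).eqOn (isContinuedA_sysInt hε hz hre m p) hl

theorem IsContinuedB.eq_sysInt {b : ℂ → Fin P → ℂ} (hb : IsContinuedB ε c z b)
    (hε : 0 < ε) (hz : ∀ p, 0 < (z p).im) (hre : StrictMono fun p => (z p).re) (m : Fin P)
    {lam : ℂ} (hl : lam ∈ cutPlane) :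
    b lam m = -lam * sysInt ε c z m (rat z 1 0 0) lam :=
  (hb m).eqOn (isContinuedB_sysInt hε hz hre m) hl

theorem IsContinuedA.mulVec_eq {A : ℂ → Matrix (Fin P) (Fin P) ℂ} (hA : IsContinuedA ε c z A)
    (hε : 0 < ε) (hz : ∀ p, 0 < (z p).im) (hre : StrictMono fun p => (z p).re)
    {lam : ℂ} (hl : lam ∈ cutPlane) (φ : Fin P → ℂ) (m : Fin P) :
    (A lam *ᵥ φ) m = sysInt ε c z m (rat z 0 φ 0) lam := by
  rw [(isSpectralFunctional_sysInt hε hz hre m).apply_sum hl, Matrix.mulVec, dotProduct]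
  exact Finset.sum_congr rfl fun p _ => by rw [hA.eq_sysInt hε hz hre m p hl]

/-- In matrix form `A' = (i/(ελ)) b 1ᵀ - (i/ε) A diag(z)`, because the functional of the constant 1
is `-b/λ`. The analysis of the pole uses nothing else about the derivative of `A`. -/
theorem IsContinuedA.hasDerivAt {A : ℂ → Matrix (Fin P) (Fin P) ℂ} {b : ℂ → Fin P → ℂ}
    (hA : IsContinuedA ε c z A) (hb : IsContinuedB ε c z b)
    (hε : 0 < ε) (hz : ∀ p, 0 < (z p).im) (hre : StrictMono fun p => (z p).re)
    {lam : ℂ} (hl : lam ∈ cutPlane) (m p : Fin P) :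
    HasDerivAt (fun lam => A lam m p) (I / (ε * lam) * b lam m - I / ε * (A lam m p * z p)) lam := by
  have hl0 : lam ≠ 0 := by
    rintro rfl
    simpa using mem_cutPlane_iff.mp hl
  refine (((isSpectralFunctional_sysInt (c := c) hε hz hre m).hasDerivAt_single hl
    p).congr_of_eventuallyEq ?_).congr_deriv ?_
  · filter_upwards [isOpen_cutPlane.mem_nhds hl] with l hl' using hA.eq_sysInt hε hz hre m p hl'
  · rw [hA.eq_sysInt hε hz hre m p hl, hb.eq_sysInt hε hz hre m hl]
    have hε' : (ε : ℂ) ≠ 0 := by exact_mod_cast hε.ne'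
    field_simp
    ring

end

end BenjaminOno

namespace BenjaminOno
open Complex Set Filter MeasureTheory

noncomputable section

variable {P : ℕ} {ε : ℝ} {c z : Fin P → ℂ} {ω : ℂ} {δ : ℝ} {m : Fin P}

/-! ### Existence of decaying solutions in the upper half-plane -/

theorem SolvesAt.differentiableAt {lam : ℂ} {R F : ℂ → ℂ} {x : ℂ}
    (h : SolvesAt ε c z lam R F x) : DifferentiableAt ℂ F x := HasDerivAt.differentiableAt h

theorem exists_base_abscissa (hre : StrictMono fun p => (z p).re) :
    ∃ a : ℝ, (∀ p, a < (z p).re) ∧ ∀ m, leftAbscissa z m = a := by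
  rcases Nat.eq_zero_or_pos P with rfl | hP
  · exact ⟨0, fun p => p.elim0, fun p => p.elim0⟩
  · exact ⟨leftAbscissa z ⟨0, hP⟩, fun p => leftAbscissa_lt hre _ p, fun m => rfl⟩

theorem mem_gapDom_cases (hre : StrictMono fun p => (z p).re) {a : ℝ} (ha : ∀ p, a < (z p).re)
    {x : ℂ} (hx : ∀ p, x.re ≠ (z p).re) :
    x ∈ gapDom z a ∨ ∃ m, x ∈ gapDom z (rightAbscissa z m) := by
  classical
  by_cases h : ∃ p, (z p).re < x.re
  · right
    set s : Finset (Fin P) := Finset.univ.filter fun p => (z p).re < x.re with hs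
    have hne : s.Nonempty := by
      obtain ⟨p, hp⟩ := h
      exact ⟨p, by simp [hs, hp]⟩
    set m := s.max' hne with hm
    have hmx : (z m).re < x.re := by
      have := s.max'_mem hne
      simpa [hs] using this
    refine ⟨m, fun p => ⟨fun hp => ?_, fun hp => ?_⟩⟩
    · have hpm : p ≤ m := by
        by_contra hpm
        exact absurd (rightAbscissa_lt hre (not_le.mp hpm)) (by linarith)
      have : (z p).re ≤ (z m).re := hre.monotone hpm
      linarith
    · refine lt_of_le_of_ne (not_lt.mp fun hlt => hp ?_) (hx p)
      exact lt_rightAbscissa hre (s.le_max' p (by simp [hs, hlt]))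
  · left
    push Not at h
    exact fun p => ⟨fun hp => absurd (ha p) (by linarith), fun _ => lt_of_le_of_ne (h p) (hx p)⟩

/-- The part above `z m` of the strip between the neighbouring poles. -/
def overDom (z : Fin P → ℂ) (m : Fin P) : Set ℂ :=
  {x | (z m).im < x.im ∧ ∀ p, (p < m → (z p).re < x.re) ∧ (m < p → x.re < (z p).re)}

theorem isOpen_overDom : IsOpen (overDom z m) := by
  have : overDom z m = {x : ℂ | (z m).im < x.im} ∩ ⋂ p, ({x | (p < m → (z p).re < x.re)} ∩
      {x | (m < p → x.re < (z p).re)}) := by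
    ext; simp [overDom]
  rw [this]
  refine (isOpen_lt continuous_const continuous_im).inter (isOpen_iInter_of_finite fun p => ?_)
  refine IsOpen.inter ?_ ?_
  · by_cases h : p < m
    · simpa [h] using isOpen_lt continuous_const continuous_re
    · simp [h]
  · by_cases h : m < p
    · simpa [h] using isOpen_lt continuous_re continuous_const
    · simp [h]

theorem isPreconnected_overDom : IsPreconnected (overDom z m) := by
  refine Convex.isPreconnected ?_
  have : overDom z m = {x : ℂ | (z m).im < x.im} ∩ ⋂ p, ({x | (p < m → (z p).re < x.re)} ∩
      {x | (m < p → x.re < (z p).re)}) := by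
    ext; simp [overDom]
  rw [this]
  refine (convex_halfSpace_im_gt _).inter (convex_iInter fun p => ?_)
  refine Convex.inter ?_ ?_
  · by_cases h : p < m
    · simpa [h] using convex_halfSpace_re_gt _
    · simpa [h] using convex_univ
  · by_cases h : m < p
    · simpa [h] using convex_halfSpace_re_lt _
    · simpa [h] using convex_univ

theorem overDom_re_ne {x : ℂ} (hx : x ∈ overDom z m) {p : Fin P} (hp : p ≠ m) :
    x.re ≠ (z p).re := by
  rcases lt_or_gt_of_ne hp with h | h
  · exact ((hx.2 p).1 h).ne'
  · exact ((hx.2 p).2 h).ne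

theorem overDom_subset_vDom : overDom z m ⊆ vDom z := fun x hx p hp => by
  by_cases h : p = m
  · subst h; exact hx.1
  · exact absurd hp (overDom_re_ne hx h)

theorem overDom_subset_exDom (hz : ∀ p, 0 < (z p).im) : overDom z m ⊆ exDom z m :=
  fun x hx p hp => by
  by_cases h : p = m
  · subst h; exact ⟨by linarith [hx.1, hz p], fun h => absurd rfl h⟩
  · exact absurd hp (overDom_re_ne hx h)

/-- A neighbourhood of `z m` in the upper half-plane. -/
def nearDom (z : Fin P → ℂ) (m : Fin P) : Set ℂ := {x | 0 < x.im ∧ ∀ p, p ≠ m → x.re ≠ (z p).re}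

theorem isOpen_nearDom : IsOpen (nearDom z m) := by
  have : nearDom z m = {x : ℂ | 0 < x.im} ∩ ⋂ p, {x | p ≠ m → x.re ≠ (z p).re} := by
    ext; simp [nearDom]
  rw [this]
  refine (isOpen_lt continuous_const continuous_im).inter (isOpen_iInter_of_finite fun p => ?_)
  by_cases h : p = m
  · simp [h]
  · simp only [h, ne_eq, not_false_eq_true, true_imp_iff]
    exact isOpen_ne_fun continuous_re continuous_const

theorem mem_nearDom (hz : ∀ p, 0 < (z p).im) (hre : StrictMono fun p => (z p).re) (m : Fin P) :
    z m ∈ nearDom z m := ⟨hz m, fun _ hp h => hp (hre.injective h.symm)⟩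

theorem nearDom_subset_exDom (hz : ∀ p, 0 < (z p).im) : nearDom z m ⊆ exDom z m :=
  fun x hx p hp => by
  by_cases h : p = m
  · subst h; exact ⟨by linarith [hx.1, hz p], fun h => absurd rfl h⟩
  · exact absurd hp (hx.2 p h)

theorem nearDom_subset_union (hz : ∀ p, 0 < (z p).im) :
    nearDom z m \ {z m} ⊆ vDom z ∪ dDom z := by
  rintro x ⟨hx, hxm⟩
  by_cases h : x.re = (z m).re
  · rcases lt_trichotomy x.im (z m).im with hlt | heq | hgt
    · exact Or.inr (mem_dDom_of_exDom (nearDom_subset_exDom hz hx) fun _ => hlt)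
    · exact absurd (Complex.ext h heq) hxm
    · refine Or.inl fun p hp => ?_
      by_cases hpm : p = m
      · subst hpm; exact hgt
      · exact absurd hp (hx.2 p hpm)
  · exact Or.inr (mem_dDom_of_exDom (nearDom_subset_exDom hz hx) fun h' => absurd h' h)

theorem upper_subset_union (hre : StrictMono fun p => (z p).re) {x : ℂ}
    (hx : 0 ≤ x.im) (hxp : x ∉ poles z) : x ∈ vDom z ∪ dDom z := by
  by_cases h : ∃ m, x.re = (z m).re
  · obtain ⟨m, hm⟩ := h
    have huniq : ∀ p, x.re = (z p).re → p = m := fun p hp => hre.injective (hp.symm.trans hm)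
    rcases lt_trichotomy x.im (z m).im with hlt | heq | hgt
    · right
      intro p hp
      rw [huniq p hp]
      exact ⟨by linarith, hlt⟩
    · exact absurd (Complex.ext hm heq ▸ mem_poles_left m) hxp
    · left
      intro p hp
      rw [huniq p hp]
      exact hgt
  · push Not at h
    exact Or.inl (mem_vDom_of_re_ne h)

/-- The single-valued exponential near a pole at which `HasZeroAt` holds. -/
def expoEx (ε : ℝ) (c z : Fin P → ℂ) (m : Fin P) (n : ℕ) (lam x : ℂ) : ℂ :=
  (I * (x - z m)) ^ n * expo ε lam (antiderivEx c z m) x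

/-- Unlike `expo` with `antideriv`, this form is differentiable across the cut above `z m`. The
condition on `n` says `c m = iεn`, so the logarithmic derivative of the power is the polar part of
`upot` at `z m` divided by `iε`. -/
theorem hasDerivAt_expoEx (hε : 0 < ε) {n : ℕ} (hn : I * c m / ε = -(n : ℂ)) (hn0 : 0 < n)
    (lam : ℂ) {x : ℂ} (hx : x ∈ exDom z m) (hxm : x ≠ z m) :
    HasDerivAt (expoEx ε c z m n lam)
      ((lam + upot c z x) / (I * ε) * expoEx ε c z m n lam x) x := by
  have hε' : (ε : ℂ) ≠ 0 := by exact_mod_cast hε.ne'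
  have hx0 : x - z m ≠ 0 := sub_ne_zero.mpr hxm
  have h1 : HasDerivAt (fun x => (I * (x - z m)) ^ n)
      (n * (I * (x - z m)) ^ (n - 1) * I) x := by
    have := (((hasDerivAt_id x).sub_const (z m)).const_mul I).pow n
    exact this.congr_deriv (by simp)
  have h2 := ((((hasDerivAt_id x).const_mul lam).add
    (hasDerivAt_antiderivEx (c := c) hx)).const_mul (-I)).div_const (ε : ℂ)
  have h3 : HasDerivAt (expo ε lam (antiderivEx c z m))
      (expo ε lam (antiderivEx c z m) x
        * (-I * (lam * 1 + ratEx z m 0 c (fun p => conj (c p)) x) / ε)) x := h2.cexp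
  refine (h1.mul h3).congr_deriv ?_
  obtain ⟨k, rfl⟩ : ∃ k, n = k + 1 := ⟨n - 1, by omega⟩
  rw [upot, rat_eq_ratEx (m := m), expoEx, add_tsub_cancel_right, pow_succ]
  have hc : c m = I * ε * ((k + 1 : ℕ) : ℂ) := by
    field_simp at hn
    linear_combination -I * hn + c m * I_sq
  rw [hc]
  generalize (I * (x - z m)) ^ k = y
  have := I_ne_zero
  field_simp
  linear_combination (-(x - z m) * y * expo ε lam (antiderivEx c z m) x * (lam + ratEx z m 0 c (fun p => conj (c p)) x)) * I_sq

/-- If all contour functionals vanish on a rational function `R` without constant term, the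
equation `i ε F' + (lam + u) F = R` has a solution that is holomorphic up to the real line and
decays at infinity. -/
theorem exists_solution (hε : 0 < ε) (hz : ∀ p, 0 < (z p).im)
    (hre : StrictMono fun p => (z p).re) {lam : ℂ} (hlam : lam ∈ cutPlane) {α β : Fin P → ℂ}
    (hsys : ∀ m, sysInt ε c z m (rat z 0 α β) lam = 0) :
    ∃ F : ℂ → ℂ, (∀ x : ℂ, 0 ≤ x.im → DifferentiableAt ℂ F x) ∧
      (∀ x : ℂ, 0 ≤ x.im → x ∉ poles z → SolvesAt ε c z lam (rat z 0 α β) F x) ∧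
      (F =O[upperInfty] fun x => x⁻¹) ∧
      (∑ p, (α p + β p) = 0 → F =O[upperInfty] fun x => (x ^ 2)⁻¹) := by
  classical
  have hε' : (ε : ℂ) ≠ 0 := by exact_mod_cast hε.ne'
  set R := rat z 0 α β with hR
  set U := upSol ε c z R lam with hU
  obtain ⟨a₀, ha₀, hleft⟩ := exists_base_abscissa hre
  set xl : ℂ := a₀ + height z * I with hxl
  have hhigh : ∀ a : ℝ, (a : ℂ) + height z * I ∈ highDom z := fun a => by simp [highDom]
  -- the two branches of the exponential
  set ED := expo ε lam (antideriv c z) with hED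
  set EV := expo ε lam (rayBranch c z I) with hEV
  have hEDd : ∀ x ∈ dDom z, HasDerivAt (antideriv c z) (upot c z x) x :=
    fun x hx => hasDerivAt_antideriv hx
  have hEVd : ∀ x ∈ vDom z, HasDerivAt (rayBranch c z I) (upot c z x) x :=
    fun x hx => hasDerivAt_rayBranch_I hz hx
  obtain ⟨QD, hQD0, hQD⟩ := (isComb_dDom hz).exists_primitive
    (g := fun x => ED x * R x / (I * ε))
    (fun x hx => ((differentiableAt_expo_antideriv_mul_rat (c := c) hε lam 0 α β
      hx).div_const _).differentiableWithinAt) xl (ED xl * U xl)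
  obtain ⟨QV, hQV0, hQV⟩ := (isComb_vDom hz).exists_primitive
    (g := fun x => EV x * R x / (I * ε))
    (fun x hx => (((hasDerivAt_expo hε (hEVd x hx)).differentiableAt.mul
      (differentiableAt_rat 0 α β (notMem_poles_of_vDom hz hx))).div_const
        _).differentiableWithinAt) xl (EV xl * U xl)
  set FD : ℂ → ℂ := fun x => QD x / ED x with hFD
  set FV : ℂ → ℂ := fun x => QV x / EV x with hFV
  have hFDs : ∀ x ∈ dDom z, SolvesAt ε c z lam R FD x := fun x hx =>
    solvesAt_div_expo hε (hEDd x hx) (hQD x hx)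
  have hFVs : ∀ x ∈ vDom z, SolvesAt ε c z lam R FV x := fun x hx =>
    solvesAt_div_expo hε (hEVd x hx) (hQV x hx)
  -- Both primitives are normalized at a point to the left of all poles so that `FD` and `FV` agree
  -- there with the bounded solution. `FV` then is that solution throughout the region above the
  -- poles; whether `FD` agrees with it in the other gaps is decided by the contour conditions.
  have hFVU : EqOn FV U (highDom z) :=
    SolvesAt.eqOn hε isOpen_highDom isPreconnected_highDom
      (fun x hx => hEVd x (highDom_subset_vDom hz hx))
      (fun x hx => hFVs x (highDom_subset_vDom hz hx))
      (fun x hx => solvesAt_upSol hε hz hlam 0 α β hx) (hhigh a₀) (by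
        simp only [hFV]
        rw [← hxl, hQV0, mul_div_cancel_left₀ _ (expo_ne_zero _ _ _)])
  have hgap : ∀ a : ℝ, (∃ x ∈ gapDom z a, FD x = FV x) → EqOn FD FV (gapDom z a) := by
    rintro a ⟨x, hx, h⟩
    exact SolvesAt.eqOn hε isOpen_gapDom isPreconnected_gapDom
      (fun x hx => hEDd x (mem_dDom_of_re_ne (gapDom_re_ne hx)))
      (fun x hx => hFDs x (mem_dDom_of_re_ne (gapDom_re_ne hx)))
      (fun x hx => hFVs x (mem_vDom_of_re_ne (gapDom_re_ne hx))) hx h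
  have hgap0 : EqOn FD FV (gapDom z a₀) := by
    refine hgap a₀ ⟨xl, mem_gapDom (fun p => (ha₀ p).ne) _, ?_⟩
    rw [hFVU (hhigh a₀)]
    simp only [hFD]
    rw [hQD0, mul_div_cancel_left₀ _ (expo_ne_zero _ _ _)]
  have hQDl : ∀ m, QD (leftAbscissa z m + height z * I)
      = ED (leftAbscissa z m + height z * I) * U (leftAbscissa z m + height z * I) := fun m => by
    rw [hleft m]; exact hQD0
  -- the regularized solution near an exceptional pole
  have hex : ∀ m, HasZeroAt ε c m → ∃ FE : ℂ → ℂ, EqOn FE FD (dDom z) ∧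
      (∀ x ∈ exDom z m, x ≠ z m → SolvesAt ε c z lam R FE x) ∧
      ∃ B : ℝ, ∀ᶠ x in 𝓝[≠] (z m), ‖FE x‖ ≤ B := by
    intro m hm
    have hm' := hm
    obtain ⟨n, hn0, hn⟩ := hm
    obtain ⟨QE, hQE0, hQE⟩ := (isComb_exDom (m := m) hz).exists_primitive
      (g := fun x => (x - z m) ^ (n - 1) * regular ε c z m n lam 0 α β x / (I * ε))
      (fun x hx => (((by fun_prop : DifferentiableAt ℂ (fun x => (x - z m) ^ (n - 1)) x).mul
        (differentiableAt_regular n lam 0 α β hx)).div_const _).differentiableWithinAt) xl (QD xl)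
    have hzD : ∀ x ∈ dDom z, x ≠ z m := fun x hx h =>
      notMem_poles_of_dDom hx (h ▸ mem_poles_left m)
    have hQED : EqOn QE QD (dDom z) := by
      refine eqOn_of_hasDerivAt_eq isOpen_dDom (isComb_dDom hz).isPreconnected
        (fun x hx => (hQE x (dDom_subset_exDom hx)).congr_deriv ?_) hQD
        (mem_dDom_vert (fun p => (ha₀ p).ne) _) hQE0
      rw [← expo_mul_rat_eq_regular hn0 hn lam 0 α β (hzD x hx)]
    have hzE : z m ∈ exDom z m := mem_exDom_self hz hre
    -- The contour ends at `z m`, so its integral is `iε` times the limit of the primitive there.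
    have hQE_zero : QE (z m) = 0 := by
      have hl : Tendsto (fun t : ℝ => QD ((z m).re + t * I)) (𝓝[<] (z m).im) (𝓝 (QE (z m))) := by
        have h1 : Tendsto (fun t : ℝ => QE ((z m).re + t * I)) (𝓝 (z m).im) (𝓝 (QE (z m))) := by
          have h2 : Tendsto (fun t : ℝ => ((z m).re : ℂ) + t * I) (𝓝 (z m).im) (𝓝 (z m)) := by
            have : Continuous fun t : ℝ => ((z m).re : ℂ) + t * I := by fun_prop
            simpa using this.tendsto (z m).im
          exact (hQE _ hzE).continuousAt.tendsto.comp h2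
        refine (h1.mono_left nhdsWithin_le_nhds).congr' ?_
        filter_upwards [self_mem_nhdsWithin, mem_nhdsWithin_of_mem_nhds
          (lt_mem_nhds (by linarith [hz m] : -(z m).im < (z m).im))] with t ht ht'
        exact hQED (mem_dDom_vert_pole hre ht' ht)
      have := sysInt_eq_of_primitive_pole hε hz hre hm' hQD (hQDl m) hl
      rw [hsys m] at this
      have hI := I_ne_zero
      simpa [hε'] using this.symm
    refine ⟨fun x => QE x / expoEx ε c z m n lam x, fun x hx => ?_, fun x hx hxm => ?_, ?_⟩
    · simp only [hFD]
      rw [hQED hx, hED, expo_antideriv_eq hn lam (hzD x hx), expoEx]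
    · have hne : expoEx ε c z m n lam x ≠ 0 := mul_ne_zero
        (pow_ne_zero _ (mul_ne_zero I_ne_zero (sub_ne_zero.mpr hxm))) (expo_ne_zero _ _ _)
      refine solvesAt_div hε (hasDerivAt_expoEx hε hn hn0 lam hx hxm) hne
        ((hQE x hx).congr_deriv ?_)
      rw [← expo_mul_rat_eq_regular hn0 hn lam 0 α β hxm, expo_antideriv_eq hn lam hxm]
      rfl
    · obtain ⟨r, hr, hball⟩ := Metric.nhds_basis_closedBall.mem_iff.mp (isOpen_exDom.mem_nhds hzE)
      obtain ⟨M, hM⟩ := (isCompact_closedBall (z m) r).exists_bound_of_continuousOn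
        (f := fun x => regular ε c z m n lam 0 α β x / (I * ε)) fun x hx =>
          ((differentiableAt_regular n lam 0 α β (hball hx)).div_const
            _).continuousAt.continuousWithinAt
      obtain ⟨K, hK⟩ := (isCompact_closedBall (z m) r).exists_bound_of_continuousOn
        (f := fun x => (expo ε lam (antiderivEx c z m) x)⁻¹) fun x hx =>
          ((differentiableAt_expo_antiderivEx lam (hball hx)).inv
            (expo_ne_zero _ _ _)).continuousAt.continuousWithinAt
      refine ⟨M * K, ?_⟩
      filter_upwards [mem_nhdsWithin_of_mem_nhds (Metric.ball_mem_nhds (z m) hr),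
        self_mem_nhdsWithin] with x hx hxm
      have hx' : ‖x - z m‖ < r := by simpa [dist_eq_norm] using hx
      have hx0 : 0 < ‖x - z m‖ := norm_pos_iff.mpr (sub_ne_zero.mpr hxm)
      have hsub : Metric.closedBall (z m) ‖x - z m‖ ⊆ Metric.closedBall (z m) r :=
        Metric.closedBall_subset_closedBall hx'.le
      -- The derivative of `QE` is `O(‖x - z m‖^(n - 1))` and `QE (z m) = 0`, so `QE = O(‖x - z
      -- m‖^n)` by the mean value inequality. This balances the zero of order `n` of `expoEx` and
      -- makes the quotient bounded.
      have hmv := (convex_closedBall (z m) ‖x - z m‖).norm_image_sub_le_of_norm_hasDerivWithin_le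
        (f := QE) (C := ‖x - z m‖ ^ (n - 1) * M)
        (fun y hy => (hQE y (hball (hsub hy))).hasDerivWithinAt) (fun y hy => ?_)
        (Metric.mem_closedBall_self hx0.le) (by simp [dist_eq_norm] : x ∈ _)
      · rw [hQE_zero, sub_zero] at hmv
        have hK' := hK x (Metric.ball_subset_closedBall hx)
        have hMK : ‖QE x / expoEx ε c z m n lam x‖
            = ‖QE x‖ / ‖x - z m‖ ^ n * ‖(expo ε lam (antiderivEx c z m) x)⁻¹‖ := by
          rw [expoEx, norm_div, norm_mul, norm_pow, norm_mul, norm_I, one_mul, norm_inv]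
          field_simp
        rw [hMK]
        have h1 : ‖QE x‖ / ‖x - z m‖ ^ n ≤ M := by
          rw [div_le_iff₀ (by positivity)]
          refine hmv.trans (le_of_eq ?_)
          obtain ⟨k, rfl⟩ : ∃ k, n = k + 1 := ⟨n - 1, by omega⟩
          rw [add_tsub_cancel_right, pow_succ]
          ring
        have h2 : 0 ≤ M := le_trans (by positivity) h1
        gcongr
      · have hy' : ‖y - z m‖ ≤ ‖x - z m‖ := by simpa [dist_eq_norm] using hy
        have := hM y (hsub hy)
        rw [mul_div_assoc, norm_mul, norm_pow]
        gcongr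
  -- agreement in all gaps
  have hgapm : ∀ k : ℕ, ∀ hk : k < P, EqOn FD FV (gapDom z (rightAbscissa z ⟨k, hk⟩)) := by
    intro k
    induction k using Nat.strong_induction_on with
    | _ k ih =>
    intro hk
    set m : Fin P := ⟨k, hk⟩ with hm
    -- At an exceptional pole there is no contour condition in the gap to its right; instead `FE` is
    -- defined across the cut above `z m` and carries the agreement over from the gap on the left.
    -- At the other poles the contour condition gives the agreement in the right gap directly.
    by_cases hexm : HasZeroAt ε c m
    · obtain ⟨FE, hFE, hFEs, -⟩ := hex m hexm
      -- points of the strip over `z m` to the left and to the right of the cut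
      have hL : ∃ x ∈ overDom z m, FE x = FV x := by
        rcases Nat.eq_zero_or_pos k with hk0 | hk0
        · have hmem : (a₀ : ℂ) + height z * I ∈ overDom z m := by
            refine ⟨?_, fun p => ⟨fun hp => ?_, fun _ => ?_⟩⟩
            · have := im_add_one_le_height hz m
              simp; linarith
            · exact absurd hp (by simp [hm, Fin.lt_def, hk0])
            · simpa using ha₀ p
          exact ⟨_, hmem, (hFE (mem_dDom_vert (fun p => (ha₀ p).ne) _)).trans
            (hgap0 (mem_gapDom (fun p => (ha₀ p).ne) _))⟩
        · have hk1 : k - 1 < P := by omega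
          set q : Fin P := ⟨k - 1, hk1⟩ with hq
          have hmem : (rightAbscissa z q : ℂ) + height z * I ∈ overDom z m := by
            refine ⟨?_, fun p => ⟨fun hp => ?_, fun hp => ?_⟩⟩
            · have := im_add_one_le_height hz m
              simp; linarith
            · have : p ≤ q := by
                rw [Fin.le_def]; rw [Fin.lt_def] at hp; simp [hm, hq] at hp ⊢; omega
              simpa using lt_rightAbscissa hre this
            · have : q < p := by
                rw [Fin.lt_def] at hp ⊢; simp [hm, hq] at hp ⊢; omega
              simpa using rightAbscissa_lt hre this
          exact ⟨_, hmem, (hFE (mem_dDom_vert (rightAbscissa_ne hre q) _)).trans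
            (ih (k - 1) (by omega) hk1 (mem_gapDom (rightAbscissa_ne hre q) _))⟩
      obtain ⟨x₁, hx₁, h₁⟩ := hL
      have hov : EqOn FE FV (overDom z m) := by
        refine SolvesAt.eqOn hε isOpen_overDom isPreconnected_overDom
          (fun x hx => hEVd x (overDom_subset_vDom hx))
          (fun x hx => hFEs x (overDom_subset_exDom hz hx) fun h => ?_)
          (fun x hx => hFVs x (overDom_subset_vDom hx)) hx₁ h₁
        have := hx.1
        rw [h] at this
        exact lt_irrefl _ this
      refine hgap _ ⟨_, mem_gapDom (rightAbscissa_ne hre m) (height z), ?_⟩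
      rw [← hFE (mem_dDom_vert (rightAbscissa_ne hre m) _)]
      refine hov ⟨?_, fun p => ⟨fun hp => ?_, fun hp => ?_⟩⟩
      · have := im_add_one_le_height hz m
        simp; linarith
      · simpa using lt_rightAbscissa hre hp.le
      · simpa using rightAbscissa_lt hre hp
    · refine hgap _ ⟨_, mem_gapDom (rightAbscissa_ne hre m) (height z), ?_⟩
      have h1 := sysInt_eq_of_primitive hε hz hre hexm hQD (hQDl m)
      rw [hsys m] at h1
      have h2 : QD (rightAbscissa z m + height z * I)
          = ED (rightAbscissa z m + height z * I) * U (rightAbscissa z m + height z * I) := by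
        have : I * (ε : ℂ) ≠ 0 := mul_ne_zero I_ne_zero hε'
        exact sub_eq_zero.mp ((mul_eq_zero.mp h1.symm).resolve_left this)
      rw [hFVU (hhigh _)]
      simp only [hFD]
      rw [h2, mul_div_cancel_left₀ _ (expo_ne_zero _ _ _)]
  have hDV : ∀ x ∈ dDom z, x ∈ vDom z → FV x = FD x := by
    intro x hxd hxv
    have hne : ∀ p, x.re ≠ (z p).re := fun p hp => by
      have := (hxd p hp).2; have := hxv p hp; linarith
    rcases mem_gapDom_cases hre ha₀ hne with h | ⟨m, h⟩
    · exact (hgap0 h).symm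
    · exact (hgapm m m.2 h).symm
  -- the glued solution
  set F0 : ℂ → ℂ := fun x => if x ∈ vDom z then FV x else FD x with hF0
  have hF0D : EqOn F0 FD (dDom z) := fun x hx => by
    simp only [hF0]
    split_ifs with h
    · exact hDV x hx h
    · rfl
  have hF0V : EqOn F0 FV (vDom z) := fun x hx => by simp only [hF0, if_pos hx]
  have hF0s : ∀ x ∈ vDom z ∪ dDom z, SolvesAt ε c z lam R F0 x := by
    rintro x (hx | hx)
    · exact (hFVs x hx).congr (hF0V.eventuallyEq_of_mem (isOpen_vDom.mem_nhds hx))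
    · exact (hFDs x hx).congr (hF0D.eventuallyEq_of_mem (isOpen_dDom.mem_nhds hx))
  have hlim : ∀ m, ∃ l, Tendsto F0 (𝓝[≠] (z m)) (𝓝 l) := by
    intro m
    have hnear := isOpen_nearDom.mem_nhds (mem_nearDom hz hre m)
    have hnear' : ∀ x ∈ nearDom z m, x ≠ z m → SolvesAt ε c z lam R F0 x := fun x hx hxm =>
      hF0s x (nearDom_subset_union hz ⟨hx, hxm⟩)
    by_cases hexm : HasZeroAt ε c m
    · obtain ⟨FE, hFE, hFEs, B, hB⟩ := hex m hexm
      have hFEV : ∀ x ∈ nearDom z m, x ≠ z m → F0 x = FE x := by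
        intro x hx hxm
        rcases nearDom_subset_union hz ⟨hx, hxm⟩ with h | h
        swap
        · rw [hF0D h, hFE h]
        by_cases hxd : x ∈ dDom z
        · rw [hF0D hxd, hFE hxd]
        rw [hF0V h]
        have hov : overDom z m ⊆ vDom z := overDom_subset_vDom
        have hR' : (rightAbscissa z m : ℂ) + height z * I ∈ overDom z m := by
          refine ⟨?_, fun p => ⟨fun hp => ?_, fun hp => ?_⟩⟩
          · have := im_add_one_le_height hz m
            simp; linarith
          · simpa using lt_rightAbscissa hre hp.le
          · simpa using rightAbscissa_lt hre hp
        have heq : EqOn FE FV (overDom z m) := by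
          refine SolvesAt.eqOn hε isOpen_overDom isPreconnected_overDom
            (fun x hx => hEVd x (hov hx))
            (fun x hx => hFEs x (overDom_subset_exDom hz hx) fun h => ?_)
            (fun x hx => hFVs x (hov hx)) hR' ?_
          · have := hx.1
            rw [h] at this
            exact lt_irrefl _ this
          · rw [hFE (mem_dDom_vert (rightAbscissa_ne hre m) _)]
            exact hgapm m m.2 (mem_gapDom (rightAbscissa_ne hre m) _)
        have hxre : x.re = (z m).re := by
          by_contra hne
          exact hxd (mem_dDom_of_exDom (nearDom_subset_exDom hz hx) fun h => absurd h hne)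
        refine (heq ⟨h m hxre, fun p => ⟨fun hp => ?_, fun hp => ?_⟩⟩).symm
        · rw [hxre]; exact hre hp
        · rw [hxre]; exact hre hp
      have hev : F0 =ᶠ[𝓝[≠] (z m)] FE := by
        filter_upwards [mem_nhdsWithin_of_mem_nhds hnear, self_mem_nhdsWithin] with x hx hxm
        exact hFEV x hx hxm
      refine ⟨_, (tendsto_limUnder_of_differentiable_on_punctured_nhds_of_bounded_under
        (f := F0) ?_ ⟨B + ‖F0 (z m)‖, ?_⟩)⟩
      · filter_upwards [mem_nhdsWithin_of_mem_nhds hnear, self_mem_nhdsWithin] with x hx hxm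
        exact (hnear' x hx hxm).differentiableAt
      · rw [eventually_map]
        filter_upwards [hB, hev] with x hx hx'
        rw [hx']
        exact (norm_sub_le _ _).trans (by gcongr)
    -- Multiplied by `x - z m`, the equation is Fuchsian with `a (z m) = i c_m/ε`; `¬HasZeroAt` says
    -- exactly that this is not a negative integer.
    · obtain ⟨r, hr, hball⟩ := Metric.isOpen_iff.mp isOpen_nearDom _ (mem_nearDom hz hre m)
      have hbex : ∀ x ∈ Metric.ball (z m) r, x ∈ exDom z m := fun x hx =>
        nearDom_subset_exDom hz (hball hx)
      refine fuchs_removable hr (F := F0)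
        (a := fun x => -((x - z m) * (lam + ratEx z m 0 c (fun p => conj (c p)) x) + c m) / (I * ε))
        (b := fun x => ((x - z m) * ratEx z m 0 α β x + α m) / (I * ε)) ?_ ?_ ?_ ?_ ?_
      · intro x hx
        have := (differentiableAt_ratEx 0 c (fun p => conj (c p)) (hbex x hx)).continuousAt
        refine ContinuousAt.continuousWithinAt ?_
        exact ((((continuousAt_id.sub continuousAt_const).mul
          (continuousAt_const.add this)).add continuousAt_const).neg).div_const _
      · intro x hx
        have := (differentiableAt_ratEx 0 α β (hbex x hx)).continuousAt
        refine ContinuousAt.continuousWithinAt ?_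
        exact (((continuousAt_id.sub continuousAt_const).mul this).add
          continuousAt_const).div_const _
      · intro x hx
        exact (hnear' x (hball hx.1) hx.2).differentiableAt.differentiableWithinAt
      · intro x hx hxm
        have hx0 : x - z m ≠ 0 := sub_ne_zero.mpr hxm
        rw [HasDerivAt.deriv (hnear' x (hball hx) hxm), hR, upot, rat_eq_ratEx (m := m),
          rat_eq_ratEx (m := m) 0 c]
        have := I_ne_zero
        field_simp
        ring
      · intro n hn h
        refine hexm ⟨n, hn, ?_⟩
        rw [← h]
        have := I_ne_zero
        simp only [sub_self, zero_mul, zero_add]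
        field_simp
        rw [I_sq]
        ring
  set F : ℂ → ℂ := fun x => if x ∈ poles z then limUnder (𝓝[≠] x) F0 else F0 x with hF
  have hFF0 : ∀ x, x ∉ poles z → F =ᶠ[𝓝 x] F0 := by
    intro x hx
    filter_upwards [finite_poles.isClosed.isOpen_compl.mem_nhds hx] with y hy
    simp only [hF]
    rw [if_neg hy]
  have hFs : ∀ x, x ∉ poles z → x ∈ vDom z ∪ dDom z → SolvesAt ε c z lam R F x :=
    fun x hx hx' => (hF0s x hx').congr (hFF0 x hx)
  have hFd : ∀ x : ℂ, 0 ≤ x.im → DifferentiableAt ℂ F x := by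
    intro x hx
    by_cases hxp : x ∈ poles z
    · obtain ⟨m, rfl | rfl⟩ := hxp
      · have hnear := isOpen_nearDom.mem_nhds (mem_nearDom hz hre m)
        have hnp : ∀ᶠ x in 𝓝[≠] (z m), x ∉ poles z := by
          have h1 : (poles z \ {z m})ᶜ ∈ 𝓝 (z m) :=
            (finite_poles.subset sdiff_subset).isClosed.isOpen_compl.mem_nhds (by simp)
          filter_upwards [mem_nhdsWithin_of_mem_nhds h1, self_mem_nhdsWithin] with x hx hxm hp
          exact hx ⟨hp, hxm⟩
        refine (analyticAt_of_differentiable_on_punctured_nhds_of_continuousAt ?_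
          ?_).differentiableAt
        · filter_upwards [mem_nhdsWithin_of_mem_nhds hnear, self_mem_nhdsWithin, hnp] with x hx hxm
            hp
          exact (hFs x hp (nearDom_subset_union hz ⟨hx, hxm⟩)).differentiableAt
        · rw [continuousAt_iff_punctured_nhds]
          have h1 : F (z m) = limUnder (𝓝[≠] (z m)) F0 := by
            simp only [hF]
            rw [if_pos (mem_poles_left m)]
          rw [h1]
          refine (tendsto_nhds_limUnder (hlim m)).congr' ?_
          filter_upwards [hnp] with x hx
          simp only [hF]
          rw [if_neg hx]
      · rw [conj_im] at hx
        linarith [hz m]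
    · exact (hFs x hxp (upper_subset_union hre hx hxp)).differentiableAt
  have hFs' : ∀ x : ℂ, 0 ≤ x.im → x ∉ poles z → SolvesAt ε c z lam R F x := fun x hx hxp =>
    hFs x hxp (upper_subset_union hre hx hxp)
  -- behaviour at infinity
  set S := raySol ε c z (decayDir lam) R lam with hS
  have hω1 := decayDir_im lam
  have hω0 := im_ne_zero_dir hω1
  have hlω := mul_decayDir_im hlam
  have hFhigh : EqOn F S (highDom z) := fun x hx => by
    have hxv := highDom_subset_vDom hz hx
    have hxp := notMem_poles_of_vDom hz hxv
    rw [(hFF0 x hxp).eq_of_nhds, hF0V hxv, hFVU hx]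
    rfl
  obtain ⟨R₀, δ, hR₀, hδ, hfar⟩ := exists_far_rayDom (z := z) hω1
  obtain ⟨X₁, hX₁⟩ := (finite_range fun p => |(z p).re|).bddAbove
  set X := max R₀ X₁ with hX
  -- High above the poles `F` is the ray solution `S`. Far to the left and far to the right both are
  -- analytic down to the real line, so the identity theorem carries `F = S` there, and the decay of
  -- `S` becomes decay of `F` in the whole closed half-plane.
  have hside : ∀ s : Set ℂ, Convex ℝ s → (∀ x ∈ s, 0 ≤ x.im ∧ X < |x.re|) →
      (∃ x ∈ s, x ∈ highDom z) → EqOn F S s := by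
    rintro s hs hsX ⟨x₀, hx₀, hx₀'⟩
    refine AnalyticOnNhd.eqOn_of_preconnected_of_eventuallyEq (𝕜 := ℂ) (fun x hx => ?_)
      (fun x hx => ?_) hs.isPreconnected hx₀
      (hFhigh.eventuallyEq_of_mem (isOpen_highDom.mem_nhds hx₀'))
    · obtain ⟨h1, h2⟩ := hsX x hx
      have hxd : x ∈ dDom z := mem_dDom_of_re_ne fun p hp => by
        have : |(z p).re| ≤ X₁ := hX₁ ⟨p, rfl⟩
        rw [hp] at h2
        exact absurd (this.trans (le_max_right R₀ X₁)) (not_le.mpr h2)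
      rw [analyticAt_iff_eventually_differentiableAt]
      filter_upwards [isOpen_dDom.mem_nhds hxd] with y hy
      exact (hFs y (notMem_poles_of_dDom hy) (Or.inr hy)).differentiableAt
    · obtain ⟨h1, h2⟩ := hsX x hx
      have hxr := (hfar x h1 ((le_max_left R₀ X₁).trans (h2.le.trans (abs_re_le_norm x)))).1
      rw [analyticAt_iff_eventually_differentiableAt]
      filter_upwards [rayDom_mem_nhds hδ hxr] with y hy
      exact (solvesAt_raySol hε (half_pos hδ) hω0 hlω 0 α β hy).differentiableAt
  have hX0 : 0 < X := lt_max_of_lt_left hR₀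
  have hFl : EqOn F S ({x : ℂ | 0 ≤ x.im} ∩ {x | x.re < -X}) := by
    refine hside _ ((convex_halfSpace_im_ge _).inter (convex_halfSpace_re_lt _)) ?_
      ⟨((-X - 1 : ℝ) : ℂ) + height z * I, ⟨?_, ?_⟩, hhigh _⟩
    · rintro x ⟨h1, h2⟩
      have h2' : x.re < -X := h2
      exact ⟨h1, by rw [abs_of_neg] <;> linarith⟩
    · simpa using (height_pos hz).le
    · simp
  have hFr : EqOn F S ({x : ℂ | 0 ≤ x.im} ∩ {x | X < x.re}) := by
    refine hside _ ((convex_halfSpace_im_ge _).inter (convex_halfSpace_re_gt _)) ?_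
      ⟨((X + 1 : ℝ) : ℂ) + height z * I, ⟨?_, ?_⟩, hhigh _⟩
    · rintro x ⟨h1, h2⟩
      have h2' : X < x.re := h2
      exact ⟨h1, by rw [abs_of_pos] <;> linarith⟩
    · simpa using (height_pos hz).le
    · simp
  have hFS : S =ᶠ[upperInfty] F := by
    rw [EventuallyEq, upperInfty, eventually_inf_principal,
      (Metric.hasBasis_cobounded_compl_ball (0 : ℂ)).eventually_iff]
    refine ⟨X + height z + 1, trivial, fun x hx hx0 => ?_⟩
    have hx' : X + height z + 1 ≤ ‖x‖ := by simpa using hx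
    have hx0' : 0 ≤ x.im := hx0
    by_cases h1 : height z - 1 / 2 < x.im
    · exact (hFhigh h1).symm
    · have h2 := norm_le_abs_re_add_abs_im x
      rw [abs_of_nonneg hx0'] at h2
      have h3 : X < |x.re| := by linarith
      rcases lt_abs.mp h3 with h | h
      · exact (hFr ⟨hx0, h⟩).symm
      · exact (hFl ⟨hx0, by simp only [mem_ofPred_eq]; linarith⟩).symm
  refine ⟨F, hFd, hFs', ?_, fun hsum => ?_⟩
  · have := isBigO_raySol (c := c) (z := z) (n := 1) hε hω1 hlω (R := R)
      (by simpa using isBigO_rat α β)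
    simpa using this.congr' hFS .rfl
  · exact (isBigO_raySol (c := c) (z := z) (n := 2) hε hω1 hlω (R := R)
      (isBigO_rat_of_sum_eq_zero hsum)).congr' hFS .rfl

end

end BenjaminOno

namespace BenjaminOno
open Complex Set Filter MeasureTheory

noncomputable section

variable {P : ℕ} {ε : ℝ} {c z : Fin P → ℂ} {m : Fin P}

/-! ### Pairings of decaying solutions on the real line -/

/-- Holomorphic functions on the closed upper half-plane that are `O(1 / x)` at infinity. -/
structure Decays (F : ℂ → ℂ) : Prop where
  differentiableAt : ∀ x : ℂ, 0 ≤ x.im → DifferentiableAt ℂ F x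
  isBigO : F =O[upperInfty] fun x => x⁻¹

theorem Decays.continuous {F : ℂ → ℂ} (hF : Decays F) : Continuous fun x : ℝ => F x :=
  continuous_ofReal_of_differentiableAt hF.differentiableAt

theorem Decays.integrable_mul_conj {F G : ℂ → ℂ} (hF : Decays F) (hG : Decays G) :
    Integrable fun x : ℝ => F x * conj (G x) := by
  refine integrable_ofReal_of_isBigO (G := fun x => F x * conj (G x))
    (hF.continuous.mul (continuous_conj.comp hG.continuous)) ?_
  have : (fun x => conj (G x)) =O[upperInfty] fun x => x⁻¹ :=
    Asymptotics.IsBigO.congr' (Asymptotics.IsBigO.of_norm_left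
      (by simpa using hG.isBigO.norm_left)) .rfl .rfl
  simpa [sq, mul_inv] using hF.isBigO.mul this

theorem ofReal_notMem_poles (hz : ∀ p, 0 < (z p).im) (x : ℝ) : (x : ℂ) ∉ poles z :=
  notMem_poles_of_dDom (mem_dDom_real hz x)

theorem conj_rat_ofReal (r : ℂ) (α β : Fin P → ℂ) (x : ℝ) :
    conj (rat z r α β x) = rat z (conj r) (fun p => conj (β p)) (fun p => conj (α p)) x := by
  simp only [rat, map_add, map_sum, map_div₀, map_sub, conj_ofReal, conj_conj]
  congr 1
  exact Finset.sum_congr rfl fun p _ => add_comm _ _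

theorem conj_upot_ofReal (x : ℝ) : conj (upot c z x) = upot c z x := by
  simp [upot, conj_rat_ofReal]

theorem Decays.integrable_div_sub {F : ℂ → ℂ} (hF : Decays F) {ζ : ℂ} (hζ : ζ.im ≠ 0) :
    Integrable fun x : ℝ => F x / (x - ζ) := by
  refine integrable_ofReal_of_isBigO (G := fun x => F x / (x - ζ)) ?_ ?_
  · refine hF.continuous.div (by fun_prop) fun x h => hζ ?_
    rw [← sub_eq_zero.mp h, ofReal_im]
  · simpa [div_eq_mul_inv] using isBigO_pow_two_of_mul hF.isBigO (isBigO_inv_sub_upperInfty ζ)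

theorem Decays.integrable_mul_rat {F : ℂ → ℂ} (hF : Decays F) (hz : ∀ p, 0 < (z p).im)
    (α β : Fin P → ℂ) : Integrable fun x : ℝ => F x * rat z 0 α β x := by
  simp only [rat, zero_add, Finset.mul_sum]
  refine integrable_finsetSum _ fun p _ => ?_
  have h1 := (hF.integrable_div_sub (ζ := z p) (hz p).ne').const_mul (α p)
  have h2 := (hF.integrable_div_sub (ζ := conj (z p)) (by simpa using (hz p).ne')).const_mul (β p)
  refine (h1.add h2).congr (ae_of_all _ fun x => ?_)
  simp only [Pi.add_apply]
  ring

/-- Split into partial fractions: the poles at `z p` contribute values of `F` by Cauchy's formula,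
those at the conjugates contribute nothing. -/
theorem Decays.integral_mul_rat {F : ℂ → ℂ} (hF : Decays F) (hz : ∀ p, 0 < (z p).im)
    (α β : Fin P → ℂ) :
    ∫ x : ℝ, F x * rat z 0 α β x = 2 * Real.pi * I * ∑ p, α p * F (z p) := by
  have h1 := fun p => (hF.integrable_div_sub (ζ := z p) (hz p).ne').const_mul (α p)
  have h2 := fun p =>
    (hF.integrable_div_sub (ζ := conj (z p)) (by simpa using (hz p).ne')).const_mul (β p)
  have e : ∀ x : ℝ, F x * rat z 0 α β x
      = ∑ p, (α p * (F x / (x - z p)) + β p * (F x / (x - conj (z p)))) := fun x => by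
    simp only [rat, zero_add, Finset.mul_sum]
    exact Finset.sum_congr rfl fun p _ => by ring
  simp_rw [e]
  have h3 : ∀ p, Integrable fun x : ℝ =>
      α p * (F x / (x - z p)) + β p * (F x / (x - conj (z p))) := fun p => (h1 p).add (h2 p)
  rw [integral_finsetSum _ fun p _ => h3 p, Finset.mul_sum]
  refine Finset.sum_congr rfl fun p _ => ?_
  rw [integral_add (h1 p) (h2 p), integral_const_mul, integral_const_mul,
    integral_div_sub_of_im_pos hF.differentiableAt hF.isBigO (hz p),
    integral_div_sub_of_im_neg hF.differentiableAt hF.isBigO (by simpa using hz p)]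
  ring

theorem Decays.integrable_rat_mul_conj {F : ℂ → ℂ} (hF : Decays F) (hz : ∀ p, 0 < (z p).im)
    (α β : Fin P → ℂ) : Integrable fun x : ℝ => rat z 0 α β x * conj (F x) := by
  have := hF.integrable_mul_rat hz (fun p => conj (β p)) fun p => conj (α p)
  have h := conjCLE.toContinuousLinearMap.integrable_comp this
  simpa [conj_rat_ofReal, mul_comm] using h

/-- The conjugate of `integral_mul_rat`, as conjugation on the real line exchanges the two kinds of
poles. In particular a rational function with all poles in the upper half-plane is orthogonal to
every decaying function. -/
theorem Decays.integral_rat_mul_conj {F : ℂ → ℂ} (hF : Decays F) (hz : ∀ p, 0 < (z p).im)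
    (α β : Fin P → ℂ) : ∫ x : ℝ, rat z 0 α β x * conj (F x)
      = -(2 * Real.pi * I) * ∑ p, β p * conj (F (z p)) := by
  have h := congrArg conj (hF.integral_mul_rat hz (fun p => conj (β p)) fun p => conj (α p))
  rw [← integral_conj] at h
  simp only [map_mul, conj_rat_ofReal, conj_conj, map_sum, map_zero, conj_ofReal, conj_I] at h
  simp_rw [mul_comm (rat z 0 α β _)]
  rw [h, Complex.conj_ofNat]
  ring

/-- Green's identity on the real line for two decaying solutions. -/
theorem integral_pairing (hε : 0 < ε) {lam : ℂ} {R₁ R₂ F₁ F₂ : ℂ → ℂ}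
    (hF₁ : Decays F₁) (hF₂ : Decays F₂) (h₁ : ∀ x : ℝ, SolvesAt ε c z lam R₁ F₁ x)
    (h₂ : ∀ x : ℝ, SolvesAt ε c z lam R₂ F₂ x)
    (i₁ : Integrable fun x : ℝ => R₁ x * conj (F₂ x))
    (i₂ : Integrable fun x : ℝ => F₁ x * conj (R₂ x)) :
    (∫ x : ℝ, R₁ x * conj (F₂ x)) - ∫ x : ℝ, F₁ x * conj (R₂ x)
      = (lam - conj lam) * ∫ x : ℝ, F₁ x * conj (F₂ x) := by
  have hε' : (ε : ℂ) ≠ 0 := by exact_mod_cast hε.ne'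
  have i₃ := (hF₁.integrable_mul_conj hF₂).const_mul (lam - conj lam)
  have i₄ : Integrable fun x : ℝ => R₁ x * conj (F₂ x) - F₁ x * conj (R₂ x) := i₁.sub i₂
  -- The integrand is the derivative of `iεF₁ conj F₂`, an integrable function: the potential is
  -- real on the real line and cancels, while `lam` leaves its imaginary part.
  have h := integral_eq_zero_of_hasDerivAt_of_integrable
    (f := fun x : ℝ => I * ε * (F₁ x * conj (F₂ x)))
    (f' := fun x : ℝ => R₁ x * conj (F₂ x) - F₁ x * conj (R₂ x)
      - (lam - conj lam) * (F₁ x * conj (F₂ x))) (fun x => ?_) (i₄.sub i₃)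
    ((hF₁.integrable_mul_conj hF₂).const_mul _)
  · rw [integral_sub i₄ i₃, integral_sub i₁ i₂, integral_const_mul] at h
    linear_combination h
  · have d₁ := HasDerivAt.comp_ofReal (h₁ x)
    have d₂ := (HasDerivAt.comp_ofReal (h₂ x)).star
    refine ((d₁.mul d₂).const_mul (I * ε)).congr_deriv ?_
    simp only [star_def, map_div₀, map_sub, map_mul, map_add, conj_I, conj_ofReal,
      conj_upot_ofReal]
    have := I_ne_zero
    field_simp
    ring

/-- Vanishing of the `L²` norm forces the continuous boundary values to vanish, and Cauchy's formula
recovers `F` from them. -/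
theorem Decays.eq_zero_of_integral {F : ℂ → ℂ} (hF : Decays F)
    (h : ∫ x : ℝ, F x * conj (F x) = 0) {ζ : ℂ} (hζ : 0 < ζ.im) : F ζ = 0 := by
  have hi := hF.integrable_mul_conj hF
  simp only [mul_conj] at h hi
  rw [integral_complex_ofReal] at h
  have h0 : ∫ x : ℝ, normSq (F x) = 0 := by exact_mod_cast h
  have hcont : Continuous fun x : ℝ => normSq (F x) := continuous_normSq.comp hF.continuous
  rw [integral_eq_zero_iff_of_nonneg (fun _ => normSq_nonneg _) (by simpa using hi.re)] at h0
  have h1 := (Continuous.ae_eq_iff_eq volume hcont continuous_const).mp h0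
  have h2 : ∀ x : ℝ, F x = 0 := fun x => normSq_eq_zero.mp (congrFun h1 x)
  have := integral_div_sub_of_im_pos hF.differentiableAt hF.isBigO hζ
  simp only [h2, zero_div, integral_zero] at this
  have h3 : 2 * (Real.pi : ℂ) * I ≠ 0 := by simp [Real.pi_ne_zero]
  exact (mul_eq_zero.mp this.symm).resolve_left h3

/-- The residue of the right-hand side at a pole, for a solution without a pole. -/
theorem mul_eq_of_solvesAt (hz : ∀ p, 0 < (z p).im) (hre : StrictMono fun p => (z p).re)
    (hε : 0 < ε) {lam r : ℂ}
    {α β : Fin P → ℂ} {F : ℂ → ℂ} (hF : ∀ x : ℂ, 0 < x.im → DifferentiableAt ℂ F x)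
    (h : ∀ x : ℂ, 0 < x.im → x ∉ poles z → SolvesAt ε c z lam (rat z r α β) F x) (m : Fin P) :
    c m * F (z m) = α m := by
  have hε' : (ε : ℂ) ≠ 0 := by exact_mod_cast hε.ne'
  have hU : IsOpen {x : ℂ | 0 < x.im} := isOpen_lt continuous_const continuous_im
  have hFo : DifferentiableOn ℂ F {x : ℂ | 0 < x.im} := fun x hx =>
    (hF x hx).differentiableWithinAt
  have hd : ContinuousAt (deriv F) (z m) :=
    ((hFo.deriv hU).differentiableAt (hU.mem_nhds (hz m))).continuousAt
  have hc := (hF _ (hz m)).continuousAt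
  have hz' := mem_exDom_self hz hre (m := m)
  have h1 := (differentiableAt_ratEx r α β hz').continuousAt
  have h2 := (differentiableAt_ratEx 0 c (fun p => conj (c p)) hz').continuousAt
  have hs : ContinuousAt (fun x => x - z m) (z m) := by fun_prop
  -- The equation multiplied by `x - z m`, with the polar part of `R` kept on the other side:
  -- continuous at `z m` and equal to `α m` nearby, so evaluation at `z m` yields the relation.
  have hL : ContinuousAt (fun x => I * ε * ((x - z m) * deriv F x) + (x - z m) * (lam * F x)
      + ((x - z m) * ratEx z m 0 c (fun p => conj (c p)) x + c m) * F x
      - (x - z m) * ratEx z m r α β x) (z m) := by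
    exact (((continuousAt_const.mul (hs.mul hd)).add (hs.mul (continuousAt_const.mul hc))).add
      (((hs.mul h2).add continuousAt_const).mul hc)).sub (hs.mul h1)
  have hev : (fun x => I * ε * ((x - z m) * deriv F x) + (x - z m) * (lam * F x)
      + ((x - z m) * ratEx z m 0 c (fun p => conj (c p)) x + c m) * F x
      - (x - z m) * ratEx z m r α β x) =ᶠ[𝓝[≠] (z m)] fun _ => α m := by
    have hp : (poles z \ {z m})ᶜ ∈ 𝓝 (z m) :=
      (finite_poles.subset sdiff_subset).isClosed.isOpen_compl.mem_nhds (by simp)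
    filter_upwards [mem_nhdsWithin_of_mem_nhds (hU.mem_nhds (hz m)), self_mem_nhdsWithin,
      mem_nhdsWithin_of_mem_nhds hp] with x hx hxm hxp
    have hx0 : x - z m ≠ 0 := sub_ne_zero.mpr hxm
    rw [HasDerivAt.deriv (h x hx fun hq => hxp ⟨hq, hxm⟩), upot, rat_eq_ratEx (m := m),
      rat_eq_ratEx (m := m) 0 c]
    have := I_ne_zero
    field_simp
    ring
  have hT := (hL.tendsto.mono_left nhdsWithin_le_nhds).congr' hev
  have := tendsto_nhds_unique hT tendsto_const_nhds
  simpa using this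

end

end BenjaminOno

namespace BenjaminOno
open Complex Set Filter MeasureTheory

noncomputable section

variable {P : ℕ} {ε : ℝ} {c z : Fin P → ℂ} {m : Fin P}

/-! ### Kernel vectors of the linear system -/

theorem tendsto_expo_pole (hz : ∀ p, 0 < (z p).im) (hre : StrictMono fun p => (z p).re)
    (hm : HasZeroAt ε c m) (lam : ℂ) :
    Tendsto (fun t : ℝ => expo ε lam (antideriv c z) ((z m).re + t * I)) (𝓝[<] (z m).im)
      (𝓝 0) := by
  obtain ⟨n, hn0, hn⟩ := hm
  have hγ : Tendsto (fun t : ℝ => ((z m).re : ℂ) + t * I) (𝓝 (z m).im) (𝓝 (z m)) := by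
    have : Continuous fun t : ℝ => ((z m).re : ℂ) + t * I := by fun_prop
    simpa using this.tendsto (z m).im
  have hc : ContinuousAt (fun x => (I * (x - z m)) ^ n * expo ε lam (antiderivEx c z m) x)
      (z m) := by
    refine ContinuousAt.mul (by fun_prop)
      (differentiableAt_expo_antiderivEx lam (mem_exDom_self hz hre)).continuousAt
  have h := (hc.tendsto.comp hγ).mono_left (nhdsWithin_le_nhds (s := Iio (z m).im))
  simp only [sub_self, mul_zero, zero_pow hn0.ne', zero_mul] at h
  refine h.congr' ?_
  filter_upwards [self_mem_nhdsWithin] with t ht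
  refine (expo_antideriv_eq hn lam fun h => (mem_Iio.mp ht).ne ?_).symm
  simpa using congrArg Complex.im h

/-- The contour integral of the derivative of the exponential vanishes. -/
theorem sysInt_rat_potential (hε : 0 < ε) (hz : ∀ p, 0 < (z p).im)
    (hre : StrictMono fun p => (z p).re) {lam : ℂ} (hlam : lam ∈ cutPlane) (m : Fin P) :
    sysInt ε c z m (rat z lam c fun p => conj (c p)) lam = 0 := by
  have hR : ∀ x, rat z lam c (fun p => conj (c p)) x = lam + upot c z x := fun x => by
    simp [rat, upot]
  have hQ : ∀ x ∈ dDom z, HasDerivAt (expo ε lam (antideriv c z))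
      (expo ε lam (antideriv c z) x * rat z lam c (fun p => conj (c p)) x / (I * ε)) x :=
    fun x hx => (hasDerivAt_expo hε (hasDerivAt_antideriv hx)).congr_deriv (by rw [hR]; ring)
  -- The constant 1 is a bounded solution for the right-hand side `lam + upot`, hence it is `upSol`;
  -- correspondingly the primitive is the exponential itself.
  have hU : ∀ a : ℝ, upSol ε c z (rat z lam c fun p => conj (c p)) lam (a + height z * I) = 1 := by
    refine fun a => (SolvesAt.eq_upSol (F := fun _ => 1) (B := 1) hε hz hlam (fun x _ => ?_)
      (by simp) (by simp [highDom])).symm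
    refine (hasDerivAt_const x (1 : ℂ)).congr_deriv ?_
    simp [hR]
  by_cases hm : HasZeroAt ε c m
  · rw [sysInt_eq_of_primitive_pole hε hz hre hm hQ (by rw [hU, mul_one])
      (tendsto_expo_pole hz hre hm lam), mul_zero]
  · rw [sysInt_eq_of_primitive hε hz hre hm hQ (by rw [hU, mul_one]), hU]
    ring

theorem exists_decaying_solution (hε : 0 < ε) (hz : ∀ p, 0 < (z p).im)
    (hre : StrictMono fun p => (z p).re) {lam : ℂ} (hlam : lam ∈ cutPlane) {α β : Fin P → ℂ}
    (hsys : ∀ m, sysInt ε c z m (rat z 0 α β) lam = 0) :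
    ∃ F : ℂ → ℂ, Decays F ∧
      (∀ x : ℂ, 0 ≤ x.im → x ∉ poles z → SolvesAt ε c z lam (rat z 0 α β) F x) ∧
      (∀ p, c p * F (z p) = α p) ∧
      (∑ p, (α p + β p) = 0 → F =O[upperInfty] fun x => (x ^ 2)⁻¹) := by
  obtain ⟨F, h1, h2, h3, h4⟩ := exists_solution hε hz hre hlam hsys
  exact ⟨F, ⟨h1, h3⟩, h2, fun p => mul_eq_of_solvesAt hz hre hε (fun x hx => h1 x hx.le)
    (fun x hx => h2 x hx.le) p, h4⟩

theorem eq_zero_of_integral_norm_sq (hz : ∀ p, 0 < (z p).im) {φ : Fin P → ℂ}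
    {F : ℂ → ℂ} (hF : Decays F) (hφ : ∀ p, c p * F (z p) = φ p)
    (h : ∫ x : ℝ, F x * conj (F x) = 0) : φ = 0 := by
  ext p
  rw [← hφ p, hF.eq_zero_of_integral h (hz p), mul_zero, Pi.zero_apply]

/-- Pair the solution `F` with itself. The right-hand side has poles only in the upper half-plane,
so both of its pairings with `F` vanish and `(lam - conj lam)‖F‖² = 0`. If `F` were zero, the
residue relation would make `φ` zero. -/
theorem im_eq_zero_of_kernel (hε : 0 < ε) (hz : ∀ p, 0 < (z p).im)
    (hre : StrictMono fun p => (z p).re) {lam : ℂ} (hlam : lam ∈ cutPlane) {φ : Fin P → ℂ}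
    (hφ : φ ≠ 0) (hsys : ∀ m, sysInt ε c z m (rat z 0 φ 0) lam = 0) : lam.im = 0 := by
  obtain ⟨F, hF, hs, hv, -⟩ := exists_decaying_solution hε hz hre hlam hsys
  have hs' := fun x : ℝ => hs x (by simp) (ofReal_notMem_poles hz x)
  have h := integral_pairing hε hF hF hs' hs' (hF.integrable_rat_mul_conj hz _ _) (by
    simpa [conj_rat_ofReal] using hF.integrable_mul_rat hz (fun _ => 0) fun p => conj (φ p))
  rw [hF.integral_rat_mul_conj hz] at h
  simp only [conj_rat_ofReal, map_zero, Pi.zero_apply, zero_mul, Finset.sum_const_zero,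
    mul_zero, hF.integral_mul_rat hz, sub_zero] at h
  rcases mul_eq_zero.mp h.symm with h0 | h0
  · exact conj_eq_iff_im.mp (sub_eq_zero.mp h0).symm
  · exact absurd (eq_zero_of_integral_norm_sq hz hF hv h0) hφ

theorem conj_eq_of_kernel (hε : 0 < ε) (hz : ∀ p, 0 < (z p).im)
    (hre : StrictMono fun p => (z p).re) {lam : ℂ} (hlam : lam ∈ cutPlane) {φ : Fin P → ℂ}
    (hφ : φ ≠ 0) (hsys : ∀ m, sysInt ε c z m (rat z 0 φ 0) lam = 0) : conj lam = lam :=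
  conj_eq_iff_im.mpr (im_eq_zero_of_kernel hε hz hre hlam hφ hsys)

/-- If the sum vanishes, `F` is `O(x⁻²)`, so `xF` decays as well. It solves the equation with
right-hand side `iεF + xR`, where `xR` again has no constant term. Green's identity with `F` leaves
`iε‖F‖² = 0`. -/
theorem sum_ne_zero_of_kernel (hε : 0 < ε) (hz : ∀ p, 0 < (z p).im)
    (hre : StrictMono fun p => (z p).re) {lam : ℂ} (hlam : lam ∈ cutPlane) {φ : Fin P → ℂ}
    (hφ : φ ≠ 0) (hsys : ∀ m, sysInt ε c z m (rat z 0 φ 0) lam = 0) : ∑ p, φ p ≠ 0 := by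
  intro hsum
  have hε' : (ε : ℂ) ≠ 0 := by exact_mod_cast hε.ne'
  have hI := I_ne_zero
  have hconj := conj_eq_of_kernel hε hz hre hlam hφ hsys
  obtain ⟨F, hF, hs, hv, hO⟩ := exists_decaying_solution hε hz hre hlam hsys
  have hs' := fun x : ℝ => hs x (by simp) (ofReal_notMem_poles hz x)
  have hO := hO (by simpa using hsum)
  set G : ℂ → ℂ := fun x => x * F x with hG
  have hGd : Decays G := by
    refine ⟨fun x hx => differentiableAt_id.mul (hF.differentiableAt x hx), ?_⟩
    refine ((Asymptotics.isBigO_refl (fun x : ℂ => x) upperInfty).mul hO).congr' .rfl ?_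
    filter_upwards [eventually_ne_zero_upperInfty] with x hx
    field_simp
  set R : ℂ → ℂ := fun x => I * ε * F x + rat z 0 (fun p => z p * φ p) 0 x with hR
  have hGs : ∀ x : ℝ, SolvesAt ε c z lam R G x := by
    intro x
    refine ((hasDerivAt_id (x : ℂ)).mul (hs' x)).congr_deriv ?_
    have := mul_rat φ 0 1 (ofReal_notMem_poles hz x)
    simp only [one_mul, Pi.zero_apply, add_zero, hsum, mul_zero] at this
    change (x : ℂ) * _ = rat z 0 (fun p => z p * φ p) 0 x at this
    simp only [hR, hG, id, ← this]
    field_simp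
    ring
  have i1 : Integrable fun x : ℝ => I * ε * (F x * conj (F x)) :=
    (hF.integrable_mul_conj hF).const_mul _
  have i2 := hF.integrable_rat_mul_conj hz (fun p => z p * φ p) 0
  have e : ∀ x : ℝ, R x * conj (F x) = I * ε * (F x * conj (F x))
      + rat z 0 (fun p => z p * φ p) 0 x * conj (F x) := fun x => by simp only [hR]; ring
  have h := integral_pairing hε hGd hF hGs hs' (by simp_rw [e]; exact i1.add i2) (by
    simpa [conj_rat_ofReal] using hGd.integrable_mul_rat hz (fun _ => 0) fun p => conj (φ p))
  simp_rw [e] at h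
  rw [integral_add i1 i2, hF.integral_rat_mul_conj hz, integral_const_mul, hconj] at h
  simp only [conj_rat_ofReal, map_zero, Pi.zero_apply, zero_mul, Finset.sum_const_zero,
    mul_zero, hGd.integral_mul_rat hz, sub_zero, sub_self, add_zero] at h
  refine hφ (eq_zero_of_integral_norm_sq hz hF hv ?_)
  exact (mul_eq_zero.mp h).resolve_left (mul_ne_zero hI hε')

/-- A solution `v` yields a decaying solution `W` for a right-hand side whose residues at `conj (z
p)` are `-conj (c p)`. Pairing `W` with the kernel solution `F` isolates these residues and gives `∑
c_p F(z_p) = 0`, that is, `∑ φ_p = 0`. -/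
theorem not_solvable_of_kernel (hε : 0 < ε) (hz : ∀ p, 0 < (z p).im)
    (hre : StrictMono fun p => (z p).re) {lam : ℂ} (hlam : lam ∈ cutPlane) {φ v : Fin P → ℂ}
    (hφ : φ ≠ 0) (hsys : ∀ m, sysInt ε c z m (rat z 0 φ 0) lam = 0)
    (hv : ∀ m, sysInt ε c z m (rat z 0 v 0) lam = -lam * sysInt ε c z m (rat z 1 0 0) lam) :
    False := by
  have hconj := conj_eq_of_kernel hε hz hre hlam hφ hsys
  -- The hypothesis says that the functionals vanish on `lam + ∑ v_p/(x - z_p)`; subtracting `lam +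
  -- upot`, on which they vanish too, removes the constant term.
  have hsys' : ∀ m, sysInt ε c z m (rat z 0 (v - c) (-fun p => conj (c p))) lam = 0 := by
    intro m
    have hL := isSpectralFunctional_sysInt (c := c) hε hz hre m
    have h1 := hL.smul lam hlam lam 1 0 0
    have h2 := hL.add lam hlam lam 0 0 v 0 0
    have h3 := hL.smul lam hlam (-1) lam c fun p => conj (c p)
    have h4 := hL.add lam hlam lam (-1 * lam) v (fun p => -1 * c p) 0 fun p => -1 * conj (c p)
    rw [sysInt_rat_potential hε hz hre hlam m, mul_zero] at h3
    rw [h3, add_zero] at h4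
    have e1 : (fun p => lam * (0 : Fin P → ℂ) p) = 0 := by ext; simp
    simp only [e1, mul_one, add_zero, zero_add] at h1 h2
    have e2 : rat z (lam + -1 * lam) (v + fun p => -1 * c p) (0 + fun p => -1 * conj (c p))
        = rat z 0 (v - c) (-fun p => conj (c p)) := by
      congr 1
      · ring
      · ext; simp [sub_eq_add_neg]
      · ext; simp
    rw [← e2, h4, h2, h1, hv m]
    ring
  obtain ⟨F, hF, hs, hval, -⟩ := exists_decaying_solution hε hz hre hlam hsys
  obtain ⟨W, hW, hsW, -, -⟩ := exists_decaying_solution hε hz hre hlam hsys'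
  have h := integral_pairing hε hW hF
    (fun x : ℝ => hsW x (by simp) (ofReal_notMem_poles hz x))
    (fun x : ℝ => hs x (by simp) (ofReal_notMem_poles hz x))
    (hF.integrable_rat_mul_conj hz _ _) (by
      simpa [conj_rat_ofReal] using hW.integrable_mul_rat hz (fun _ => 0) fun p => conj (φ p))
  rw [hF.integral_rat_mul_conj hz, hconj] at h
  simp only [conj_rat_ofReal, map_zero, Pi.zero_apply, zero_mul, Finset.sum_const_zero,
    mul_zero, hW.integral_mul_rat hz, sub_zero, sub_self, Pi.neg_apply] at h
  refine sum_ne_zero_of_kernel hε hz hre hlam hφ hsys ?_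
  have h2 := (mul_eq_zero.mp h).resolve_left (by simp [Real.pi_ne_zero])
  have h3 := congrArg conj h2
  simp only [map_sum, map_mul, map_neg, conj_conj, map_zero, neg_mul, Finset.sum_neg_distrib,
    neg_eq_zero, hval] at h3
  exact h3

end

end BenjaminOno

namespace BenjaminOno
open Complex Set Filter MeasureTheory

noncomputable section

variable {P : ℕ} {ε : ℝ} {c z : Fin P → ℂ} {m : Fin P}

/-! ### Kernel vectors give eigenvalues -/

theorem Decays.exists_norm_le {F : ℂ → ℂ} (hF : Decays F) :
    ∃ K : ℝ, ∀ x : ℂ, 0 ≤ x.im → ‖F x‖ ^ 2 ≤ K * (1 + x.re ^ 2)⁻¹ := by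
  obtain ⟨C, R, hR, h⟩ := isBigO_upperInfty_iff.mp (show F =O[upperInfty] fun x => (x ^ 1)⁻¹ by
    simpa using hF.isBigO)
  simp only [pow_one] at h
  have hcpt : IsCompact (Metric.closedBall (0 : ℂ) (max R 1) ∩ {x | 0 ≤ x.im}) :=
    (isCompact_closedBall _ _).inter_right (isClosed_le continuous_const continuous_im)
  obtain ⟨M, hM⟩ := hcpt.exists_bound_of_continuousOn (f := F) fun x hx =>
    (hF.differentiableAt x hx.2).continuousAt.continuousWithinAt
  refine ⟨max (C ^ 2 * 2) (M ^ 2 * (1 + max R 1 ^ 2)), fun x hx => ?_⟩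
  have hre : x.re ^ 2 ≤ ‖x‖ ^ 2 := by
    rw [← sq_abs]
    exact pow_le_pow_left₀ (abs_nonneg _) (abs_re_le_norm x) 2
  rw [← div_eq_mul_inv, le_div_iff₀ (by positivity)]
  rcases le_total ‖x‖ (max R 1) with hx' | hx'
  · refine le_trans ?_ (le_max_right _ _)
    have h1 := hM x ⟨by simpa using hx', hx⟩
    have h2 : ‖x‖ ^ 2 ≤ max R 1 ^ 2 := by gcongr
    have h3 : 1 + x.re ^ 2 ≤ 1 + max R 1 ^ 2 := by linarith
    gcongr
  · refine le_trans ?_ (le_max_left _ _)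
    have h1 := h x hx ((le_max_left _ _).trans hx')
    have hx1 : 1 ≤ ‖x‖ := (le_max_right _ _).trans hx'
    have h0 : 0 < ‖x‖ := by linarith
    calc ‖F x‖ ^ 2 * (1 + x.re ^ 2) ≤ (C / ‖x‖) ^ 2 * (2 * ‖x‖ ^ 2) := by
          have : 1 + x.re ^ 2 ≤ 2 * ‖x‖ ^ 2 := by nlinarith
          gcongr
      _ = C ^ 2 * 2 := by field_simp

/-- The bound `K(1 + x²)⁻¹` for `‖F‖²` depends on the real part only, so one square-integrable
majorant serves all horizontal lines. -/
theorem Decays.memHardyPlus {F : ℂ → ℂ} (hF : Decays F) : MemHardyPlus fun x : ℝ => F x := by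
  obtain ⟨K, hK⟩ := hF.exists_norm_le
  have hK0 : 0 ≤ K := by
    have := hK 0 le_rfl
    simp only [zero_re] at this
    norm_num at this
    exact (sq_nonneg _).trans this
  set g : ℝ → ℝ := fun x => Real.sqrt (K * (1 + x ^ 2)⁻¹) with hg
  have hgs : ∀ x, g x ^ 2 = K * (1 + x ^ 2)⁻¹ := fun x => Real.sq_sqrt (by positivity)
  have hgL : MemLp g 2 := by
    have hgc : Continuous g := by
      refine Real.continuous_sqrt.comp (continuous_const.mul (Continuous.inv₀ (by fun_prop) ?_))
      intro x; positivity
    rw [memLp_two_iff_integrable_sq hgc.aestronglyMeasurable]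
    simp_rw [hgs]
    exact integrable_inv_one_add_sq.const_mul K
  refine ⟨F, fun x hx => (hF.differentiableAt x (le_of_lt hx)).differentiableWithinAt,
    ⟨(eLpNorm g 2 volume).toNNReal, fun y hy => ?_⟩, ae_of_all _ fun x => ?_⟩
  · rw [ENNReal.coe_toNNReal hgL.eLpNorm_ne_top]
    refine eLpNorm_mono_real fun x => ?_
    refine Real.le_sqrt_of_sq_le ?_
    simpa using hK ((x : ℂ) + y * I) (by simpa using hy.le)
  · have h1 : Tendsto (fun y : ℝ => (x : ℂ) + y * I) (𝓝 0) (𝓝 (x : ℂ)) := by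
      have : Continuous fun y : ℝ => (x : ℂ) + y * I := by fun_prop
      simpa using this.tendsto 0
    exact ((hF.differentiableAt x (by simp)).continuousAt.tendsto.comp h1).mono_left
      nhdsWithin_le_nhds

theorem isBigO_inv_sq_upperInfty :
    (fun x : ℂ => (x ^ 2)⁻¹) =O[upperInfty] fun x => x⁻¹ := by
  refine Asymptotics.IsBigO.of_bound 1 (Filter.Eventually.filter_mono inf_le_left ?_)
  rw [(Metric.hasBasis_cobounded_compl_ball (0 : ℂ)).eventually_iff]
  refine ⟨1, trivial, fun x hx => ?_⟩
  have : 1 ≤ ‖x‖ := by simpa using hx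
  rw [norm_inv, norm_inv, norm_pow, one_mul]
  gcongr
  nlinarith

theorem decays_inv_sub {ζ : ℂ} (hζ : ζ.im < 0) : Decays fun x => (x - ζ)⁻¹ := by
  refine ⟨fun x hx => ?_, isBigO_inv_sub_upperInfty ζ⟩
  refine DifferentiableAt.inv (by fun_prop) fun h => ?_
  rw [sub_eq_zero.mp h] at hx
  linarith

theorem Decays.decays_dslope {F : ℂ → ℂ} (hF : Decays F) {ζ : ℂ} (hζ : 0 < ζ.im) :
    Decays (dslope F ζ) := by
  refine ⟨fun x hx => ?_, ?_⟩
  · by_cases hxz : x = ζ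
    · subst hxz
      have hU : {y : ℂ | 0 < y.im} ∈ 𝓝 x := (isOpen_lt continuous_const continuous_im).mem_nhds hζ
      exact ((differentiableOn_dslope hU).mpr fun y hy =>
        (hF.differentiableAt y (le_of_lt hy)).differentiableWithinAt).differentiableAt hU
    · exact (differentiableAt_dslope_of_ne hxz).mpr (hF.differentiableAt x hx)
  · have h1 := (isBigO_pow_two_of_mul hF.isBigO (isBigO_inv_sub_upperInfty ζ)).trans
      isBigO_inv_sq_upperInfty
    have h2 := (isBigO_inv_sub_upperInfty ζ).const_mul_left (F ζ)
    refine (h1.sub h2).congr' ?_ .rfl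
    refine Filter.Eventually.filter_mono inf_le_left ?_
    rw [(Metric.hasBasis_cobounded_compl_ball (0 : ℂ)).eventually_iff]
    refine ⟨‖ζ‖ + 1, trivial, fun x hx => ?_⟩
    have hne : x ≠ ζ := by
      rintro rfl
      simp at hx
    simp only [dslope_of_ne _ hne, slope_def_field]
    ring

theorem Decays.mul_inv_sub {F : ℂ → ℂ} (hF : Decays F) {ζ : ℂ} (hζ : ζ.im < 0) :
    Decays fun x => F x * (x - ζ)⁻¹ :=
  ⟨fun x hx => (hF.differentiableAt x hx).mul ((decays_inv_sub hζ).differentiableAt x hx),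
    (isBigO_pow_two_of_mul hF.isBigO (isBigO_inv_sub_upperInfty ζ)).trans isBigO_inv_sq_upperInfty⟩

/-- The product of a decaying function with the potential is the sum of a decaying function and
of a rational function with poles in the upper half-plane. -/
theorem Decays.exists_decays_upot_mul_sub {F : ℂ → ℂ} (hF : Decays F)
    (hz : ∀ p, 0 < (z p).im) :
    ∃ G, Decays G ∧ ∀ x : ℝ,
      upot c z x * F x = G x + rat z 0 (fun p => c p * F (z p)) 0 x := by
  have h : ∀ p, Decays fun x =>
      c p * dslope F (z p) x + conj (c p) * (F x * (x - conj (z p))⁻¹) := fun p => by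
    have h1 := hF.decays_dslope (hz p)
    have h2 := hF.mul_inv_sub (ζ := conj (z p)) (by simpa using hz p)
    exact ⟨fun x hx => ((h1.differentiableAt x hx).const_mul _).add
      ((h2.differentiableAt x hx).const_mul _),
      (h1.isBigO.const_mul_left _).add (h2.isBigO.const_mul_left _)⟩
  refine ⟨fun x => ∑ p, (c p * dslope F (z p) x + conj (c p) * (F x * (x - conj (z p))⁻¹)),
    ⟨fun x hx => DifferentiableAt.fun_sum fun p _ => (h p).differentiableAt x hx,
      Asymptotics.IsBigO.fun_sum fun p _ => (h p).isBigO⟩, fun x => ?_⟩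
  simp only [upot, rat, zero_add, Pi.zero_apply, zero_div, add_zero, Finset.sum_mul]
  rw [← Finset.sum_add_distrib]
  refine Finset.sum_congr rfl fun p _ => ?_
  obtain ⟨h1, h2⟩ := sub_ne_zero_of_notMem_poles (ofReal_notMem_poles hz x) p
  rw [dslope_of_ne _ (sub_ne_zero.mp h1), slope_def_field]
  field_simp
  ring

/-- Both factors are holomorphic in the closed lower half-plane: this is the pairing of the rational
function with the decaying function `1/(x - conj ζ)`. -/
theorem integral_rat_div_sub (hz : ∀ p, 0 < (z p).im) (α : Fin P → ℂ) {ζ : ℂ} (hζ : 0 < ζ.im) :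
    (Integrable fun x : ℝ => rat z 0 α 0 x / (x - ζ)) ∧
      ∫ x : ℝ, rat z 0 α 0 x / (x - ζ) = 0 := by
  have hd := decays_inv_sub (ζ := conj ζ) (by simpa using hζ)
  have h1 := hd.integrable_rat_mul_conj hz α 0
  have h2 := hd.integral_rat_mul_conj hz α 0
  simp only [map_inv₀, map_sub, conj_ofReal, conj_conj, Pi.zero_apply, zero_mul,
    Finset.sum_const_zero, mul_zero] at h1 h2
  simp only [← div_eq_mul_inv] at h1 h2
  exact ⟨h1, h2⟩

/-- On the real line `u₀F = G + R` with `G` decaying in the upper half-plane and `R = ∑ φ_p/(x -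
z_p)`, by the residue relation. The Cauchy integral reproduces `G` and annihilates `R`, and the
differential equation says that `-G = iεF' + λF`. -/
theorem isEigenvalue_of_kernel (hε : 0 < ε) (hz : ∀ p, 0 < (z p).im)
    (hre : StrictMono fun p => (z p).re) {lam : ℂ} (hlam : lam ∈ cutPlane) {φ : Fin P → ℂ}
    (hφ : φ ≠ 0) (hsys : ∀ m, sysInt ε c z m (rat z 0 φ 0) lam = 0) :
    lam ∈ eigenvalues ε (potential c z) := by
  have hε' : (ε : ℂ) ≠ 0 := by exact_mod_cast hε.ne'
  have him := im_eq_zero_of_kernel hε hz hre hlam hφ hsys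
  have hl : lam = (lam.re : ℂ) := Complex.ext rfl (by simpa using him)
  refine ⟨lam.re, ⟨?_, ?_⟩, hl⟩
  · rcases mem_cutPlane_iff.mp hlam with h | h
    · exact h
    · exact absurd him h
  obtain ⟨F, hF, hs, hv, -⟩ := exists_decaying_solution hε hz hre hlam hsys
  have hs' := fun x : ℝ => HasDerivAt.comp_ofReal (hs x (by simp) (ofReal_notMem_poles hz x))
  refine ⟨fun x : ℝ => F x, fun h0 => hφ ?_, hF.memHardyPlus,
    fun x => (hs' x).differentiableAt, fun x => ?_⟩
  · refine eq_zero_of_integral_norm_sq hz hF hv ?_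
    have : ∀ x : ℝ, F x = 0 := fun x => congrFun h0 x
    simp [this]
  · obtain ⟨G, hG, hGu⟩ := hF.exists_decays_upot_mul_sub (c := c) hz
    simp only [hv] at hGu
    have hval : -(I * ε * deriv (fun x : ℝ => F x) x + lam.re * F x) = G x := by
      rw [(hs' x).deriv, ← hl]
      have := hGu x
      change upot c z x * F x = G x + rat z 0 φ 0 x at this
      have hI := I_ne_zero
      field_simp
      linear_combination this
    rw [HasCauchyPlus, hval]
    have hc : Tendsto (fun δ : ℝ => G ((x : ℂ) + δ * I)) (𝓝[>] 0) (𝓝 (G x)) := by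
      have h1 : Tendsto (fun y : ℝ => (x : ℂ) + y * I) (𝓝 0) (𝓝 (x : ℂ)) := by
        have : Continuous fun y : ℝ => (x : ℂ) + y * I := by fun_prop
        simpa using this.tendsto 0
      exact ((hG.differentiableAt x (by simp)).continuousAt.tendsto.comp h1).mono_left
        nhdsWithin_le_nhds
    refine hc.congr' ?_
    filter_upwards [self_mem_nhdsWithin] with δ hδ
    have hδ' : 0 < ((x : ℂ) + δ * I).im := by simpa using hδ
    obtain ⟨h1, h2⟩ := integral_rat_div_sub hz φ hδ'
    have h3 := hG.integrable_div_sub hδ'.ne'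
    have e : ∀ y : ℝ, potential c z y * F y / ((y : ℂ) - ((x : ℂ) + δ * I))
        = G y / ((y : ℂ) - ((x : ℂ) + δ * I))
          + rat z 0 φ 0 y / ((y : ℂ) - ((x : ℂ) + δ * I)) := fun y => by
      rw [potential_eq_upot, ← add_div]
      exact congrArg (· / _) (hGu y)
    simp_rw [e]
    rw [integral_add h3 h1, h2, add_zero,
      integral_div_sub_of_im_pos hG.differentiableAt hG.isBigO hδ']
    have hI := I_ne_zero
    have hpi : (Real.pi : ℂ) ≠ 0 := by exact_mod_cast Real.pi_ne_zero
    field_simp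

end

end BenjaminOno

namespace BenjaminOno
open Complex Set Filter MeasureTheory

noncomputable section

/-! ### Boundary values of functions in the Hardy space -/

/-! ### Weak convergence of bounded sequences in `L²` -/

section Weak

variable {f : ℕ → ℝ → ℂ} {w g : ℝ → ℂ} {K : NNReal}

theorem memLp_of_tendsto_of_bounded (hf : ∀ n, AEStronglyMeasurable (f n))
    (hK : ∀ n, eLpNorm (f n) 2 ≤ K) (hw : ∀ᵐ x, Tendsto (fun n => f n x) atTop (𝓝 (w x))) :
    MemLp w 2 := by
  refine ⟨aestronglyMeasurable_of_tendsto_ae _ hf hw, ?_⟩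
  refine (Lp.eLpNorm_lim_le_liminf_eLpNorm hf w hw).trans_lt (lt_of_le_of_lt ?_
    (ENNReal.coe_lt_top (r := K)))
  exact liminf_le_of_frequently_le' (Frequently.of_forall hK)

theorem eLpNorm_indicator_mul_le {f : ℝ → ℂ} (hf : AEStronglyMeasurable f) (hK : eLpNorm f 2 ≤ K)
    (hg : AEStronglyMeasurable g) {s : Set ℝ} (hs : MeasurableSet s) :
    eLpNorm (s.indicator fun x => f x * g x) 1 ≤ K * eLpNorm (s.indicator g) 2 := by
  have h := eLpNorm_smul_le_mul_eLpNorm (p := 2) (q := 2) (r := 1) (hg.indicator hs) hf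
  refine le_trans (le_of_eq ?_) (h.trans (by gcongr))
  congr 1
  ext x
  by_cases hx : x ∈ s <;> simp [hx]

/-- A sequence that is bounded in `L²` and converges almost everywhere converges weakly. -/
theorem tendsto_integral_mul_of_bounded (hf : ∀ n, AEStronglyMeasurable (f n))
    (hK : ∀ n, eLpNorm (f n) 2 ≤ K) (hw : ∀ᵐ x, Tendsto (fun n => f n x) atTop (𝓝 (w x)))
    (hg : MemLp g 2) :
    Tendsto (fun n => ∫ x, f n x * g x) atTop (𝓝 (∫ x, w x * g x)) := by
  have hwL := memLp_of_tendsto_of_bounded hf hK hw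
  have hfL : ∀ n, MemLp (f n) 2 := fun n => ⟨hf n, (hK n).trans_lt ENNReal.coe_lt_top⟩
  have hi : ∀ {h : ℝ → ℂ}, MemLp h 2 → Integrable fun x => h x * g x := fun hh => hh.integrable_mul hg
  -- Vitali's theorem in `L¹` for the products. By Hölder's inequality with the uniform bound `K`,
  -- uniform integrability and tightness are inherited from the single function `g`; dividing by `K
  -- + 1` avoids a division by zero.
  have h1 : UnifIntegrable (fun n x => f n x * g x) 1 volume := by
    intro e he
    obtain ⟨δ, hδ, h⟩ := hg.eLpNorm_indicator_le (by norm_num) (by norm_num)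
      (ε := e / (K + 1)) (by positivity)
    refine ⟨δ, hδ, fun n s hs hμ => ?_⟩
    refine (eLpNorm_indicator_mul_le (hf n) (hK n) hg.1 hs).trans ?_
    refine (mul_le_mul_right (h s hs hμ) _).trans ?_
    rw [← ENNReal.ofReal_coe_nnreal, ← ENNReal.ofReal_mul (by positivity)]
    refine ENNReal.ofReal_le_ofReal ?_
    rw [mul_div_assoc', div_le_iff₀ (by positivity)]
    nlinarith [K.2]
  have h2 : UnifTight (fun n x => f n x * g x) 1 volume := by
    intro e he
    obtain ⟨s, hs, hμ, h⟩ := hg.exists_eLpNorm_indicator_compl_lt (by norm_num)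
      (ε := (e / (K + 1) : NNReal)) (by simpa using (by positivity : 0 < e / (K + 1)).ne')
    refine ⟨s, hμ.ne, fun n => ?_⟩
    refine (eLpNorm_indicator_mul_le (hf n) (hK n) hg.1 hs.compl).trans ?_
    refine (mul_le_mul_right h.le _).trans ?_
    rw [← ENNReal.coe_mul, ENNReal.coe_le_coe, mul_div_assoc', div_le_iff₀ (by positivity), mul_add,
      mul_comm e]
    exact le_add_of_nonneg_right (by positivity)
  have h3 := tendsto_Lp_of_tendsto_ae (p := 1) le_rfl (by norm_num)
    (fun n => (hf n).mul hg.1) (memLp_one_iff_integrable.mpr (hi hwL)) h1 h2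
    (hw.mono fun x hx => hx.mul_const (g x))
  exact tendsto_integral_of_L1' _ (hi hwL).1 (Eventually.of_forall fun n => hi (hfL n)) h3

end Weak

/-! ### Pointwise bounds and Cauchy's formula in the Hardy space -/

section Hardy

variable {F : ℂ → ℂ} {w : ℝ → ℂ} {K : NNReal}

/-- Continuity along horizontal lines in the upper half-plane. -/
theorem continuous_line (hF : DifferentiableOn ℂ F {x | 0 < x.im}) {y : ℝ} (hy : 0 < y) :
    Continuous fun x : ℝ => F (x + y * I) := by
  rw [← continuousOn_univ]
  exact hF.continuousOn.comp (by fun_prop) fun x _ => by simpa using hy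

theorem norm_integral_line_le (hF : DifferentiableOn ℂ F {x | 0 < x.im})
    (hK : ∀ y : ℝ, 0 < y → eLpNorm (fun x : ℝ => F (x + y * I)) 2 ≤ K) {y : ℝ} (hy : 0 < y)
    (a : ℝ) {h : ℝ} (h0 : 0 ≤ h) (h1 : h ≤ 1) : ‖∫ s in a..a + h, F (s + y * I)‖ ≤ K := by
  have hm : AEStronglyMeasurable (fun x : ℝ => F (x + y * I)) :=
    (continuous_line hF hy).aestronglyMeasurable
  have h : ‖∫ s in a..a + h, F (s + y * I)‖ₑ ≤ K := by
    rw [intervalIntegral.integral_of_le (by linarith)]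
    calc ‖∫ s in Ioc a (a + h), F (s + y * I)‖ₑ ≤ ∫⁻ s in Ioc a (a + h), ‖F (s + y * I)‖ₑ :=
          enorm_integral_le_lintegral_enorm _
      _ ≤ ∫⁻ s in Ioc a (a + 1), ‖F (s + y * I)‖ₑ :=
          lintegral_mono_set (Ioc_subset_Ioc_right (by linarith))
      _ = eLpNorm (fun x : ℝ => F (x + y * I)) 1 (volume.restrict (Ioc a (a + 1))) :=
          eLpNorm_one_eq_lintegral_enorm.symm
      _ ≤ eLpNorm (fun x : ℝ => F (x + y * I)) 2 (volume.restrict (Ioc a (a + 1))) := by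
          refine (eLpNorm_le_eLpNorm_mul_rpow_measure_univ (by norm_num : (1 : ENNReal) ≤ 2)
            hm.restrict).trans (le_of_eq ?_)
          simp
      _ ≤ eLpNorm (fun x : ℝ => F (x + y * I)) 2 volume :=
          eLpNorm_mono_measure _ Measure.restrict_le_self
      _ ≤ K := hK y hy
  exact_mod_cast enorm_le_coe.mp h

theorem isComb_upper : IsComb {x : ℂ | 0 < x.im} 1 where
  isOpen := isOpen_lt continuous_const continuous_im
  line s := by simp
  vert x hx t ht := by
    have hx : 0 < x.im := hx
    have : min 1 x.im ≤ t := ht.1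
    simpa using lt_of_lt_of_le (lt_min one_pos hx) this

/-- Let `Φ` be a primitive of `F`. By the Cauchy–Schwarz inequality on a unit interval, `Φ(x + h) -
Φ(x)` is bounded by `K` for `0 ≤ h ≤ 1`. Cauchy's estimate on the disk of radius `ζ.im/2` then
bounds `F(ζ + h) - F(ζ)` by `2K/ζ.im`. The average of `F(ζ + h)` over `h` is itself at most `K`, and
the two bounds add up. -/
theorem norm_le_of_hardy (hF : DifferentiableOn ℂ F {x | 0 < x.im})
    (hK : ∀ y : ℝ, 0 < y → eLpNorm (fun x : ℝ => F (x + y * I)) 2 ≤ K) {ζ : ℂ} (hζ : 0 < ζ.im) :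
    ‖F ζ‖ ≤ K + 2 * K / ζ.im := by
  obtain ⟨Φ, -, hΦ⟩ := isComb_upper.exists_primitive hF I 0
  have hshift : ∀ x : ℂ, 0 < x.im → ∀ h ∈ Icc (0 : ℝ) 1, ‖Φ (x + h) - Φ x‖ ≤ K := by
    intro x hx h hh
    have := norm_integral_line_le hF hK hx x.re hh.1 hh.2
    have e : ∫ s in x.re..x.re + h, F (s + x.im * I) = Φ (x + h) - Φ x := by
      have hd : ∀ s : ℝ, HasDerivAt (fun s : ℝ => Φ (s + x.im * I)) (F (s + x.im * I)) s :=
        fun s => by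
          have h1 : HasDerivAt (fun s : ℝ => (s : ℂ) + x.im * I) 1 s := by
            simpa using (hasDerivAt_id s).ofReal_comp.add_const (x.im * I)
          exact ((hΦ ((s : ℂ) + x.im * I) (by simpa using hx)).comp_of_eq s h1 rfl).congr_deriv
            (mul_one _)
      rw [intervalIntegral.integral_eq_sub_of_hasDerivAt (fun s _ => hd s)
        ((continuous_line hF hx).intervalIntegrable _ _), re_add_im]
      congr 2
      rw [ofReal_add, add_right_comm, re_add_im]
    rwa [e] at this
  have hdiff : ∀ h ∈ Icc (0 : ℝ) 1, ‖F (ζ + h) - F ζ‖ ≤ 2 * K / ζ.im := by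
    intro h hh
    have hd : ∀ x : ℂ, 0 < x.im → HasDerivAt (fun x => Φ (x + h) - Φ x) (F (x + h) - F x) x :=
      fun x hx => (HasDerivAt.comp_add_const x (h : ℂ) (hΦ _ (by simpa using hx))).sub (hΦ x hx)
    have hsub : ∀ x ∈ Metric.closedBall ζ (ζ.im / 2), 0 < x.im := fun x hx => by
      have h1 : ‖x - ζ‖ ≤ ζ.im / 2 := by simpa [dist_eq_norm] using hx
      have h2 := (abs_le.mp ((abs_im_le_norm (x - ζ)).trans h1)).1
      rw [sub_im] at h2
      linarith
    have hdc : DiffContOnCl ℂ (fun x => Φ (x + h) - Φ x) (Metric.ball ζ (ζ.im / 2)) := by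
      refine DifferentiableOn.diffContOnCl fun x hx => ?_
      rw [closure_ball _ (by positivity)] at hx
      exact (hd x (hsub x hx)).differentiableAt.differentiableWithinAt
    have := Complex.norm_deriv_le_of_forall_mem_sphere_norm_le (C := K) (half_pos hζ) hdc
      fun x hx => hshift x (hsub x (Metric.sphere_subset_closedBall hx)) h hh
    rw [(hd ζ hζ).deriv] at this
    refine this.trans (le_of_eq ?_)
    field_simp
  have hline : ∀ s : ℝ, ζ + (s : ℂ) ∈ {x : ℂ | 0 < x.im} := fun s => by simpa using hζ
  have hcont : Continuous fun s : ℝ => F (ζ + s) := by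
    rw [← continuousOn_univ]
    exact hF.continuousOn.comp (by fun_prop) fun x _ => hline x
  have hI : ∫ s in (0 : ℝ)..1, F (ζ + s) = Φ (ζ + 1) - Φ ζ := by
    have hd : ∀ s : ℝ, HasDerivAt (fun s : ℝ => Φ (ζ + s)) (F (ζ + s)) s := fun s => by
      have h1 : HasDerivAt (fun s : ℝ => ζ + (s : ℂ)) 1 s := by
        simpa using (hasDerivAt_id s).ofReal_comp.const_add ζ
      exact ((hΦ _ (hline s)).comp_of_eq s h1 rfl).congr_deriv (mul_one _)
    rw [intervalIntegral.integral_eq_sub_of_hasDerivAt (fun s _ => hd s)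
      (hcont.intervalIntegrable _ _)]
    simp
  have h1 : ‖∫ s in (0 : ℝ)..1, (F (ζ + s) - F ζ)‖ ≤ 2 * K / ζ.im * |1 - 0| := by
    refine intervalIntegral.norm_integral_le_of_norm_le_const fun s hs => ?_
    rw [uIoc_of_le zero_le_one] at hs
    exact hdiff s ⟨hs.1.le, hs.2⟩
  rw [intervalIntegral.integral_sub (hcont.intervalIntegrable _ _) (by simp), hI,
    intervalIntegral.integral_const] at h1
  have h2 := hshift ζ hζ 1 (by simp)
  simp only [sub_zero, one_smul, abs_one, mul_one] at h1
  rw [ofReal_one] at h2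
  have h3 := norm_sub_norm_le (F ζ) (F ζ - (Φ (ζ + 1) - Φ ζ))
  rw [sub_sub_cancel, norm_sub_rev (F ζ)] at h3
  linarith

/-- Approximation of Hardy functions by decaying functions. -/
theorem exists_decays_approx (hF : DifferentiableOn ℂ F {x | 0 < x.im})
    (hK : ∀ y : ℝ, 0 < y → eLpNorm (fun x : ℝ => F (x + y * I)) 2 ≤ K)
    (hw : ∀ᵐ x : ℝ, Tendsto (fun y : ℝ => F (x + y * I)) (𝓝[>] 0) (𝓝 (w x))) :
    ∃ H : ℕ → ℂ → ℂ, (∀ n, Decays (H n)) ∧ (∀ n, eLpNorm (fun x : ℝ => H n x) 2 ≤ K) ∧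
      (∀ᵐ x : ℝ, Tendsto (fun n => H n x) atTop (𝓝 (w x))) ∧
      ∀ ζ : ℂ, 0 < ζ.im → Tendsto (fun n => H n ζ) atTop (𝓝 (F ζ)) := by
  set η : ℕ → ℝ := fun n => 1 / ((n : ℝ) + 1) with hη
  have hη0 : ∀ n, 0 < η n := fun n => by positivity
  have hη1 : Tendsto η atTop (𝓝 0) := tendsto_one_div_add_atTop_nhds_zero_nat
  have hη2 : Tendsto η atTop (𝓝[>] 0) :=
    tendsto_nhdsWithin_iff.mpr ⟨hη1, Eventually.of_forall hη0⟩
  have hη3 : Tendsto (fun n => (η n : ℂ)) atTop (𝓝 0) := by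
    simpa [Function.comp_def] using (continuous_ofReal.tendsto 0).comp hη1
  have hden : ∀ n (x : ℂ), 0 ≤ x.im → 1 ≤ ‖(η n : ℂ) * x + I‖ := fun n x hx => by
    refine le_trans ?_ ((le_abs_self _).trans (abs_im_le_norm _))
    have : 0 ≤ η n * x.im := mul_nonneg (hη0 n).le hx
    simpa using this
  have hden0 : ∀ n (x : ℂ), 0 ≤ x.im → (η n : ℂ) * x + I ≠ 0 := fun n x hx =>
    norm_pos_iff.mp (one_pos.trans_le (hden n x hx))
  have hk : ∀ x : ℂ, Tendsto (fun n => I / ((η n : ℂ) * x + I)) atTop (𝓝 1) := fun x => by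
    have h := (hη3.mul_const x).add_const I
    rw [zero_mul, zero_add] at h
    have := (tendsto_const_nhds (x := I)).div h I_ne_zero
    rwa [div_self I_ne_zero] at this
  have him : ∀ n (x : ℂ), 0 ≤ x.im → 0 < (x + η n * I).im := fun n x hx => by
    have := hη0 n
    simp only [add_im, mul_im, ofReal_re, I_im, ofReal_im, I_re, mul_one, mul_zero, add_zero]
    linarith
  -- The shift by `ηi` makes `F` holomorphic and bounded on the closed half-plane. The factor `i/(ηx
  -- + i)` has modulus at most 1 there, supplies the decay `1/x`, and tends to 1 as `η → 0`.
  refine ⟨fun n x => F (x + η n * I) * (I / (η n * x + I)), fun n => ⟨fun x hx => ?_, ?_⟩,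
    fun n => ?_, ?_, fun ζ hζ => ?_⟩
  · have hU := isComb_upper.isOpen.mem_nhds (him n x hx)
    have h1 : DifferentiableAt ℂ (fun x => F (x + η n * I)) x :=
      (HasDerivAt.comp_add_const x (η n * I) (hF.differentiableAt hU).hasDerivAt).differentiableAt
    exact h1.mul ((differentiableAt_const I).div (by fun_prop) (hden0 n x hx))
  · have h1 : (fun x => F (x + η n * I)) =O[upperInfty] fun _ => (1 : ℂ) := by
      refine Asymptotics.IsBigO.of_bound (K + 2 * K / η n) (Filter.Eventually.filter_mono inf_le_right ?_)
      refine eventually_principal.mpr fun x hx => ?_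
      refine (norm_le_of_hardy hF hK (him n x hx)).trans ?_
      have hx : 0 ≤ x.im := hx
      have : η n ≤ (x + η n * I).im := by simpa using hx
      have := hη0 n
      have := K.2
      rw [norm_one, mul_one]
      gcongr
    have h2 : (fun x => I / (η n * x + I)) =O[upperInfty] fun x => x⁻¹ := by
      refine ((isBigO_inv_sub_upperInfty (-(I / η n))).const_mul_left (I / η n)).congr_left
        fun x => ?_
      have : (η n : ℂ) ≠ 0 := by exact_mod_cast (hη0 n).ne'
      rw [sub_neg_eq_add, ← div_eq_mul_inv, div_div]
      congr 1
      field_simp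
    simpa using h1.mul h2
  · refine (eLpNorm_mono fun x => ?_).trans (hK (η n) (hη0 n))
    rw [norm_mul, norm_div, norm_I]
    refine mul_le_of_le_one_right (norm_nonneg _) ?_
    exact div_le_one_of_le₀ (hden n x (by simp)) (norm_nonneg _)
  · filter_upwards [hw] with x hx
    simpa using (hx.comp hη2).mul (hk x)
  · have h1 : Tendsto (fun n => ζ + η n * I) atTop (𝓝 ζ) := by
      simpa using (hη3.mul_const I).const_add ζ
    have h2 := (hF.differentiableAt (isComb_upper.isOpen.mem_nhds hζ)).continuousAt.tendsto.comp h1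
    simpa using h2.mul (hk ζ)

theorem memLp_inv_sub {ζ : ℂ} (hζ : ζ.im ≠ 0) : MemLp (fun x : ℝ => ((x : ℂ) - ζ)⁻¹) 2 := by
  have hc : Continuous fun x : ℝ => ((x : ℂ) - ζ)⁻¹ :=
    Continuous.inv₀ (by fun_prop) fun x h => hζ (by rw [← sub_eq_zero.mp h, ofReal_im])
  rw [memLp_two_iff_integrable_sq_norm hc.aestronglyMeasurable]
  have := integrable_ofReal_of_isBigO (G := fun x => (x - ζ)⁻¹ * (x - ζ)⁻¹) (hc.mul hc)
    (isBigO_pow_two_of_mul (isBigO_inv_sub_upperInfty ζ) (isBigO_inv_sub_upperInfty ζ))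
  refine this.norm.congr (ae_of_all _ fun x => ?_)
  simp [sq]

/-- The Cauchy formula for the boundary values of a Hardy function. -/
theorem hardy_cauchy (hF : DifferentiableOn ℂ F {x | 0 < x.im})
    (hK : ∀ y : ℝ, 0 < y → eLpNorm (fun x : ℝ => F (x + y * I)) 2 ≤ K)
    (hw : ∀ᵐ x : ℝ, Tendsto (fun y : ℝ => F (x + y * I)) (𝓝[>] 0) (𝓝 (w x))) :
    MemLp w 2 ∧
    (∀ ζ : ℂ, 0 < ζ.im → ∫ x : ℝ, w x / (x - ζ) = 2 * Real.pi * I * F ζ) ∧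
    ∀ ζ : ℂ, ζ.im < 0 → ∫ x : ℝ, w x / (x - ζ) = 0 := by
  obtain ⟨H, hH, hHK, hHw, hHF⟩ := exists_decays_approx hF hK hw
  have hm := fun n => (hH n).continuous.aestronglyMeasurable (μ := volume)
  have hlim := fun (ζ : ℂ) (hζ : ζ.im ≠ 0) =>
    tendsto_integral_mul_of_bounded hm hHK hHw (memLp_inv_sub hζ)
  simp only [← div_eq_mul_inv] at hlim
  refine ⟨memLp_of_tendsto_of_bounded hm hHK hHw, fun ζ hζ => ?_, fun ζ hζ => ?_⟩
  · refine tendsto_nhds_unique (hlim ζ hζ.ne') ?_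
    simp_rw [integral_div_sub_of_im_pos (hH _).differentiableAt (hH _).isBigO hζ]
    exact (hHF ζ hζ).const_mul _
  · refine tendsto_nhds_unique (hlim ζ hζ.ne) ?_
    simp_rw [integral_div_sub_of_im_neg (hH _).differentiableAt (hH _).isBigO hζ]
    exact tendsto_const_nhds

end Hardy

end

end BenjaminOno

namespace BenjaminOno
open Complex Set Filter MeasureTheory

noncomputable section

variable {P : ℕ} {ε : ℝ} {c z : Fin P → ℂ} {m : Fin P}

/-! ### Eigenfunctions give kernel vectors -/

/-- The derivative agrees almost everywhere with a continuous function, hence is integrable, and `w`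
is the integral of that function. This upgrades an equation obtained from boundary values, known
only almost everywhere, to every point. -/
theorem hasDerivAt_of_ae_deriv_eq {w g : ℝ → ℂ} (hw : Differentiable ℝ w) (hg : Continuous g)
    (h : ∀ᵐ x, deriv w x = g x) (x : ℝ) : HasDerivAt w (g x) x := by
  have hi : ∀ a b, IntervalIntegrable (deriv w) volume a b := fun a b =>
    (hg.intervalIntegrable a b).congr_ae (ae_restrict_of_ae (h.mono fun _ hx => hx.symm))
  have e : w = fun x => w 0 + ∫ t in (0 : ℝ)..x, g t := by
    ext x
    have h1 := intervalIntegral.integral_eq_sub_of_hasDerivAt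
      (fun t _ => (hw t).hasDerivAt) (hi 0 x)
    rw [← intervalIntegral.integral_congr_ae (h.mono fun t ht _ => ht), h1]
    ring
  rw [e]
  simpa using (hg.integral_hasStrictDerivAt 0 x).hasDerivAt.const_add (w 0)

section Cauchy

variable {w : ℝ → ℂ} {F : ℂ → ℂ}

theorem integrable_div_sub_of_memLp (hw : MemLp w 2) {ζ : ℂ} (hζ : ζ.im ≠ 0) :
    Integrable fun x : ℝ => w x / (x - ζ) := by
  simp only [div_eq_mul_inv]
  exact hw.integrable_mul (memLp_inv_sub hζ)

theorem abs_im_le_norm_sub (ζ : ℂ) (x : ℝ) : |ζ.im| ≤ ‖(x : ℂ) - ζ‖ := by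
  simpa using abs_im_le_norm ((x : ℂ) - ζ)

theorem ofReal_sub_ne_zero {ζ : ℂ} (hζ : ζ.im ≠ 0) (x : ℝ) : (x : ℂ) - ζ ≠ 0 :=
  norm_pos_iff.mp ((abs_pos.mpr hζ).trans_le (abs_im_le_norm_sub ζ x))

theorem hasDerivAt_cauchyIntegral (hw : MemLp w 2) {ζ : ℂ} (hζ : 0 < ζ.im) :
    (Integrable fun x : ℝ => w x / (x - ζ) ^ 2) ∧
      HasDerivAt (fun ζ : ℂ => ∫ x : ℝ, w x / (x - ζ)) (∫ x : ℝ, w x / (x - ζ) ^ 2) ζ := by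
  have hball : ∀ ξ ∈ Metric.ball ζ (ζ.im / 2), ζ.im / 2 < ξ.im ∧ ∀ x : ℝ,
      ‖(x : ℂ) - ζ‖ / 2 ≤ ‖(x : ℂ) - ξ‖ := by
    intro ξ hξ
    have h1 : ‖ξ - ζ‖ < ζ.im / 2 := by simpa [dist_eq_norm] using hξ
    have h2 := (abs_lt.mp ((abs_im_le_norm (ξ - ζ)).trans_lt h1)).1
    rw [sub_im] at h2
    refine ⟨by linarith, fun x => ?_⟩
    have h3 := abs_im_le_norm_sub ζ x
    rw [abs_of_pos hζ] at h3
    have h4 := norm_sub_le_norm_sub_add_norm_sub (x : ℂ) ξ ζ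
    linarith
  have hb : Integrable fun x : ℝ => 4 * (ζ.im)⁻¹ * ‖w x / (x - ζ)‖ :=
    (integrable_div_sub_of_memLp hw hζ.ne').norm.const_mul _
  refine hasDerivAt_integral_of_dominated_loc_of_deriv_le
    (F := fun ξ (x : ℝ) => w x / (x - ξ)) (F' := fun ξ (x : ℝ) => w x / (x - ξ) ^ 2)
    (Metric.ball_mem_nhds ζ (half_pos hζ)) ?_ (integrable_div_sub_of_memLp hw hζ.ne') ?_
    (ae_of_all _ fun x ξ hξ => ?_) hb (ae_of_all _ fun x ξ hξ => ?_)
  · filter_upwards [Metric.ball_mem_nhds ζ (half_pos hζ)] with ξ hξ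
    exact (integrable_div_sub_of_memLp hw (by linarith [(hball ξ hξ).1] : (0 : ℝ) < ξ.im).ne').1
  · refine AEStronglyMeasurable.congr (((integrable_div_sub_of_memLp hw hζ.ne').1.mul
      (memLp_inv_sub hζ.ne').1)) (ae_of_all _ fun x => ?_)
    have := ofReal_sub_ne_zero hζ.ne' x
    simp only [Pi.mul_apply]
    field_simp
  · obtain ⟨h1, h2⟩ := hball ξ hξ
    have h3 := abs_im_le_norm_sub ζ x
    rw [abs_of_pos hζ] at h3
    have h4 := h2 x
    have h5 : 0 < ‖(x : ℂ) - ζ‖ := hζ.trans_le h3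
    rw [norm_div, norm_div, norm_pow]
    calc ‖w x‖ / ‖(x : ℂ) - ξ‖ ^ 2 ≤ ‖w x‖ / (‖(x : ℂ) - ζ‖ / 2) ^ 2 := by gcongr
      _ = 4 * ‖(x : ℂ) - ζ‖⁻¹ * (‖w x‖ / ‖(x : ℂ) - ζ‖) := by field_simp; ring
      _ ≤ 4 * (ζ.im)⁻¹ * (‖w x‖ / ‖(x : ℂ) - ζ‖) := by gcongr
  · have h0 := ofReal_sub_ne_zero (by linarith [(hball ξ hξ).1] : (0 : ℝ) < ξ.im).ne' x
    refine ((hasDerivAt_const ξ (w x)).div ((hasDerivAt_id ξ).const_sub (x : ℂ)) h0).congr_deriv ?_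
    simp

/-- The Cauchy integral of the product of a Hardy function and the potential. -/
theorem cauchy_upot_mul (hz : ∀ p, 0 < (z p).im) (hw : MemLp w 2)
    (h₁ : ∀ ζ : ℂ, 0 < ζ.im → ∫ x : ℝ, w x / (x - ζ) = 2 * Real.pi * I * F ζ)
    (h₂ : ∀ ζ : ℂ, ζ.im < 0 → ∫ x : ℝ, w x / (x - ζ) = 0) {ζ : ℂ} (hζ : 0 < ζ.im)
    (hζp : ζ ∉ poles z) :
    (Integrable fun x : ℝ => upot c z x * w x / (x - ζ)) ∧
      ∫ x : ℝ, upot c z x * w x / (x - ζ)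
        = 2 * Real.pi * I * (upot c z ζ * F ζ - rat z 0 (fun p => c p * F (z p)) 0 ζ) := by
  have hz' : ∀ p, (conj (z p)).im < 0 := fun p => by simpa using hz p
  have i0 := integrable_div_sub_of_memLp hw hζ.ne'
  have i1 := fun p => integrable_div_sub_of_memLp hw (hz p).ne'
  have i2 := fun p => integrable_div_sub_of_memLp hw (hz' p).ne
  have j1 : ∀ p, Integrable fun x : ℝ => c p / (ζ - z p) * (w x / (x - ζ) - w x / (x - z p)) :=
    fun p => (i0.sub (i1 p)).const_mul _
  have j2 : ∀ p, Integrable fun x : ℝ =>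
      conj (c p) / (ζ - conj (z p)) * (w x / (x - ζ) - w x / (x - conj (z p))) :=
    fun p => (i0.sub (i2 p)).const_mul _
  have j3 : ∀ p, Integrable fun x : ℝ => c p / (ζ - z p) * (w x / (x - ζ) - w x / (x - z p))
      + conj (c p) / (ζ - conj (z p)) * (w x / (x - ζ) - w x / (x - conj (z p))) :=
    fun p => (j1 p).add (j2 p)
  have e : ∀ x : ℝ, upot c z x * w x / (x - ζ)
      = ∑ p, (c p / (ζ - z p) * (w x / (x - ζ) - w x / (x - z p))
      + conj (c p) / (ζ - conj (z p)) * (w x / (x - ζ) - w x / (x - conj (z p)))) := by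
    intro x
    simp only [upot, rat, zero_add, Finset.sum_mul, Finset.sum_div]
    refine Finset.sum_congr rfl fun p _ => ?_
    have a1 := ofReal_sub_ne_zero hζ.ne' x
    have a2 := ofReal_sub_ne_zero (hz p).ne' x
    have a3 := ofReal_sub_ne_zero (hz' p).ne x
    obtain ⟨a4, a5⟩ := sub_ne_zero_of_notMem_poles hζp p
    field_simp
    ring
  simp_rw [e]
  refine ⟨integrable_finsetSum _ fun p _ => j3 p, ?_⟩
  rw [integral_finsetSum _ fun p _ => j3 p]
  simp only [upot, rat, zero_add, Finset.sum_mul, Pi.zero_apply, zero_div, add_zero,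
    ← Finset.sum_sub_distrib, Finset.mul_sum]
  refine Finset.sum_congr rfl fun p _ => ?_
  obtain ⟨a4, a5⟩ := sub_ne_zero_of_notMem_poles hζp p
  rw [integral_add (j1 p) (j2 p), integral_const_mul, integral_const_mul,
    integral_sub i0 (i1 p), integral_sub i0 (i2 p), h₁ ζ hζ, h₁ _ (hz p), h₂ _ (hz' p)]
  field_simp
  ring

end Cauchy

/-- The derivative of an eigenfunction. -/
theorem hasDerivAt_of_hasCauchyPlus (hε : 0 < ε) (hz : ∀ p, 0 < (z p).im) {lam : ℝ}
    {w : ℝ → ℂ} {F : ℂ → ℂ} (hw : MemLp w 2)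
    (hF : ∀ᵐ x : ℝ, Tendsto (fun y : ℝ => F (x + y * I)) (𝓝[>] 0) (𝓝 (w x)))
    (h₁ : ∀ ζ : ℂ, 0 < ζ.im → ∫ x : ℝ, w x / (x - ζ) = 2 * Real.pi * I * F ζ)
    (h₂ : ∀ ζ : ℂ, ζ.im < 0 → ∫ x : ℝ, w x / (x - ζ) = 0) (hd : Differentiable ℝ w)
    (h : ∀ x : ℝ, HasCauchyPlus (fun y => potential c z y * w y) x
      (-(I * ε * deriv w x + lam * w x))) (x : ℝ) :
    HasDerivAt w ((rat z 0 (fun p => c p * F (z p)) 0 x - (lam + upot c z x) * w x) / (I * ε))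
      x := by
  have hε' : (ε : ℂ) ≠ 0 := by exact_mod_cast hε.ne'
  have hI := I_ne_zero
  have hpi : (Real.pi : ℂ) ≠ 0 := by exact_mod_cast Real.pi_ne_zero
  have hcr : ∀ α β : Fin P → ℂ, Continuous fun x : ℝ => rat z 0 α β x := fun α β =>
    continuous_iff_continuousAt.mpr fun x =>
      (differentiableAt_rat 0 α β (ofReal_notMem_poles hz x)).continuousAt.comp
        (f := fun x : ℝ => (x : ℂ)) (by fun_prop)
  refine hasDerivAt_of_ae_deriv_eq (g := fun x : ℝ =>
    (rat z 0 (fun p => c p * F (z p)) 0 x - (lam + upot c z x) * w x) / (I * ε)) hd ?_ ?_ x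
  · exact ((hcr _ _).sub ((continuous_const.add (hcr _ _)).mul hd.continuous)).div_const _
  filter_upwards [hF] with x hx
  have hγ : Tendsto (fun y : ℝ => (x : ℂ) + y * I) (𝓝[>] 0) (𝓝 (x : ℂ)) := by
    have : Continuous fun y : ℝ => (x : ℂ) + y * I := by fun_prop
    simpa using (this.tendsto 0).mono_left nhdsWithin_le_nhds
  have hr : ∀ α β : Fin P → ℂ, Tendsto (fun y : ℝ => rat z 0 α β (x + y * I)) (𝓝[>] 0)
      (𝓝 (rat z 0 α β x)) := fun α β =>
    (differentiableAt_rat 0 α β (ofReal_notMem_poles hz x)).continuousAt.tendsto.comp hγ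
  have hlim := ((hr c fun p => conj (c p)).mul hx).sub (hr (fun p => c p * F (z p)) 0)
  have hsmall : ∀ᶠ y : ℝ in 𝓝[>] 0, ∀ p, y < (z p).im := eventually_all.mpr fun p =>
    mem_nhdsWithin_of_mem_nhds (Iio_mem_nhds (hz p))
  -- By `cauchy_upot_mul` the Cauchy integral at `x + iy` is `uF - R` there, and its boundary value
  -- is `u w - R`. Comparison with the limit prescribed by the spectral problem is the differential
  -- equation.
  have key := tendsto_nhds_unique ((h x).congr' ?_) hlim
  · change _ = upot c z x * w x - rat z 0 (fun p => c p * F (z p)) 0 x at key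
    field_simp
    linear_combination -key
  filter_upwards [hsmall, self_mem_nhdsWithin] with y hy hy0
  have hy0 : 0 < y := hy0
  have hζ : 0 < ((x : ℂ) + y * I).im := by simpa using hy0
  have hζp : (x : ℂ) + y * I ∉ poles z := by
    rintro ⟨p, hp | hp⟩
    · have := congrArg Complex.im hp
      simp at this
      linarith [hy p]
    · have := congrArg Complex.im hp
      simp at this
      linarith [hz p]
  simp only [potential_eq_upot]
  rw [(cauchy_upot_mul hz hw h₁ h₂ hζ hζp).2]
  simp only [upot]
  field_simp

/-- An eigenfunction solves the differential equation in the upper half-plane. -/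
theorem solvesAt_of_hardy (hε : 0 < ε) (hz : ∀ p, 0 < (z p).im) {lam : ℝ}
    {w : ℝ → ℂ} {F : ℂ → ℂ} (hw : MemLp w 2)
    (h₁ : ∀ ζ : ℂ, 0 < ζ.im → ∫ x : ℝ, w x / (x - ζ) = 2 * Real.pi * I * F ζ)
    (h₂ : ∀ ζ : ℂ, ζ.im < 0 → ∫ x : ℝ, w x / (x - ζ) = 0)
    (hd : ∀ x : ℝ, HasDerivAt w
      ((rat z 0 (fun p => c p * F (z p)) 0 x - (lam + upot c z x) * w x) / (I * ε)) x)
    {ζ : ℂ} (hζ : 0 < ζ.im) (hζp : ζ ∉ poles z) :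
    SolvesAt ε c z lam (rat z 0 (fun p => c p * F (z p)) 0) F ζ := by
  have hε' : (ε : ℂ) ≠ 0 := by exact_mod_cast hε.ne'
  have hI := I_ne_zero
  have hpi : (Real.pi : ℂ) ≠ 0 := by exact_mod_cast Real.pi_ne_zero
  set R := rat z 0 (fun p => c p * F (z p)) 0 with hR
  obtain ⟨hi, hD⟩ := hasDerivAt_cauchyIntegral hw hζ
  obtain ⟨iu, hu⟩ := cauchy_upot_mul (c := c) hz hw h₁ h₂ hζ hζp
  obtain ⟨ir, hr⟩ := integral_rat_div_sub hz (fun p => c p * F (z p)) hζ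
  have iw := integrable_div_sub_of_memLp hw hζ.ne'
  have e : ∀ x : ℝ, (R x - (lam + upot c z x) * w x) / (I * ε) / (x - ζ)
      = (I * ε)⁻¹ * (R x / (x - ζ) - (lam * (w x / (x - ζ)) + upot c z x * w x / (x - ζ))) :=
    fun x => by ring
  have ilu : Integrable fun x : ℝ => lam * (w x / (x - ζ)) + upot c z x * w x / (x - ζ) :=
    (iw.const_mul _).add iu
  have ig : Integrable fun x : ℝ => (R x - (lam + upot c z x) * w x) / (I * ε) / (x - ζ) := by
    simp_rw [e]
    exact (ir.sub ilu).const_mul _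
  -- Integration by parts: the Cauchy integral of `w'` equals the integral of `w/(x - ζ)²`, the
  -- derivative of the Cauchy integral of `w`. So the equation on the line becomes the equation for
  -- `F` at `ζ`.
  have hparts := integral_eq_zero_of_hasDerivAt_of_integrable (f := fun x : ℝ => w x / (x - ζ))
    (f' := fun x : ℝ => (R x - (lam + upot c z x) * w x) / (I * ε) / (x - ζ)
      - w x / (x - ζ) ^ 2) (fun x => ?_) (ig.sub hi) iw
  · rw [integral_sub ig hi] at hparts
    simp_rw [e] at hparts
    rw [integral_const_mul, integral_sub ir ilu, integral_add (iw.const_mul _) iu,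
      integral_const_mul, hr, hu, h₁ ζ hζ] at hparts
    have hF : F =ᶠ[𝓝 ζ] fun ζ : ℂ => (2 * Real.pi * I)⁻¹ * ∫ x : ℝ, w x / (x - ζ) := by
      filter_upwards [isComb_upper.isOpen.mem_nhds hζ] with ξ hξ
      rw [h₁ ξ hξ]
      field_simp
    refine ((hD.const_mul (2 * Real.pi * I)⁻¹).congr_of_eventuallyEq hF).congr_deriv ?_
    rw [← sub_eq_zero.mp hparts]
    field_simp
    ring
  · have h0 := ofReal_sub_ne_zero hζ.ne' x
    have h1 : HasDerivAt (fun x : ℝ => (x : ℂ) - ζ) 1 x := (hasDerivAt_real x).sub_const ζ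
    refine ((hd x).div h1 h0).congr_deriv ?_
    field_simp

/-- With `lam` and the potential real, `|w|²` is constant; a constant that is integrable over the
line vanishes. -/
theorem eq_zero_of_homogeneous {lam : ℝ} {w : ℝ → ℂ} (hw : MemLp w 2)
    (hd : ∀ x : ℝ, HasDerivAt w ((0 - (lam + upot c z x) * w x) / (I * ε)) x) : w = 0 := by
  have hN : ∀ x, HasDerivAt (fun x => w x * conj (w x)) 0 x := fun x => by
    refine ((hd x).mul (hd x).star).congr_deriv ?_
    simp only [star_def, map_div₀, map_sub, map_mul, map_add, map_zero, conj_I, conj_ofReal,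
      conj_upot_ofReal]
    rw [neg_mul, div_neg]
    ring
  have hconst : ∀ x, w x * conj (w x) = w 0 * conj (w 0) := fun x =>
    is_const_of_deriv_eq_zero (fun x => (hN x).differentiableAt) (fun x => (hN x).deriv) x 0
  have hnorm : ∀ x, ‖w x‖ ^ 2 = ‖w 0‖ ^ 2 := fun x => by
    have := hconst x
    rw [mul_conj', mul_conj'] at this
    exact_mod_cast this
  have hi := (memLp_two_iff_integrable_sq_norm hw.1).mp hw
  simp_rw [hnorm] at hi
  have h0 : ‖w 0‖ ^ 2 = 0 := by
    rcases integrable_const_iff.mp hi with h | h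
    · exact h
    · exact absurd (isFiniteMeasure_iff _ |>.mp h) (by simp)
  ext x
  have := hnorm x
  rw [h0] at this
  simpa using this

theorem exists_small_height (hz : ∀ p, 0 < (z p).im) : ∃ y : ℝ, 0 < y ∧ ∀ p, y < (z p).im := by
  have h : ∀ᶠ y : ℝ in 𝓝[>] 0, 0 < y ∧ ∀ p, y < (z p).im := by
    refine Eventually.and self_mem_nhdsWithin (eventually_all.mpr fun p => ?_)
    exact mem_nhdsWithin_of_mem_nhds (Iio_mem_nhds (hz p))
  exact h.exists

/-- A solution in the upper half-plane that is bounded above the poles annihilates the contour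
functionals. -/
theorem sysInt_eq_zero_of_solvesAt (hε : 0 < ε) (hz : ∀ p, 0 < (z p).im)
    (hre : StrictMono fun p => (z p).re) {lam : ℂ} (hlam : lam ∈ cutPlane) {α β : Fin P → ℂ}
    {F : ℂ → ℂ} (hF : ∀ x : ℂ, 0 < x.im → DifferentiableAt ℂ F x)
    (hs : ∀ x : ℂ, 0 < x.im → x ∉ poles z → SolvesAt ε c z lam (rat z 0 α β) F x)
    {B : ℝ} (hB : ∀ x ∈ highDom z, ‖F x‖ ≤ B) (m : Fin P) :
    sysInt ε c z m (rat z 0 α β) lam = 0 := by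
  set R := rat z 0 α β with hR
  set E := expo ε lam (antideriv c z) with hE
  obtain ⟨a₀, ha₀, hleft⟩ := exists_base_abscissa hre
  have hh := height_pos hz
  have hhigh : ∀ x ∈ highDom z, 0 < x.im := fun x hx => by
    have h1 : height z - 1 / 2 < x.im := hx
    have h2 : 1 ≤ height z := by
      unfold height
      linarith [Finset.sum_nonneg (s := Finset.univ) fun p _ => (hz p).le]
    linarith
  have hU : ∀ x ∈ highDom z, F x = upSol ε c z R lam x := fun x hx =>
    SolvesAt.eq_upSol hε hz hlam (fun x hx => hs x (hhigh x hx)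
      (notMem_poles_of_vDom hz (highDom_subset_vDom hz hx))) hB hx
  have hmem : ∀ a : ℝ, (a : ℂ) + height z * I ∈ highDom z := fun a => by simp [highDom]
  obtain ⟨Q, hQ0, hQ⟩ := (isComb_dDom hz).exists_primitive
    (g := fun x => E x * R x / (I * ε))
    (fun x hx => ((differentiableAt_expo_antideriv_mul_rat (c := c) hε lam 0 α β
      hx).div_const _).differentiableWithinAt) (a₀ + height z * I)
    (E (a₀ + height z * I) * F (a₀ + height z * I))
  obtain ⟨y, hy0, hy⟩ := exists_small_height hz
  -- The equation for `F` is known only in the open upper half-plane, so the primitive `Q` is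
  -- compared with `E * F` on the upper part of `dDom`. A horizontal line below all the `z p`
  -- connects it.
  have hcomb : IsComb (dDom z ∩ {x | 0 < x.im}) y :=
    { isOpen := isOpen_dDom.inter isComb_upper.isOpen
      line := fun s => ⟨fun p _ => by simpa using ⟨by linarith [hz p], hy p⟩, by simpa using hy0⟩
      vert := fun x hx t ht => by
        obtain ⟨h1, h2⟩ := hx
        have h2 : 0 < x.im := h2
        have ht0 : 0 < t := lt_of_lt_of_le (lt_min hy0 h2) ht.1
        refine ⟨fun p hp => ?_, by simpa using ht0⟩
        have h3 := h1 p (by simpa using hp)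
        have h4 : t < (z p).im := lt_of_le_of_lt ht.2 (max_lt (hy p) h3.2)
        simpa using ⟨by linarith [hz p], h4⟩ }
  have hEF : ∀ x ∈ dDom z ∩ {x | 0 < x.im}, Q x = E x * F x := by
    refine eqOn_of_hasDerivAt_eq hcomb.isOpen hcomb.isPreconnected (fun x hx => hQ x hx.1)
      (fun x hx => (hs x hx.2 (notMem_poles_of_dDom hx.1)).expo_mul hε
        (hasDerivAt_antideriv hx.1))
      (x₀ := a₀ + height z * I) ⟨mem_dDom_vert (fun p => (ha₀ p).ne) _, by simpa using hh⟩ hQ0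
  have hQleft : Q (leftAbscissa z m + height z * I)
      = E (leftAbscissa z m + height z * I) * upSol ε c z R lam (leftAbscissa z m + height z * I) := by
    rw [hleft m, hQ0, hU _ (hmem _)]
  by_cases hm : HasZeroAt ε c m
  · have hl : Tendsto (fun t : ℝ => Q ((z m).re + t * I)) (𝓝[<] (z m).im) (𝓝 0) := by
      have h1 := tendsto_expo_pole (c := c) hz hre hm lam
      have hγ : Tendsto (fun t : ℝ => ((z m).re : ℂ) + t * I) (𝓝[<] (z m).im) (𝓝 (z m)) := by
        have : Continuous fun t : ℝ => ((z m).re : ℂ) + t * I := by fun_prop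
        simpa using (this.tendsto (z m).im).mono_left nhdsWithin_le_nhds
      have h2 := h1.mul ((hF _ (hz m)).continuousAt.tendsto.comp hγ)
      rw [zero_mul] at h2
      refine h2.congr' ?_
      filter_upwards [self_mem_nhdsWithin, mem_nhdsWithin_of_mem_nhds (lt_mem_nhds (hz m))]
        with t ht ht0
      exact (hEF _ ⟨mem_dDom_vert_pole hre (by linarith [hz m]) ht, by simpa using ht0⟩).symm
    rw [sysInt_eq_of_primitive_pole hε hz hre hm hQ hQleft hl, mul_zero]
  · rw [sysInt_eq_of_primitive hε hz hre hm hQ hQleft,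
      hEF _ ⟨mem_dDom_vert (rightAbscissa_ne hre m) _, by simpa using hh⟩, hU _ (hmem _), sub_self,
      mul_zero]

/-- The kernel vector is `φ_p = c_p F(z_p)` for the Hardy extension `F` of the eigenfunction. If it
vanished, the eigenfunction would solve the homogeneous equation on the line and be zero; the
contour functionals vanish because `F` is bounded above the poles. -/
theorem exists_kernel_of_isEigenvalue (hε : 0 < ε) (hz : ∀ p, 0 < (z p).im)
    (hre : StrictMono fun p => (z p).re) {lam : ℝ} (h : IsEigenvalue ε (potential c z) lam) :
    ∃ φ : Fin P → ℂ, φ ≠ 0 ∧ ∀ m, sysInt ε c z m (rat z 0 φ 0) lam = 0 := by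
  obtain ⟨hlam, w, hw0, ⟨F, hF, ⟨K, hK⟩, hFw⟩, hwd, hC⟩ := h
  obtain ⟨hw, h₁, h₂⟩ := hardy_cauchy hF hK hFw
  have hd := hasDerivAt_of_hasCauchyPlus hε hz hw hFw h₁ h₂ hwd hC
  have hs := fun ζ hζ hζp => solvesAt_of_hardy (ζ := ζ) hε hz hw h₁ h₂ hd hζ hζp
  refine ⟨fun p => c p * F (z p), fun h0 => hw0 ?_, ?_⟩
  · refine eq_zero_of_homogeneous (ε := ε) (c := c) (z := z) (lam := lam) hw fun x => ?_
    have := hd x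
    rw [h0] at this
    simpa [rat] using this
  · refine sysInt_eq_zero_of_solvesAt (B := K + 2 * K / (1 / 2)) hε hz hre (neg_mem_cutPlane hlam)
      (fun x hx => hF.differentiableAt (isComb_upper.isOpen.mem_nhds hx)) hs fun x hx => ?_
    have h1 : height z - 1 / 2 < x.im := hx
    have h2 : 1 ≤ height z := by
      unfold height
      linarith [Finset.sum_nonneg (s := Finset.univ) fun p _ => (hz p).le]
    have h3 : 1 / 2 ≤ x.im := by linarith
    refine (norm_le_of_hardy hF hK (by linarith)).trans ?_
    have := K.2
    gcongr

end

end BenjaminOno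

namespace BenjaminOno
open Complex Set Filter MeasureTheory

noncomputable section

variable {P : ℕ} {ε : ℝ} {c z : Fin P → ℂ} {m : Fin P}

/-! ### Linear systems with analytic coefficients -/

theorem analyticAt_det {M : ℂ → Matrix (Fin P) (Fin P) ℂ} {x : ℂ}
    (h : ∀ i j, AnalyticAt ℂ (fun y => M y i j) x) : AnalyticAt ℂ (fun y => (M y).det) x := by
  simp only [Matrix.det_apply']
  exact Finset.analyticAt_fun_sum _ fun σ _ => analyticAt_const.mul
    (Finset.analyticAt_fun_prod _ fun i _ => h _ _)

/-- Cramer's rule for analytic systems. -/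
theorem exists_analyticAt_det_smul {A : ℂ → Matrix (Fin P) (Fin P) ℂ} {b : ℂ → Fin P → ℂ} {x : ℂ}
    (hA : ∀ i j, AnalyticAt ℂ (fun y => A y i j) x) (hb : ∀ i, AnalyticAt ℂ (fun y => b y i) x) :
    ∃ g : ℂ → Fin P → ℂ, AnalyticAt ℂ g x ∧
      ∀ y v, (A y).det ≠ 0 → A y *ᵥ v = b y → v = (A y).det⁻¹ • g y := by
  refine ⟨fun y => (A y).adjugate *ᵥ b y, ?_, fun y v hdet hv => ?_⟩
  · refine analyticAt_pi_iff.mpr fun i => ?_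
    simp only [Matrix.mulVec, dotProduct]
    refine Finset.analyticAt_fun_sum _ fun j _ => AnalyticAt.mul ?_ (hb j)
    simp only [Matrix.adjugate_apply]
    refine analyticAt_det fun k l => ?_
    by_cases hk : k = j
    · subst hk
      simpa [Matrix.updateRow_self] using analyticAt_const
    · simpa [Matrix.updateRow_ne hk] using hA k l
  · change v = (A y).det⁻¹ • ((A y).adjugate *ᵥ b y)
    rw [← hv, Matrix.mulVec_mulVec, Matrix.adjugate_mul, Matrix.smul_mulVec, Matrix.one_mulVec,
      inv_smul_smul₀ hdet]

/-- The product rule with the special form of `A'`: a multiple of `b` whose factor is the sum of the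
entries, plus `A` applied to `g' - (i/ε) diag(z) g`. -/
theorem hasDerivAt_mulVec {A : ℂ → Matrix (Fin P) (Fin P) ℂ} {b g : ℂ → Fin P → ℂ} {l : ℂ}
    {q : Fin P}
    (hA : ∀ p, HasDerivAt (fun y => A y q p) (I / (ε * l) * b l q - I / ε * (A l q p * z p)) l)
    {g' : Fin P → ℂ} (hg : ∀ p, HasDerivAt (fun y => g y p) (g' p) l) :
    HasDerivAt (fun y => (A y *ᵥ g y) q)
      (I / (ε * l) * b l q * ∑ p, g l p + (A l *ᵥ fun p => g' p - I / ε * (z p * g l p)) q) l := by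
  simp only [Matrix.mulVec, dotProduct]
  refine (HasDerivAt.fun_sum fun p (_ : p ∈ Finset.univ) => (hA p).mul (hg p)).congr_deriv ?_
  rw [Finset.mul_sum, ← Finset.sum_add_distrib]
  exact Finset.sum_congr rfl fun p _ => by ring

theorem isBigO_laurent {g : ℂ → ℂ} {x : ℂ} (hg : AnalyticAt ℂ g x) :
    (fun y => (y - x)⁻¹ * g y - (g x / (y - x) + deriv g x)) =O[𝓝[≠] x] fun y => y - x := by
  obtain ⟨p, hp⟩ := hg
  have hd := hp.has_fpower_series_dslope_fslope.analyticAt.differentiableAt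
  refine (hd.isBigO_sub.mono nhdsWithin_le_nhds).congr' ?_ .rfl
  filter_upwards [self_mem_nhdsWithin] with y hy
  have : y - x ≠ 0 := sub_ne_zero.mpr hy
  rw [dslope_same, dslope_of_ne _ hy, slope_def_field]
  field_simp
  ring

/-- Solutions of the linear system have a simple pole where the system has a nontrivial kernel. -/
theorem exists_pole_expansion (hε : 0 < ε) {A : ℂ → Matrix (Fin P) (Fin P) ℂ} {b : ℂ → Fin P → ℂ}
    {l : ℂ} (hl : l ≠ 0)
    (hA : ∀ᶠ y in 𝓝 l, ∀ q p,
      HasDerivAt (fun y => A y q p) (I / (ε * y) * b y q - I / ε * (A y q p * z p)) y)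
    (hb : AnalyticAt ℂ b l) (hker : ∀ ψ, A l *ᵥ ψ = 0 → ∑ p, ψ p = 0 → ψ = 0)
    (hran : ∀ ψ, A l *ᵥ ψ ≠ b l) {v : ℂ → Fin P → ℂ} (hv : MeromorphicAt v l)
    (hvA : ∀ᶠ y in 𝓝[≠] l, A y *ᵥ v y = b y) :
    ∃ g : ℂ → Fin P → ℂ, AnalyticAt ℂ g l ∧ (∀ᶠ y in 𝓝[≠] l, v y = (y - l)⁻¹ • g y) ∧
      (∀ᶠ y in 𝓝 l, A y *ᵥ g y = (y - l) • b y) ∧ ∑ p, g l p = -(I * ε * l) ∧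
      (A l *ᵥ fun p => deriv g l p - I / ε * (z p * g l p)) = 0 := by
  have hε' : (ε : ℂ) ≠ 0 := by exact_mod_cast hε.ne'
  have hI := I_ne_zero
  have hA0 := hA.self_of_nhds
  have hbc : ∀ q, ContinuousAt (fun y => b y q) l := fun q =>
    (continuousAt_pi.mp hb.continuousAt) q
  have hmc : ∀ {g : ℂ → Fin P → ℂ}, AnalyticAt ℂ g l → ∀ q,
      ContinuousAt (fun y => (A y *ᵥ g y) q) l := fun hg q =>
    (hasDerivAt_mulVec (hA0 q) (hasDerivAt_pi.mp hg.differentiableAt.hasDerivAt)).continuousAt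
  have huniq : ∀ {f h : ℂ → ℂ}, ContinuousAt f l → ContinuousAt h l →
      (∀ᶠ y in 𝓝[≠] l, f y = h y) → f l = h l := fun hf hh he =>
    tendsto_nhds_unique ((hf.tendsto.mono_left nhdsWithin_le_nhds).congr' he)
      (hh.tendsto.mono_left nhdsWithin_le_nhds)
  -- If `v` vanished near `l`, so would `b` at `l`; but the range of `A l` contains 0 and not `b l`.
  have hne_top : meromorphicOrderAt v l ≠ ⊤ := by
    intro htop
    refine hran 0 ?_
    ext q
    have h1 := huniq (f := fun _ => 0) continuousAt_const (hbc q) (by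
      filter_upwards [hvA, meromorphicOrderAt_eq_top_iff.mp htop] with y hy hy0
      rw [← hy, hy0, Matrix.mulVec_zero, Pi.zero_apply])
    rw [Matrix.mulVec_zero, ← h1, Pi.zero_apply]
  obtain ⟨k, hk⟩ := WithTop.ne_top_iff_exists.mp hne_top
  obtain ⟨g, hg, hg0, hvg⟩ := (meromorphicOrderAt_eq_int_iff hv).mp hk.symm
  have hgA : ∀ᶠ y in 𝓝[≠] l, (y - l) ^ k • (A y *ᵥ g y) = b y := by
    filter_upwards [hvA, hvg] with y h1 h2
    rw [← h1, h2, Matrix.mulVec_smul]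
  -- Without a pole, `v` would have a limit at `l`, and this limit would solve the singular system.
  have hk0 : k < 0 := by
    by_contra hk0
    obtain ⟨n, rfl⟩ := Int.eq_ofNat_of_zero_le (not_lt.mp hk0)
    refine hran (((0 : ℂ) ^ n) • g l) ?_
    ext q
    have := huniq (f := fun y => (y - l) ^ n * (A y *ᵥ g y) q)
      (ContinuousAt.mul (by fun_prop) (hmc hg q)) (hbc q) (by
        filter_upwards [hgA] with y hy
        have := congrFun hy q
        simpa using this)
    simpa [Matrix.mulVec_smul] using this
  obtain ⟨n, rfl⟩ : ∃ n : ℕ, k = -(n + 1 : ℤ) := ⟨(-k - 1).toNat, by omega⟩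
  have hgA' : ∀ᶠ y in 𝓝[≠] l, A y *ᵥ g y = (y - l) ^ (n + 1) • b y := by
    filter_upwards [hgA, self_mem_nhdsWithin] with y h1 hy
    have h0 : y - l ≠ 0 := sub_ne_zero.mpr hy
    rw [← h1, zpow_neg, smul_smul]
    have : (y - l) ^ (n + 1 : ℤ) = (y - l) ^ (n + 1) := by
      rw [← zpow_natCast]; push_cast; rfl
    rw [this, mul_inv_cancel₀ (pow_ne_zero _ h0), one_smul]
  have hgl : A l *ᵥ g l = 0 := by
    ext q
    have := huniq (h := fun y => (y - l) ^ (n + 1) * b y q) (hmc hg q)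
      (ContinuousAt.mul (by fun_prop) (hbc q)) (by
        filter_upwards [hgA'] with y hy
        rw [hy, Pi.smul_apply, smul_eq_mul])
    simpa using this
  have hgA2 : ∀ᶠ y in 𝓝 l, A y *ᵥ g y = (y - l) ^ (n + 1) • b y := by
    rw [eventually_nhdsWithin_iff] at hgA'
    filter_upwards [hgA'] with y hy
    by_cases hyl : y = l
    · rw [hyl, hgl]; simp
    · exact hy hyl
  have hσ : ∑ p, g l p ≠ 0 := fun h => hg0 (hker _ hgl h)
  have hfirst : (A l *ᵥ fun p => deriv g l p - I / ε * (z p * g l p))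
      = ((n + 1) * 0 ^ n - I / (ε * l) * ∑ p, g l p) • b l := by
    ext q
    have h1 := hasDerivAt_mulVec (hA0 q) (hasDerivAt_pi.mp hg.differentiableAt.hasDerivAt)
    have h2 : HasDerivAt (fun y => (y - l) ^ (n + 1) * b y q)
        ((n + 1) * (l - l) ^ n * b l q + (l - l) ^ (n + 1) * deriv b l q) l := by
      have h3 := ((hasDerivAt_id l).sub_const l).pow (n + 1)
      refine (h3.mul (hasDerivAt_pi.mp hb.differentiableAt.hasDerivAt q)).congr_deriv ?_
      simp
    have h3 := (h1.congr_of_eventuallyEq (hgA2.mono fun y hy => by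
      beta_reduce; rw [hy, Pi.smul_apply, smul_eq_mul])).unique h2
    simp only [sub_self, ne_eq, Nat.succ_ne_zero, not_false_eq_true, zero_pow, zero_mul,
      add_zero] at h3
    rw [Pi.smul_apply, smul_eq_mul]
    linear_combination h3
  -- The derivative at `l` exhibits a multiple of `b l` in the range of `A l`, so its coefficient
  -- vanishes. For `n > 0` only the sum of the entries of `g l` remains, which is nonzero on the
  -- kernel; for `n = 0` the sum is determined.
  have hcoef : ((n : ℂ) + 1) * 0 ^ n - I / (ε * l) * ∑ p, g l p = 0 := by
    by_contra h
    refine hran ((((n : ℂ) + 1) * 0 ^ n - I / (ε * l) * ∑ p, g l p)⁻¹ •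
      fun p => deriv g l p - I / ε * (z p * g l p)) ?_
    rw [Matrix.mulVec_smul, hfirst, inv_smul_smul₀ h]
  have hn : n = 0 := by
    by_contra hn
    rw [zero_pow hn, mul_zero, zero_sub, neg_eq_zero] at hcoef
    exact (mul_ne_zero (div_ne_zero hI (mul_ne_zero hε' hl)) hσ) hcoef
  subst hn
  refine ⟨g, hg, ?_, ?_, ?_, ?_⟩
  · filter_upwards [hvg] with y hy
    simpa using hy
  · simpa using hgA2
  · simp only [CharP.cast_eq_zero, zero_add, pow_zero, mul_one] at hcoef
    field_simp at hcoef
    linear_combination I * hcoef + (∑ p, g l p) * I_sq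
  · rw [hfirst, hcoef, zero_smul]

/-- The second coefficient of the expansion at the pole. -/
theorem pole_expansion_second (hε : 0 < ε) {A : ℂ → Matrix (Fin P) (Fin P) ℂ}
    {b : ℂ → Fin P → ℂ} {l : ℂ} (hl : l ≠ 0)
    (hA : ∀ᶠ y in 𝓝 l, ∀ q p,
      HasDerivAt (fun y => A y q p) (I / (ε * y) * b y q - I / ε * (A y q p * z p)) y)
    (hb : AnalyticAt ℂ b l) {g : ℂ → Fin P → ℂ} (hg : AnalyticAt ℂ g l)
    (hgA : ∀ᶠ y in 𝓝 l, A y *ᵥ g y = (y - l) • b y) {φ μ : Fin P → ℂ} {G : ℂ}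
    (hφ : ∑ p, φ p = l) (hg0 : ∀ p, g l p = -(I * ε) * φ p)
    (hg1 : ∀ p, deriv g l p - I / ε * (z p * g l p) = G * φ p)
    (hm : μ ᵥ* A l = 0) (hmb : μ ⬝ᵥ b l ≠ 0) : G = gammaConst ε z b l φ μ := by
  have hε' : (ε : ℂ) ≠ 0 := by exact_mod_cast hε.ne'
  have hI := I_ne_zero
  have hA0 := hA.self_of_nhds
  -- The first derivative of `A g = (y - l) b` is an equation for `A h`. It is differentiated once
  -- more at `l`; pairing with the left null vector `μ` then removes the terms in the range of `A
  -- l`, including the unknown second derivative of `g`, and a scalar linear equation for `G` is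
  -- left.
  set h : ℂ → Fin P → ℂ := fun y p => deriv g y p - I / ε * (z p * g y p) with hh
  have hga : ∀ p, AnalyticAt ℂ (fun y => g y p) l := analyticAt_pi_iff.mp hg
  have hgd : ∀ p, AnalyticAt ℂ (fun y => deriv g y p) l := analyticAt_pi_iff.mp hg.deriv
  have hba : ∀ p, AnalyticAt ℂ (fun y => b y p) l := analyticAt_pi_iff.mp hb
  have hbd : ∀ p, AnalyticAt ℂ (fun y => deriv b y p) l := analyticAt_pi_iff.mp hb.deriv
  have hg' : ∀ p, HasDerivAt (fun y => g y p) (deriv g l p) l :=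
    hasDerivAt_pi.mp hg.differentiableAt.hasDerivAt
  have hb' : ∀ p, HasDerivAt (fun y => b y p) (deriv b l p) l :=
    hasDerivAt_pi.mp hb.differentiableAt.hasDerivAt
  have hha : ∀ p, HasDerivAt (fun y => h y p) (deriv (fun y => h y p) l) l := fun p =>
    ((hgd p).sub (analyticAt_const.mul (analyticAt_const.mul (hga p)))).differentiableAt.hasDerivAt
  have hid : ∀ q, ∀ᶠ y in 𝓝 l, (A y *ᵥ h y) q
      = b y q + (y - l) * deriv b y q - I / (ε * y) * b y q * ∑ p, g y p := by
    intro q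
    filter_upwards [hA, eventually_eventually_nhds.mpr hgA, hg.eventually_analyticAt,
      hb.eventually_analyticAt] with y hy1 hy2 hy3 hy4
    have h1 := hasDerivAt_mulVec (hy1 q) (hasDerivAt_pi.mp hy3.differentiableAt.hasDerivAt)
    have h2 : HasDerivAt (fun y => (y - l) * b y q) (1 * b y q + (y - l) * deriv b y q) y :=
      ((hasDerivAt_id y).sub_const l).mul (hasDerivAt_pi.mp hy4.differentiableAt.hasDerivAt q)
    have h3 := (h1.congr_of_eventuallyEq (hy2.mono fun y hy => by
      beta_reduce; rw [hy, Pi.smul_apply, smul_eq_mul])).unique h2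
    linear_combination h3
  have hS : ∑ p, g l p = -(I * ε) * l := by
    simp_rw [hg0]
    rw [← Finset.mul_sum, hφ]
  have hS' : ∑ p, deriv g l p = ∑ p, z p * φ p + G * l := by
    have h1 : G * l = ∑ p, G * φ p := by rw [← Finset.mul_sum, hφ]
    rw [h1, ← Finset.sum_add_distrib]
    refine Finset.sum_congr rfl fun p _ => ?_
    rw [← hg1 p, hg0 p]
    field_simp
    rw [I_sq]
    ring
  have hhs : ∑ p, h l p = G * l := by
    have h1 : G * l = ∑ p, G * φ p := by rw [← Finset.mul_sum, hφ]
    rw [h1]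
    exact Finset.sum_congr rfl fun p _ => hg1 p
  have hq : ∀ q, I / (ε * l) * b l q * ∑ p, h l p
        + (A l *ᵥ fun p => deriv (fun y => h y p) l - I / ε * (z p * h l p)) q
      = deriv b l q - I / ε * b l q * ((∑ p, deriv g l p) / l - (∑ p, g l p) / l ^ 2) := by
    intro q
    have h1 := hasDerivAt_mulVec (hA0 q) hha
    have hsum : HasDerivAt (fun y => ∑ p, g y p) (∑ p, deriv g l p) l :=
      HasDerivAt.fun_sum fun p _ => hg' p
    have h2 := ((hb' q).add (((hasDerivAt_id l).sub_const l).mul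
      (hbd q).differentiableAt.hasDerivAt)).sub
      ((((hasDerivAt_const l I).div ((hasDerivAt_id l).const_mul (ε : ℂ))
        (mul_ne_zero hε' hl)).mul (hb' q)).mul hsum)
    have h3 := (h1.congr_of_eventuallyEq (EventuallyEq.symm (hid q))).unique h2
    rw [h3, hS]
    simp only [id, Pi.div_apply, Pi.mul_apply]
    field_simp
    linear_combination l * ε * deriv b l q * I_sq
  have hdot : μ ⬝ᵥ (A l *ᵥ fun p => deriv (fun y => h y p) l - I / ε * (z p * h l p)) = 0 := by
    rw [Matrix.dotProduct_mulVec, hm, zero_dotProduct]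
  have hfin : I / (ε * l) * (μ ⬝ᵥ b l) * (G * l)
      = μ ⬝ᵥ deriv b l - I / ε * (μ ⬝ᵥ b l) *
        ((∑ p, z p * φ p + G * l) / l - (-(I * ε) * l) / l ^ 2) := by
    have h1 : ∀ q, μ q * (A l *ᵥ fun p => deriv (fun y => h y p) l - I / ε * (z p * h l p)) q
        = μ q * deriv b l q - I / ε * (μ q * b l q) *
          ((∑ p, z p * φ p + G * l) / l - (-(I * ε) * l) / l ^ 2)
          - I / (ε * l) * (μ q * b l q) * (G * l) := fun q => by
      have := hq q
      rw [hhs, hS, hS'] at this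
      linear_combination μ q * this
    have h2 := hdot
    simp only [dotProduct] at h2 ⊢
    rw [Finset.sum_congr rfl fun q _ => h1 q] at h2
    simp only [Finset.sum_sub_distrib, ← Finset.sum_mul, ← Finset.mul_sum] at h2
    linear_combination -h2
  unfold gammaConst
  generalize μ ⬝ᵥ b l = B at *
  generalize μ ⬝ᵥ deriv b l = B' at *
  generalize ∑ p, z p * φ p = S at *
  field_simp at hfin ⊢
  linear_combination -I * hfin + (2 * l * B * G + B * S + B * I * ε) * I_sq

end

end BenjaminOno

namespace BenjaminOno
open Complex Set Filter MeasureTheory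

noncomputable section

variable {P : ℕ} {ε : ℝ} {c z : Fin P → ℂ} {m : Fin P}

/-! ### The singular points of the linear system -/

/-- The sum of the entries is injective on the kernel, so the kernel has dimension at most 1 and the
range codimension at most 1. The range lies in the hyperplane orthogonal to `μ`, and therefore
equals it. -/
theorem exists_mulVec_eq_of_dotProduct_eq_zero {M : Matrix (Fin P) (Fin P) ℂ} {b μ : Fin P → ℂ}
    (hker : ∀ ψ, M *ᵥ ψ = 0 → ∑ p, ψ p = 0 → ψ = 0) (hμ : μ ≠ 0) (hμM : μ ᵥ* M = 0)
    (hμb : μ ⬝ᵥ b = 0) : ∃ ψ, M *ᵥ ψ = b := by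
  set s : (Fin P → ℂ) →ₗ[ℂ] ℂ := ∑ p, LinearMap.proj p with hs
  set D : (Fin P → ℂ) →ₗ[ℂ] ℂ := ∑ p, μ p • LinearMap.proj p with hD
  have hsa : ∀ ψ, s ψ = ∑ p, ψ p := fun ψ => by simp [hs]
  have hDa : ∀ ψ, D ψ = μ ⬝ᵥ ψ := fun ψ => by simp [hD, dotProduct]
  have h1 : Module.finrank ℂ (LinearMap.ker M.mulVecLin) ≤ 1 := by
    have hinj : Function.Injective (s.domRestrict (LinearMap.ker M.mulVecLin)) := by
      rw [← LinearMap.ker_eq_bot, LinearMap.ker_eq_bot']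
      rintro ⟨ψ, hψ⟩ h
      have h' : s ψ = 0 := h
      rw [hsa] at h'
      exact Subtype.ext (hker ψ (by simpa using hψ) h')
    simpa using LinearMap.finrank_le_finrank_of_injective hinj
  have h2 := LinearMap.finrank_range_add_finrank_ker M.mulVecLin
  have hD0 : D ≠ 0 := by
    intro h
    refine hμ (funext fun p => ?_)
    have := hDa (Pi.single p 1)
    rw [h] at this
    simpa using this.symm
  have h3 := Module.Dual.finrank_ker_add_one_of_ne_zero (f := D) hD0
  have hle : LinearMap.range M.mulVecLin ≤ LinearMap.ker D := by
    rintro _ ⟨ψ, rfl⟩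
    rw [LinearMap.mem_ker, hDa, Matrix.mulVecLin_apply, Matrix.dotProduct_mulVec, hμM,
      zero_dotProduct]
  have heq := Submodule.eq_of_le_of_finrank_le hle (by omega)
  have hb : b ∈ LinearMap.range M.mulVecLin := by
    rw [heq, LinearMap.mem_ker, hDa, hμb]
  obtain ⟨ψ, hψ⟩ := hb
  exact ⟨ψ, by simpa using hψ⟩

section System

variable {A : ℂ → Matrix (Fin P) (Fin P) ℂ} {b : ℂ → Fin P → ℂ}

theorem IsContinuedA.mulVec_eq_zero_iff (hA : IsContinuedA ε c z A) (hε : 0 < ε)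
    (hz : ∀ p, 0 < (z p).im) (hre : StrictMono fun p => (z p).re) {lam : ℂ} (hl : lam ∈ cutPlane)
    (φ : Fin P → ℂ) : A lam *ᵥ φ = 0 ↔ ∀ m, sysInt ε c z m (rat z 0 φ 0) lam = 0 := by
  rw [funext_iff]
  simp only [hA.mulVec_eq hε hz hre hl, Pi.zero_apply]

theorem IsContinuedA.det_eq_zero_iff (hA : IsContinuedA ε c z A) (hε : 0 < ε)
    (hz : ∀ p, 0 < (z p).im) (hre : StrictMono fun p => (z p).re) {lam : ℂ} (hl : lam ∈ cutPlane) :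
    (A lam).det = 0 ↔ lam ∈ eigenvalues ε (potential c z) := by
  rw [← Matrix.exists_mulVec_eq_zero_iff]
  simp only [hA.mulVec_eq_zero_iff hε hz hre hl]
  refine ⟨fun ⟨φ, hφ, h⟩ => isEigenvalue_of_kernel hε hz hre hl hφ h, ?_⟩
  rintro ⟨r, hr, rfl⟩
  exact exists_kernel_of_isEigenvalue hε hz hre hr

theorem IsContinuedA.eq_zero_of_sum_eq_zero (hA : IsContinuedA ε c z A) (hε : 0 < ε)
    (hz : ∀ p, 0 < (z p).im) (hre : StrictMono fun p => (z p).re) {lam : ℂ} (hl : lam ∈ cutPlane)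
    {φ : Fin P → ℂ} (h : A lam *ᵥ φ = 0) (hs : ∑ p, φ p = 0) : φ = 0 := by
  by_contra hφ
  exact sum_ne_zero_of_kernel hε hz hre hl hφ ((hA.mulVec_eq_zero_iff hε hz hre hl φ).mp h) hs

theorem mem_cutPlane_of_mem_eigenvalues {u : ℝ → ℂ} {lam : ℂ} (h : lam ∈ eigenvalues ε u) :
    lam ∈ cutPlane := by
  obtain ⟨r, hr, rfl⟩ := h
  exact neg_mem_cutPlane hr.1

theorem mulVec_ne_of_mem_eigenvalues (hA : IsContinuedA ε c z A) (hb : IsContinuedB ε c z b)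
    (hε : 0 < ε) (hz : ∀ p, 0 < (z p).im) (hre : StrictMono fun p => (z p).re) {lam : ℂ}
    (h : lam ∈ eigenvalues ε (potential c z)) (ψ : Fin P → ℂ) : A lam *ᵥ ψ ≠ b lam := by
  intro hψ
  have hl := mem_cutPlane_of_mem_eigenvalues h
  obtain ⟨φ, hφ, hk⟩ := Matrix.exists_mulVec_eq_zero_iff.mpr
    ((hA.det_eq_zero_iff hε hz hre hl).mpr h)
  refine not_solvable_of_kernel (v := ψ) hε hz hre hl hφ
    ((hA.mulVec_eq_zero_iff hε hz hre hl φ).mp hk) fun m => ?_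
  rw [← hA.mulVec_eq hε hz hre hl, hψ, hb.eq_sysInt hε hz hre m hl]

theorem IsContinuedA.analyticAt (hA : IsContinuedA ε c z A) {lam : ℂ} (hl : lam ∈ cutPlane)
    (i j : Fin P) : AnalyticAt ℂ (fun y => A y i j) lam := (hA i j).1 lam hl

theorem IsContinuedB.analyticAt (hb : IsContinuedB ε c z b) {lam : ℂ} (hl : lam ∈ cutPlane)
    (i : Fin P) : AnalyticAt ℂ (fun y => b y i) lam := (hb i).1 lam hl

/-- The determinant vanishes only at real parameters; points on the vertical line through `lam` show
that it is not identically zero near `lam`. -/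
theorem eventually_det_ne_zero (hA : IsContinuedA ε c z A) (hε : 0 < ε)
    (hz : ∀ p, 0 < (z p).im) (hre : StrictMono fun p => (z p).re) {lam : ℂ} (hl : lam ∈ cutPlane) :
    ∀ᶠ y in 𝓝[≠] lam, (A y).det ≠ 0 := by
  refine (analyticAt_det
    (hA.analyticAt hl)).eventually_eq_zero_or_eventually_ne_zero.resolve_left fun h => ?_
  have hγ : Tendsto (fun t : ℝ => lam + (t - lam.im) * I) (𝓝[≠] lam.im) (𝓝 lam) := by
    have : Continuous fun t : ℝ => lam + (t - lam.im) * I := by fun_prop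
    simpa using (this.tendsto lam.im).mono_left nhdsWithin_le_nhds
  have h0 : ∀ᶠ t : ℝ in 𝓝[≠] lam.im, t ≠ 0 := by
    by_cases him : lam.im = 0
    · rw [him]; exact self_mem_nhdsWithin
    · exact mem_nhdsWithin_of_mem_nhds (isOpen_ne.mem_nhds him)
  obtain ⟨t, ht0, hdet, hmem⟩ := (h0.and ((hγ.eventually h).and
    (hγ.eventually (isOpen_cutPlane.mem_nhds hl)))).exists
  obtain ⟨r, -, hr⟩ := (hA.det_eq_zero_iff hε hz hre hmem).mp hdet
  have := congrArg Complex.im hr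
  simp at this
  exact ht0 this

theorem analyticAt_solution (hA : IsContinuedA ε c z A) (hb : IsContinuedB ε c z b)
    {v : ℂ → Fin P → ℂ} (hv : ∀ lam ∈ cutPlane, (A lam).det ≠ 0 → A lam *ᵥ v lam = b lam) {lam : ℂ}
    (hl : lam ∈ cutPlane) (hdet : (A lam).det ≠ 0) : AnalyticAt ℂ v lam := by
  obtain ⟨g, hg, hgv⟩ := exists_analyticAt_det_smul (hA.analyticAt hl) (hb.analyticAt hl)
  have hd := analyticAt_det (hA.analyticAt hl)
  refine ((hd.inv hdet).smul hg).congr ?_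
  filter_upwards [hd.continuousAt.eventually_ne hdet, isOpen_cutPlane.mem_nhds hl] with y h1 h2
  exact (hgv y (v y) h1 (hv y h2 h1)).symm

theorem meromorphicAt_solution (hA : IsContinuedA ε c z A) (hb : IsContinuedB ε c z b)
    (hε : 0 < ε) (hz : ∀ p, 0 < (z p).im) (hre : StrictMono fun p => (z p).re)
    {v : ℂ → Fin P → ℂ} (hv : ∀ lam ∈ cutPlane, (A lam).det ≠ 0 → A lam *ᵥ v lam = b lam) {lam : ℂ}
    (hl : lam ∈ cutPlane) : MeromorphicAt v lam := by
  obtain ⟨g, hg, hgv⟩ := exists_analyticAt_det_smul (hA.analyticAt hl) (hb.analyticAt hl)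
  have hd := analyticAt_det (hA.analyticAt hl)
  refine (hd.meromorphicAt.inv.smul hg.meromorphicAt).congr ?_
  filter_upwards [eventually_det_ne_zero hA hε hz hre hl,
    mem_nhdsWithin_of_mem_nhds (isOpen_cutPlane.mem_nhds hl)] with y h1 h2
  exact (hgv y (v y) h1 (hv y h2 h1)).symm

/-- The sum of the entries is nonzero on nonzero kernel vectors, so it can be scaled to `lam`, and
the difference of two normalized kernel vectors has sum 0. -/
theorem existsUnique_kernel (hA : IsContinuedA ε c z A) (hε : 0 < ε) (hz : ∀ p, 0 < (z p).im)
    (hre : StrictMono fun p => (z p).re) {lam : ℂ} (h : lam ∈ eigenvalues ε (potential c z)) :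
    ∃! φ : Fin P → ℂ, A lam *ᵥ φ = 0 ∧ ∑ p, φ p = lam := by
  have hl := mem_cutPlane_of_mem_eigenvalues h
  obtain ⟨φ, hφ, hk⟩ := Matrix.exists_mulVec_eq_zero_iff.mpr
    ((hA.det_eq_zero_iff hε hz hre hl).mpr h)
  have hs : ∑ p, φ p ≠ 0 := fun hs => hφ (hA.eq_zero_of_sum_eq_zero hε hz hre hl hk hs)
  refine ⟨(lam / ∑ p, φ p) • φ, ⟨by rw [Matrix.mulVec_smul, hk, smul_zero], ?_⟩, ?_⟩
  · simp only [Pi.smul_apply, smul_eq_mul, ← Finset.mul_sum]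
    exact div_mul_cancel₀ _ hs
  · rintro ψ ⟨h1, h2⟩
    refine sub_eq_zero.mp (hA.eq_zero_of_sum_eq_zero hε hz hre hl ?_ ?_)
    · rw [Matrix.mulVec_sub, Matrix.mulVec_smul, h1, hk, smul_zero, sub_zero]
    · simp only [Pi.sub_apply, Pi.smul_apply, smul_eq_mul, Finset.sum_sub_distrib,
        ← Finset.mul_sum, h2]
      rw [div_mul_cancel₀ _ hs, sub_self]

theorem ne_zero_of_mem_cutPlane {lam : ℂ} (hl : lam ∈ cutPlane) : lam ≠ 0 := by
  rintro rfl
  simpa using mem_cutPlane_iff.mp hl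

/-- The Laurent expansion of the solution at an eigenvalue. -/
theorem exists_solution_expansion (hA : IsContinuedA ε c z A) (hb : IsContinuedB ε c z b)
    (hε : 0 < ε) (hz : ∀ p, 0 < (z p).im) (hre : StrictMono fun p => (z p).re)
    {v : ℂ → Fin P → ℂ} (hv : ∀ lam ∈ cutPlane, (A lam).det ≠ 0 → A lam *ᵥ v lam = b lam) {lam : ℂ}
    (h : lam ∈ eigenvalues ε (potential c z)) :
    ∃ g : ℂ → Fin P → ℂ, AnalyticAt ℂ g lam ∧ (∀ᶠ y in 𝓝[≠] lam, v y = (y - lam)⁻¹ • g y) ∧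
      g lam ≠ 0 ∧ ∀ φ μ : Fin P → ℂ, A lam *ᵥ φ = 0 → ∑ p, φ p = lam → μ ≠ 0 → μ ᵥ* A lam = 0 →
        μ ⬝ᵥ b lam ≠ 0 ∧ ∀ p, g lam p = -(I * ε) * φ p ∧
          deriv g lam p = (z p + gammaConst ε z b lam φ μ) * φ p := by
  have hl := mem_cutPlane_of_mem_eigenvalues h
  have hl0 := ne_zero_of_mem_cutPlane hl
  have hε' : (ε : ℂ) ≠ 0 := by exact_mod_cast hε.ne'
  have hAd : ∀ᶠ y in 𝓝 lam, ∀ q p,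
      HasDerivAt (fun y => A y q p) (I / (ε * y) * b y q - I / ε * (A y q p * z p)) y := by
    filter_upwards [isOpen_cutPlane.mem_nhds hl] with y hy q p
    exact hA.hasDerivAt hb hε hz hre hy q p
  have hba : AnalyticAt ℂ b lam := analyticAt_pi_iff.mpr (hb.analyticAt hl)
  have hker := fun ψ => hA.eq_zero_of_sum_eq_zero hε hz hre hl (φ := ψ)
  have hran := mulVec_ne_of_mem_eigenvalues hA hb hε hz hre h
  have hvA : ∀ᶠ y in 𝓝[≠] lam, A y *ᵥ v y = b y := by
    filter_upwards [eventually_det_ne_zero hA hε hz hre hl,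
      mem_nhdsWithin_of_mem_nhds (isOpen_cutPlane.mem_nhds hl)] with y h1 h2
    exact hv y h2 h1
  obtain ⟨g, hg, hvg, hgA, hσ, hh⟩ := exists_pole_expansion hε hl0 hAd hba hker hran
    (meromorphicAt_solution hA hb hε hz hre hv hl) hvA
  refine ⟨g, hg, hvg, fun h0 => ?_, fun φ μ hφ hφs hμ hμA => ?_⟩
  · rw [h0] at hσ
    simp [hε', hl0] at hσ
  have hmb : μ ⬝ᵥ b lam ≠ 0 := fun h0 => by
    obtain ⟨ψ, hψ⟩ := exists_mulVec_eq_of_dotProduct_eq_zero hker hμ hμA h0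
    exact hran ψ hψ
  -- A kernel vector is determined by the sum of its entries. This is applied to the leading
  -- coefficient `g lam` and to the vector built from the next coefficient.
  have hspan : ∀ ψ, A lam *ᵥ ψ = 0 → ∀ p, ψ p = (∑ p, ψ p) / lam * φ p := by
    intro ψ hψ p
    have := hker (ψ - ((∑ p, ψ p) / lam) • φ)
      (by rw [Matrix.mulVec_sub, Matrix.mulVec_smul, hψ, hφ, smul_zero, sub_zero]) (by
        simp only [Pi.sub_apply, Pi.smul_apply, smul_eq_mul, Finset.sum_sub_distrib,
          ← Finset.mul_sum, hφs]
        rw [div_mul_cancel₀ _ hl0, sub_self])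
    exact sub_eq_zero.mp (congrFun this p)
  have hgl : A lam *ᵥ g lam = 0 := by simpa using hgA.self_of_nhds
  have hg0 : ∀ p, g lam p = -(I * ε) * φ p := fun p => by
    rw [hspan _ hgl p, hσ]
    field_simp
  have hg1 := hspan _ hh
  have hG := pole_expansion_second hε hl0 hAd hba hg hgA hφs hg0 hg1 hμA hmb
  refine ⟨hmb, fun p => ⟨hg0 p, ?_⟩⟩
  have := hg1 p
  rw [hG, hg0 p] at this
  rw [add_mul, ← this]
  field_simp
  rw [I_sq]
  ring

end System

end

end BenjaminOno

/-! ### The theorem -/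

open BenjaminOno in
theorem proposition3p4 (P : ℕ) (ε : ℝ) (hε : 0 < ε) (c z : Fin P → ℂ)
    (hc : ∀ p, c p ≠ 0) (hz : ∀ p, 0 < (z p).im)
    (hre : StrictMono fun p => (z p).re)
    (hsum : ∑ p, (c p + conj (c p)) = 0) :
    -- the continuations of the system to the cut plane exist
    (∃ A, IsContinuedA ε c z A) ∧ (∃ b, IsContinuedB ε c z b) ∧
    ∀ (A : ℂ → Matrix (Fin P) (Fin P) ℂ) (b : ℂ → Fin P → ℂ),
      IsContinuedA ε c z A → IsContinuedB ε c z b →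
      -- the system is singular exactly at the eigenvalues
      (∀ lam ∈ cutPlane, (A lam).det = 0 ↔ lam ∈ eigenvalues ε (potential c z)) ∧
      ∀ v : ℂ → Fin P → ℂ,
        (∀ lam ∈ cutPlane, (A lam).det ≠ 0 → A lam *ᵥ v lam = b lam) →
        -- analyticity away from the eigenvalues
        (∀ p, AnalyticOnNhd ℂ (fun lam => v lam p)
          (cutPlane \ eigenvalues ε (potential c z))) ∧
        ∀ lamj ∈ eigenvalues ε (potential c z),
          -- a simple pole
          meromorphicOrderAt v lamj = -1 ∧
          (∃! φ : Fin P → ℂ, A lamj *ᵥ φ = 0 ∧ ∑ p, φ p = lamj) ∧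
          (∃ m : Fin P → ℂ, m ≠ 0 ∧ m ᵥ* A lamj = 0) ∧
          ∀ φ m : Fin P → ℂ, A lamj *ᵥ φ = 0 → ∑ p, φ p = lamj →
            m ≠ 0 → m ᵥ* A lamj = 0 →
            m ⬝ᵥ b lamj ≠ 0 ∧
            ∀ p,
              MeromorphicAt (fun lam => v lam p) lamj ∧
              (φ p ≠ 0 → meromorphicOrderAt (fun lam => v lam p) lamj = -1) ∧
              (fun lam => v lam p - (-(Complex.I * ε) * (φ p / (lam - lamj))
                + (z p + gammaConst ε z b lamj φ m) * φ p))
                =O[𝓝[≠] lamj] fun lam => lam - lamj := by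
  refine ⟨⟨_, isContinuedA_sysInt hε hz hre⟩, ⟨_, isContinuedB_sysInt hε hz hre⟩,
    fun A b hA hb => ⟨fun lam hl => hA.det_eq_zero_iff hε hz hre hl, fun v hv =>
      ⟨fun p lam hl => ?_, fun lamj hj => ?_⟩⟩⟩
  · exact analyticAt_pi_iff.mp (analyticAt_solution hA hb hv hl.1 fun hdet =>
      hl.2 ((hA.det_eq_zero_iff hε hz hre hl.1).mp hdet)) p
  have hl := mem_cutPlane_of_mem_eigenvalues hj
  obtain ⟨g, hg, hvg, hg0, hexp⟩ := exists_solution_expansion hA hb hε hz hre hv hj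
  have hmer := meromorphicAt_solution hA hb hε hz hre hv hl
  refine ⟨?_, existsUnique_kernel hA hε hz hre hj, Matrix.exists_vecMul_eq_zero_iff.mpr
    ((hA.det_eq_zero_iff hε hz hre hl).mpr hj), fun φ m hφ hφs hm hmA => ?_⟩
  · refine (meromorphicOrderAt_eq_int_iff (n := -1) hmer).mpr ⟨g, hg, hg0, ?_⟩
    filter_upwards [hvg] with y hy
    rw [hy, zpow_neg_one]
  obtain ⟨hmb, hcoef⟩ := hexp φ m hφ hφs hm hmA
  refine ⟨hmb, fun p => ?_⟩
  have hgp : AnalyticAt ℂ (fun y => g y p) lamj := analyticAt_pi_iff.mp hg p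
  have hvp : ∀ᶠ y in 𝓝[≠] lamj, v y p = (y - lamj)⁻¹ * g y p := by
    filter_upwards [hvg] with y hy
    rw [hy, Pi.smul_apply, smul_eq_mul]
  have hmp : MeromorphicAt (fun y => v y p) lamj := by
    have h1 : AnalyticAt ℂ (fun y => y - lamj) lamj := by fun_prop
    exact (h1.meromorphicAt.inv.mul hgp.meromorphicAt).congr (hvp.mono fun y hy => hy.symm)
  refine ⟨hmp, fun hφp => ?_, ?_⟩
  · refine (meromorphicOrderAt_eq_int_iff (n := -1) hmp).mpr ⟨fun y => g y p, hgp, ?_, ?_⟩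
    · beta_reduce
      rw [(hcoef p).1]
      refine mul_ne_zero (neg_ne_zero.mpr (mul_ne_zero Complex.I_ne_zero ?_)) hφp
      exact_mod_cast hε.ne'
    · filter_upwards [hvp] with y hy
      rw [hy, zpow_neg_one, smul_eq_mul]
  · have hd : deriv (fun y => g y p) lamj = deriv g lamj p :=
      (hasDerivAt_pi.mp hg.differentiableAt.hasDerivAt p).deriv
    refine (isBigO_laurent hgp).congr' ?_ .rfl
    filter_upwards [hvp] with y hy
    rw [hy, hd, (hcoef p).1, (hcoef p).2]
    ring
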